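/- Let $k$ be a perfect field of characteristic $2$, $G=\{1,g_1,g_2,g_1g_2\}$ the Klein four group, $f\in k[T]$ a monic irreducible polynomial of degree $m$, $n\ge 1$ an integer, and $K=k[\epsilon]$ the extension of $k$ generated by a root $\epsilon$ of $f$. Let $\Pi\in\mathrm{Mat}_{mn}(k)$ be the companion matrix of $f^n$ (ones on the first subdiagonal), and let $C_n(f)$ be the $kG$-module $k^{2mn}$ of column vectors, with unit vectors $e_1,\dots,e_{2mn}$, on which $$g_1=\begin{pmatrix} I&I\\0&I\end{pmatrix},\qquad g_2=\begin{pmatrix} I&\Pi\\0&I\end{pmatrix}.$$ Put $M=C_n(f)\oplus C_n(f)$, with the basis $e_1\oplus0,\dots,e_{mn}\oplus 0,\ 0\oplus e_1,\dots,0\oplus e_{mn},\ e_{mn+1}\oplus 0,\dots,e_{2mn}\oplus0,\ 0\oplus e_{mn+1},\dots,0\oplus e_{2mn}$. All matrices of forms on $M$ refer to this basis; a matrix $B$ gives the bilinear form $x^TBy$ and the quadratic form $x^TBx$. A symplectic form on $M$ is a $G$-invariant, alternating, non-degenerate bilinear form; it is indecomposable if $M$ is not an orthogonal direct sum of two proper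 $kG$-submodules on which the form is non-degenerate. Two bilinear (or quadratic) forms on $M$ are isometric if some $kG$-automorphism of $M$ carries one to the other. The bilinear form associated with a quadratic form $q$ is $q(x+y)-q(x)-q(y)$. For $x\in K$ let $H_i(x)\in\mathrm{Mat}_n(K)$ be the matrix whose $(a,b)$ entry is $x$ if $a+b=i$ and $0$ otherwise (so $H_i(x)=0$ if $i>2n$). Let $J=J_n(\epsilon)$ be the Jordan block with ones on the superdiagonal, $V'\in\mathrm{Mat}_{n\times mn}(K)$ the matrix with columns $e_n,Je_n,\dots,J^{mn-1}e_n$, and $\sigma_1,\dots,\sigma_m$ the $k$-embeddings of $K$ in an algebraic closure. For $X\in\mathrm{Mat}_n(K)$ put $$\mathcal V(X)=V^T\,\mathrm{diag}(\sigma_1(X),\dots,\sigma_m(X))\,V=\sum_i\sigma_i(V'^TXV')\in\mathrm{Mat}_{mn}(k),$$ where $V$ is obtained by stacking $\sigma_1(V'),\dots,\sigma_m(V')$. Put $$S(\varphi,\psi,\mu)=\begin{pmatrix}0&\sigma\\ \sigma&0\end{pmatrix},\qquad \sigma=\begin{pmatrix}\mathcal V(\varphi)&\mathcal V(\psi)\\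 \mathcal V(\psi)&\mathcal V(\mu)\end{pmatrix}.$$ Let $\mathcal K$ be the set of triples $(\varphi,\psi,\mu)$ with $$\varphi=H_{n+r}(1)+\sum_{i\in\{1,3,\dots,2s-1\}}H_{n+r+i}(\varphi_i),\quad \psi=H_{n+1}(1)+\sum_{i=1}^tH_{n+i}(\psi_i),\quad \mu=H_{n+r+2s+1}(1),$$ where $r,s$ are integers with $2\le r\le n+1$ and $0\le s\le\frac{n-r+1}2$, $t=\lfloor\frac{n-r-2s+1}2\rfloor$, $\varphi_i,\psi_i\in K$, and $\psi_1\ne1$ if $t\ge1$. Let $\mathcal P\subseteq k$ be a full set of representatives of the cosets of $\{x^2+x:x\in k\}$ in $(k,+)$. (a) Every $S(\varphi,\psi,\mu)$ with $(\varphi,\psi,\mu)\in\mathcal K$ is an indecomposable symplectic form on $M$, and every indecomposable symplectic form on $M$ is isometric to $S(\varphi,\psi,\mu)$ for exactly one $(\varphi,\psi,\mu)\in\mathcal K$. Different labels $(r,s,(\varphi_i),(\psi_i))$ give different triples in $\mathcal K$. If $k$ is finite, the number of isometry classes of indecomposable symplectic forms on $M$ is $n|k|^{m(n-2)/2}$ if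 $n$ is even, and $\frac{n+1}2|k|^{m(n-1)/2}+\frac{n-1}2|k|^{m(n-3)/2}$ if $n$ is odd. (b) Let $(\varphi,\psi,\mu)\in\mathcal K$, with $r,s,\varphi_i$ as above, and $S=S(\varphi,\psi,\mu)$. There is a $G$-invariant quadratic form on $M$ with associated bilinear form $S$ if and only if $\mu=0$ and one of the following holds: (1) $\varphi=0$; (2) $n+r$ is even, $f\in\{T,T+1\}$, $\varphi_1=1$ if $s\ge1$, and $\varphi_i=0$ for all odd $i\in\{3,\dots,2s-1\}$; (3) $n+r$ is odd, $f\notin\{T,T+1\}$, and $\varphi_i=(\epsilon+\epsilon^2)^{-(i+1)/2}$ for all odd $i\in\{1,\dots,2s-1\}$. In this case these quadratic forms are exactly the forms $Q_\sigma(D')=\begin{pmatrix}D&\sigma\\0&D'\end{pmatrix}$, where $D'\in\mathrm{Mat}_{2mn}(k)$ is any diagonal matrix and $D$ is the diagonal matrix with the same diagonal as $\sigma$. If $\varphi=\mu=0$, they form a single isometry class, represented by $Q_\sigma(0)$. Otherwise let $\eta=\sigma^{-1}D\sigma^{-T}$; then $\eta_{u,u}\ne0$ for some $u\in\{1,\dots,2mn\}$,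 and for each such $u$ the forms $Q_\sigma(E_{u,u}(\eta_{u,u}^{-1}x))$, $x\in\mathcal P$, are a full set of pairwise non-isometric representatives of the isometry classes of these quadratic forms, where $E_{u,u}(y)$ is the matrix with $(u,u)$ entry $y$ and all other entries $0$. -/

import Mathlib

noncomputable section

namespace KleinSymplectic

open Matrix

/-! ### Symplectic modules and quadratic forms over a group algebra

A `kG`-module is a representation `ρ : Representation k G M`. -/

section Forms

variable {k G M : Type*} [Field k] [Group G] [AddCommGroup M] [Module k M]

/-- `B` is a non-degenerate, alternating, `G`-invariant bilinear form on the `kG`-module `ρ`. -/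
def IsSymplectic (ρ : Representation k G M) (B : LinearMap.BilinForm k M) : Prop :=
  B.IsAlt ∧ B.Nondegenerate ∧ ∀ (g : G) (x y : M), B (ρ g x) (ρ g y) = B x y

/-- `(M, B)` is an indecomposable symplectic `kG`-module: it is symplectic and non-zero, and it is
not an orthogonal direct sum of two proper `kG`-submodules on both of which `B` is non-degenerate
(hence symplectic). -/
def IsIndecomposableSymplectic (ρ : Representation k G M) (B : LinearMap.BilinForm k M) : Prop :=
  IsSymplectic ρ B ∧ Nontrivial M ∧
    ¬ ∃ N₁ N₂ : Submodule k M,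
      (∀ g, ∀ x ∈ N₁, ρ g x ∈ N₁) ∧ (∀ g, ∀ x ∈ N₂, ρ g x ∈ N₂) ∧
      N₁ ≠ ⊤ ∧ N₂ ≠ ⊤ ∧ IsCompl N₁ N₂ ∧ (∀ x ∈ N₁, ∀ y ∈ N₂, B x y = 0) ∧
      (B.restrict N₁).Nondegenerate ∧ (B.restrict N₂).Nondegenerate

/-- The `kG`-automorphisms of `M`, as a predicate on `k`-linear automorphisms. -/
def IsModuleAut (ρ : Representation k G M) (α : M ≃ₗ[k] M) : Prop :=
  ∀ (g : G) (x : M), α (ρ g x) = ρ g (α x)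

/-- Isometry of bilinear forms on a `kG`-module. -/
def Isometric (ρ : Representation k G M) (B B' : LinearMap.BilinForm k M) : Prop :=
  ∃ α : M ≃ₗ[k] M, IsModuleAut ρ α ∧ ∀ x y, B (α x) (α y) = B' x y

/-- `q` is a `G`-invariant quadratic form whose associated bilinear form
`(x, y) ↦ q (x + y) - q x - q y` is `B`. -/
def IsInvariantQuadratic (ρ : Representation k G M) (B : LinearMap.BilinForm k M)
    (q : QuadraticForm k M) : Prop :=
  (∀ (g : G) (x : M), q (ρ g x) = q x) ∧ QuadraticMap.polarBilin q = B

/-- Isometry of quadratic forms on a `kG`-module. -/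
def QIsometric (ρ : Representation k G M) (q q' : QuadraticForm k M) : Prop :=
  ∃ α : M ≃ₗ[k] M, IsModuleAut ρ α ∧ ∀ x, q (α x) = q' x

/-- Isometry is an equivalence relation on the indecomposable symplectic forms on `ρ`. -/
def isometrySetoid (ρ : Representation k G M) :
    Setoid {B : LinearMap.BilinForm k M // IsIndecomposableSymplectic ρ B} where
  r B B' := Isometric ρ B.1 B'.1
  iseqv :=
    { refl := fun _ => ⟨LinearEquiv.refl k M, fun _ _ => rfl, fun _ _ => rfl⟩
      symm := by
        rintro B B' ⟨α, h, hB⟩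
        refine ⟨α.symm, fun g x => ?_, fun x y => ?_⟩
        · apply α.injective
          rw [h]
          simp
        · rw [← hB]
          simp
      trans := by
        rintro B B' B'' ⟨α, h, hB⟩ ⟨β, h', hB'⟩
        refine ⟨β.trans α, fun g x => ?_, fun x y => ?_⟩
        · simp only [LinearEquiv.trans_apply]
          rw [h', h]
        · simp only [LinearEquiv.trans_apply]
          rw [hB, hB'] }

/-- The isometry classes of indecomposable symplectic forms on `ρ`. -/
abbrev IsometryClass (ρ : Representation k G M) : Type _ := Quotient (isometrySetoid ρ)

end Forms

/-- The family `F` is a full set of representatives, without repetition, for the classes of the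
relation `r` on the set `A`: every `F i` lies in `A`, and every `a ∈ A` is related to `F i` for
exactly one index `i`. -/
def IsFullSetOfReps {X ι : Type*} (A : Set X) (r : X → X → Prop) (F : ι → X) : Prop :=
  (∀ i, F i ∈ A) ∧ ∀ a ∈ A, ∃! i, r a (F i)

/-- `P` is a full set of representatives for the cosets of `{x ^ 2 + x}` in the additive group of
`k`. -/
def IsArtinSchreierReps {k : Type*} [Field k] (P : Set k) : Prop :=
  ∀ a : k, ∃! p, p ∈ P ∧ ∃ x : k, a - p = x ^ 2 + x

/-! ### The Klein four group and the module `C_n(f) ⊕ C_n(f)` -/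

/-- The Klein four group `C₂ × C₂`. -/
abbrev V4 : Type := Multiplicative (ZMod 2) × Multiplicative (ZMod 2)

/-- The generator `g₁` of the Klein four group. -/
def g₁ : V4 := (Multiplicative.ofAdd 1, 1)

/-- The generator `g₂` of the Klein four group. -/
def g₂ : V4 := (1, Multiplicative.ofAdd 1)

section Module

variable {k : Type*} [Field k]

/-- The companion matrix of a monic polynomial `p`: ones on the first subdiagonal, the negatives of
the lower coefficients of `p` in the last column. -/
def companion (p : Polynomial k) : Matrix (Fin p.natDegree) (Fin p.natDegree) k :=
  Matrix.of fun i j =>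
    if (j : ℕ) + 1 = p.natDegree then -p.coeff i else if (i : ℕ) = j + 1 then 1 else 0

variable [CharP k 2]

/-- The `kG`-module attached to a square matrix `A`: `g₁` acts as `[1, 1; 0, 1]` and `g₂` acts as
`[1, A; 0, 1]` on column vectors. -/
def blockRep {d : ℕ} (A : Matrix (Fin d) (Fin d) k) :
    Representation k V4 (Fin d ⊕ Fin d → k) where
  toFun g := Matrix.toLin' (Matrix.fromBlocks 1
    (ZMod.castHom (dvd_refl 2) k g.1.toAdd • (1 : Matrix (Fin d) (Fin d) k) +
      ZMod.castHom (dvd_refl 2) k g.2.toAdd • A) 0 1)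
  map_one' := by
    simp
    rfl
  map_mul' g h := by
    rw [Module.End.mul_eq_comp, ← Matrix.toLin'_mul, Matrix.fromBlocks_multiply]
    congr 2 <;> simp [add_smul]
    abel

theorem blockRep_g₁ {d : ℕ} (A : Matrix (Fin d) (Fin d) k) :
    blockRep A g₁ = Matrix.toLin' (Matrix.fromBlocks 1 1 0 1) := by
  change Matrix.toLin' _ = _
  simp [g₁]

theorem blockRep_g₂ {d : ℕ} (A : Matrix (Fin d) (Fin d) k) :
    blockRep A g₂ = Matrix.toLin' (Matrix.fromBlocks 1 A 0 1) := by
  change Matrix.toLin' _ = _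
  simp [g₂]

/-- The `kG`-module `C_n(f)`, on `k ^ (2 m n)` with `m` the degree of `f`. -/
def C (f : Polynomial k) (n : ℕ) :
    Representation k V4 (Fin (f ^ n).natDegree ⊕ Fin (f ^ n).natDegree → k) :=
  blockRep (companion (f ^ n))

/-- The `kG`-module `C_n(f) ⊕ C_n(f)`. -/
def C2 (f : Polynomial k) (n : ℕ) :
    Representation k V4 ((Fin (f ^ n).natDegree ⊕ Fin (f ^ n).natDegree → k) ×
      (Fin (f ^ n).natDegree ⊕ Fin (f ^ n).natDegree → k)) :=
  (C f n).prod (C f n)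

end Module

/-- The basis `e_1 ⊕ 0, …, e_d ⊕ 0, 0 ⊕ e_1, …, 0 ⊕ e_d, e_{d+1} ⊕ 0, …, e_{2d} ⊕ 0,
0 ⊕ e_{d+1}, …, 0 ⊕ e_{2d}` of `k ^ (2 d) ⊕ k ^ (2 d)`; the index set is
`(e_i ⊕ 0, i ≤ d) ⊕ (0 ⊕ e_i, i ≤ d)` followed by `(e_i ⊕ 0, i > d) ⊕ (0 ⊕ e_i, i > d)`. -/
def stdBasis (k : Type*) [Field k] (d : ℕ) :
    Module.Basis ((Fin d ⊕ Fin d) ⊕ (Fin d ⊕ Fin d)) k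
      ((Fin d ⊕ Fin d → k) × (Fin d ⊕ Fin d → k)) :=
  ((Pi.basisFun k (Fin d ⊕ Fin d)).prod (Pi.basisFun k (Fin d ⊕ Fin d))).reindex
    (Equiv.sumSumSumComm (Fin d) (Fin d) (Fin d) (Fin d))

/-! ### Hankel matrices and the operator `𝒱` -/

/-- `H_i(x)`: the `(s, t)` entry (indices counted from `1`) is `x` if `s + t = i`, else `0`. -/
def H {K : Type*} [Field K] (n i : ℕ) (x : K) : Matrix (Fin n) (Fin n) K :=
  Matrix.of fun s t => if ((s : ℕ) + 1) + ((t : ℕ) + 1) = i then x else 0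

/-- The Jordan block `J_n(a)`, with ones on the superdiagonal. -/
def jordan {K : Type*} [Field K] (n : ℕ) (a : K) : Matrix (Fin n) (Fin n) K :=
  Matrix.of fun s t => if s = t then a else if (t : ℕ) = s + 1 then 1 else 0

/-- The last unit column vector `e_n`. -/
def lastVec (K : Type*) [Field K] (n : ℕ) : Fin n → K := fun t => if (t : ℕ) + 1 = n then 1 else 0

/-- The `n × d` matrix `V'` whose `s`-th column is `J_n(ε) ^ (s - 1) e_n`. -/
def V' {K : Type*} [Field K] (n d : ℕ) (ε : K) : Matrix (Fin n) (Fin d) K :=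
  Matrix.of fun q s => (jordan n ε ^ (s : ℕ) *ᵥ lastVec K n) q

/-- The matrix `V` over an extension field `E`, obtained by stacking the conjugates of `V'`. -/
def bigV (k E : Type*) {K : Type*} [Field k] [Field E] [Field K] [Algebra k K] [Algebra k E]
    (n d : ℕ) (ε : K) : Matrix (Fin n × (K →ₐ[k] E)) (Fin d) E :=
  Matrix.of fun p s => p.2 (V' n d ε p.1 s)

/-- `𝒱(X) = Vᵀ diag(σ_1(X), …, σ_m(X)) V`, where the `σ_i` are the `k`-embeddings of `K = k[ε]` into
an algebraic closure. The entries lie in `k` and are the traces of the entries of `V'ᵀ X V'`; the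
equality with the product over an algebraically closed field is `calV_eq`. -/
def calV (k : Type*) {K : Type*} [Field k] [Field K] [Algebra k K] {n : ℕ} (d : ℕ) (ε : K)
    (X : Matrix (Fin n) (Fin n) K) : Matrix (Fin d) (Fin d) k :=
  ((V' n d ε)ᵀ * X * V' n d ε).map (Algebra.trace k K)

theorem calV_eq (k E : Type*) {K : Type*} [Field k] [Field E] [IsAlgClosed E] [Field K]
    [Algebra k K] [Algebra k E] [FiniteDimensional k K] [Algebra.IsSeparable k K]
    [DecidableEq (K →ₐ[k] E)] {n : ℕ} (d : ℕ) (ε : K) (X : Matrix (Fin n) (Fin n) K) :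
    (calV k d ε X).map (algebraMap k E) =
      (bigV k E n d ε)ᵀ * Matrix.blockDiagonal (fun σ : K →ₐ[k] E => X.map σ) *
        bigV k E n d ε := by
  ext i j
  simp only [calV, Matrix.map_apply]
  rw [trace_eq_sum_embeddings E]
  simp only [Matrix.mul_apply, Matrix.transpose_apply, map_sum, map_mul, bigV, Matrix.of_apply,
    Matrix.blockDiagonal_apply, Matrix.map_apply, Fintype.sum_prod_type, mul_ite, mul_zero,
    Finset.sum_ite_eq', Finset.mem_univ, if_true]
  rw [Finset.sum_comm]

/-! ### The labels -/

/-- The labels `(r, s, φ, ψ)` with `2 ≤ r ≤ n + 1`, `0 ≤ s ≤ (n - r + 1) / 2`,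
`φ = (φ_1, φ_3, …, φ_{2 s - 1}) ∈ K ^ s` and `ψ = (ψ_1, …, ψ_t) ∈ K ^ t`, where
`t = ⌊(n - r - 2 s + 1) / 2⌋` and `ψ_1 ≠ 1` if `t ≥ 1`. Here `phi j` is `φ_{2 j + 1}` and
`psi j` is `ψ_{j + 1}` for `j = 0, 1, …`. -/
structure Label (n : ℕ) (K : Type*) [Field K] where
  r : ℕ
  s : ℕ
  two_le_r : 2 ≤ r
  r_le : r ≤ n + 1
  s_le : r + 2 * s ≤ n + 1
  phi : Fin s → K
  psi : Fin ((n + 1 - r - 2 * s) / 2) → K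
  psi_ne : ∀ j : Fin ((n + 1 - r - 2 * s) / 2), (j : ℕ) = 0 → psi j ≠ 1

namespace Label

variable {n : ℕ} {K : Type*} [Field K] (l : Label n K)

/-- `φ = H_{n+r}(1) + ∑ H_{n+r+i}(φ_i)`, the sum over all odd `i` with `1 ≤ i ≤ 2 s - 1`. -/
def φ : Matrix (Fin n) (Fin n) K :=
  H n (n + l.r) 1 + ∑ j : Fin l.s, H n (n + l.r + (2 * (j : ℕ) + 1)) (l.phi j)

/-- `ψ = H_{n+1}(1) + ∑ H_{n+i}(ψ_i)`, the sum over `1 ≤ i ≤ t`. -/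
def ψ : Matrix (Fin n) (Fin n) K :=
  H n (n + 1) 1 + ∑ j : Fin ((n + 1 - l.r - 2 * l.s) / 2), H n (n + ((j : ℕ) + 1)) (l.psi j)

/-- `μ = H_{n+r+2s+1}(1)`. -/
def μ : Matrix (Fin n) (Fin n) K := H n (n + l.r + 2 * l.s + 1) 1

end Label

/-- The set `𝒦` of all triples `(φ, ψ, μ)` of Hankel matrices that come from a label. -/
def calK (n : ℕ) (K : Type*) [Field K] :
    Set (Matrix (Fin n) (Fin n) K × Matrix (Fin n) (Fin n) K × Matrix (Fin n) (Fin n) K) :=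
  Set.range fun l : Label n K => (l.φ, l.ψ, l.μ)

/-! ### The forms `S(φ, ψ, μ)` and `Q_σ(D')` -/

section Standard

variable (k : Type*) {K : Type*} [Field k] [Field K] [Algebra k K] {n : ℕ}

/-- `σ = [𝒱(φ), 𝒱(ψ); 𝒱(ψ), 𝒱(μ)]`. -/
def sigma (d : ℕ) (ε : K) (φ ψ μ : Matrix (Fin n) (Fin n) K) :
    Matrix (Fin d ⊕ Fin d) (Fin d ⊕ Fin d) k :=
  Matrix.fromBlocks (calV k d ε φ) (calV k d ε ψ) (calV k d ε ψ) (calV k d ε μ)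

variable {k}

/-- The bilinear form with Gram matrix `[0, σ; σ, 0]`. -/
def S {d : ℕ} (σ : Matrix (Fin d ⊕ Fin d) (Fin d ⊕ Fin d) k) :
    LinearMap.BilinForm k ((Fin d ⊕ Fin d → k) × (Fin d ⊕ Fin d → k)) :=
  Matrix.toBilin (stdBasis k d) (Matrix.fromBlocks 0 σ σ 0)

/-- The diagonal matrix with the same diagonal as `σ`. -/
def diagPart {ι : Type*} [DecidableEq ι] (σ : Matrix ι ι k) : Matrix ι ι k :=
  Matrix.diagonal fun i => σ i i

/-- The quadratic form `x ↦ xᵀ Q x` with `Q = Q_σ(D') = [D, σ; 0, D']`, where `D` is the diagonal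
matrix with the same diagonal as `σ`. -/
def Q {d : ℕ} (σ D' : Matrix (Fin d ⊕ Fin d) (Fin d ⊕ Fin d) k) :
    QuadraticForm k ((Fin d ⊕ Fin d → k) × (Fin d ⊕ Fin d → k)) :=
  LinearMap.BilinMap.toQuadraticMap
    (Matrix.toBilin (stdBasis k d) (Matrix.fromBlocks (diagPart σ) σ 0 D'))

/-- `η = σ⁻¹ D σ⁻ᵀ`. -/
def eta {d : ℕ} (σ : Matrix (Fin d ⊕ Fin d) (Fin d ⊕ Fin d) k) :
    Matrix (Fin d ⊕ Fin d) (Fin d ⊕ Fin d) k :=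
  σ⁻¹ * diagPart σ * (σ⁻¹)ᵀ

end Standard

end KleinSymplectic

end

noncomputable section

namespace KleinSymplectic

open PowerSeries (X coeff)

/-! ### Power series in characteristic two: even and odd parts -/

section Series

variable {K : Type*} [Field K] [CharP K 2]

/-! Let R = K[[X]]/(X ^ n). Since k is perfect, f is separable, so f(ε + X) is X times a unit, and T
↦ τ = ε + X identifies k[T]/(f ^ n) with R; multiplication by τ is the companion matrix. Hence M = N
× N with N = R², where g₁ and g₂ act as [1, 1; 0, 1] and [1, τ; 0, 1], and the automorphisms of M
are the matrices [A, B; 0, A] with A in GL₂(R) and B any k-linear map.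

A symplectic form vanishes on the upper half, and its alternating part on the lower half can be
removed by a shear [1, B; 0, 1]. What remains is [0, s; s, 0] with s symmetric, non-degenerate and τ
self-adjoint. The functional lam (trace of the coefficient of X ^ (n - 1)) makes R a Frobenius
algebra, so s = lam ∘ [α, β; β, γ] for a unique symmetric matrix over R, and isometry of symplectic
forms becomes congruence over R (`isometric_hyp_iff`, `exists_isometry_form_iff`). Through Hankel
matrices, 𝒱 is exactly the passage from series to Gram matrices (`calV_hankel`). As R is local, the
form is indecomposable if and only if α and γ are non-units (`decomposes_form_iff`).

In characteristic two, congruence transforms the diagonal by α' = a²α + c²γ, γ' = b²α + d²γ. Since K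
is perfect, every series is p² + X q² with independent even and odd parts. Existence of the normal
form (`exists_label_formCongr`) is elimination with these parts; uniqueness
(`label_eq_of_formCongr`) compares them separately. Counting labels is a telescoping sum.

An invariant quadratic form has forced values on the upper half, and these are consistent exactly
when s(Tw, Tw) = s(Tw, w) for all w (`exists_isInvariantQuadratic_iff`). Here this says that lam((τ²
- τ)(φx² + μy²)) vanishes identically, that is, that the coefficients of one parity vanish in φ(τ² -
τ) and μ(τ² - τ) (`lam_proj_mul_sq_eq_zero_iff`); solving the recursion gives the listed cases
(`vanishes_iff`). On the lower half the form is an arbitrary diagonal form. Write s(w, w) = s(h,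
w)²; every isometry fixes h modulo the upper half, and the value at h, modulo elements y² + y, is a
complete invariant (`qIsometric_iff`). The squares of the entries of h form the diagonal of η. -/

theorem charTwo_series : (2 : PowerSeries K) = 0 := by
  have h : PowerSeries.C (2 : K) = (0 : PowerSeries K) := by simp [CharTwo.two_eq_zero]
  rw [← h]
  exact (map_ofNat (PowerSeries.C (R := K)) 2).symm

instance : CharP (PowerSeries K) 2 := CharTwo.of_one_ne_zero_of_two_eq_zero one_ne_zero charTwo_series

/-- The swap pairs equal terms of the convolution, which cancel; only the fixed point (m, m)
survives. In odd degree there is no fixed point. -/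
theorem coeff_sq_two_mul (p : PowerSeries K) (m : ℕ) : coeff (2 * m) (p ^ 2) = coeff m p ^ 2 := by
  classical
  rw [pow_two, PowerSeries.coeff_mul,
    ← Finset.add_sum_erase _ _ (a := (m, m)) (by simp [two_mul]), pow_two]
  refine add_eq_left.2 (Finset.sum_involution (fun x _ => x.swap) ?_ ?_ ?_ ?_)
  · intro x _
    simp only [Prod.fst_swap, Prod.snd_swap]
    rw [mul_comm (coeff x.2 p)]
    exact CharTwo.add_self_eq_zero _
  · rintro ⟨i, j⟩ hx _ h
    rw [Finset.mem_erase, Finset.HasAntidiagonal.mem_antidiagonal] at hx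
    simp only [Prod.swap_prod_mk, Prod.mk.injEq, ne_eq] at hx h
    omega
  · rintro ⟨i, j⟩ hx
    rw [Finset.mem_erase, Finset.HasAntidiagonal.mem_antidiagonal] at hx ⊢
    simp only [Prod.swap_prod_mk, Prod.mk.injEq, ne_eq] at hx ⊢
    omega
  · intro x _
    simp

theorem coeff_sq_two_mul_add_one (p : PowerSeries K) (m : ℕ) : coeff (2 * m + 1) (p ^ 2) = 0 := by
  rw [pow_two, PowerSeries.coeff_mul]
  refine Finset.sum_involution (fun x _ => x.swap) ?_ ?_ ?_ ?_
  · intro x _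
    simp only [Prod.fst_swap, Prod.snd_swap]
    rw [mul_comm (coeff x.2 p)]
    exact CharTwo.add_self_eq_zero _
  · rintro ⟨i, j⟩ hx _ h
    rw [Finset.HasAntidiagonal.mem_antidiagonal] at hx
    simp only [Prod.swap_prod_mk, Prod.mk.injEq] at hx h
    omega
  · rintro ⟨i, j⟩ hx
    rw [Finset.HasAntidiagonal.mem_antidiagonal] at hx ⊢
    simp only [Prod.swap_prod_mk] at hx ⊢
    omega
  · intro x _
    simp

/-- Even coefficients see only `p` and odd ones only `q`, so a congruence on p² + X q² splits into
two independent ones. -/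
theorem coeff_sq_add_X_mul_sq (p q : PowerSeries K) (m : ℕ) :
    coeff (2 * m) (p ^ 2 + X * q ^ 2) = coeff m p ^ 2 ∧
      coeff (2 * m + 1) (p ^ 2 + X * q ^ 2) = coeff m q ^ 2 := by
  constructor
  · rw [map_add, coeff_sq_two_mul]
    rcases m with _ | m
    · simp
    · rw [show 2 * (m + 1) = 2 * m + 1 + 1 by ring, PowerSeries.coeff_succ_X_mul,
        coeff_sq_two_mul_add_one, add_zero]
  · rw [map_add, coeff_sq_two_mul_add_one, PowerSeries.coeff_succ_X_mul, coeff_sq_two_mul, zero_add]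

/-- Over a perfect field of characteristic two every power series is `p ^ 2 + X * q ^ 2`. -/
theorem exists_sq_add_X_mul_sq [PerfectRing K 2] (g : PowerSeries K) :
    ∃ p q : PowerSeries K, g = p ^ 2 + X * q ^ 2 := by
  have hs : ∀ x : K, ∃ y, y ^ 2 = x := fun x =>
    ⟨(frobeniusEquiv K 2).symm x, frobeniusEquiv_symm_pow_p K 2 x⟩
  choose r hr using hs
  refine ⟨PowerSeries.mk fun i => r (coeff (2 * i) g), PowerSeries.mk fun i => r (coeff (2 * i + 1) g), ?_⟩
  ext m
  rcases Nat.even_or_odd' m with ⟨i, rfl | rfl⟩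
  · rw [(coeff_sq_add_X_mul_sq _ _ i).1, PowerSeries.coeff_mk, hr]
  · rw [(coeff_sq_add_X_mul_sq _ _ i).2, PowerSeries.coeff_mk, hr]

/-- Divisibility of `p ^ 2 + X * q ^ 2` by a power of `X`. -/
theorem X_pow_dvd_sq_add_X_mul_sq {N : ℕ} {p q : PowerSeries K}
    (h : (X : PowerSeries K) ^ N ∣ p ^ 2 + X * q ^ 2) :
    (X : PowerSeries K) ^ ((N + 1) / 2) ∣ p ∧ (X : PowerSeries K) ^ (N / 2) ∣ q := by
  rw [PowerSeries.X_pow_dvd_iff] at h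
  constructor <;> rw [PowerSeries.X_pow_dvd_iff] <;> intro m hm
  · have := h (2 * m) (by omega)
    rw [(coeff_sq_add_X_mul_sq _ _ m).1] at this
    exact pow_eq_zero_iff two_ne_zero |>.1 this
  · have := h (2 * m + 1) (by omega)
    rw [(coeff_sq_add_X_mul_sq _ _ m).2] at this
    exact pow_eq_zero_iff two_ne_zero |>.1 this

end Series

/-! ### Congruence of symmetric binary forms in characteristic two -/

section Congr

variable {R : Type*} [CommRing R]

/-- The symmetric matrices `[α, β; β, γ]` and `[α', β'; β', γ']` over a ring of characteristic two
are congruent under the invertible matrix `[a, b; c, d]`. -/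
def FormCongr (α β γ α' β' γ' : R) : Prop :=
  ∃ a b c d : R, IsUnit (a * d + b * c) ∧ α' = a ^ 2 * α + c ^ 2 * γ ∧
    β' = a * b * α + (a * d + b * c) * β + c * d * γ ∧ γ' = b ^ 2 * α + d ^ 2 * γ

namespace FormCongr

variable {α β γ α' β' γ' α'' β'' γ'' : R}

theorem refl : FormCongr α β γ α β γ := ⟨1, 0, 0, 1, by simp, by ring, by ring, by ring⟩

/-- `FormCongr` omits the terms 2acβ, 2bdβ and writes the determinant with a plus sign, so
composition is matrix multiplication only up to multiples of 2. -/
theorem trans [CharP R 2] (h : FormCongr α β γ α' β' γ') (h' : FormCongr α' β' γ' α'' β'' γ'') :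
    FormCongr α β γ α'' β'' γ'' := by
  have h2 : (2 : R) = 0 := CharTwo.two_eq_zero
  obtain ⟨a, b, c, d, hu, rfl, rfl, rfl⟩ := h
  obtain ⟨a', b', c', d', hu', rfl, rfl, rfl⟩ := h'
  refine ⟨a * a' + b * c', a * b' + b * d', c * a' + d * c', c * b' + d * d', ?_, ?_, ?_, ?_⟩
  · convert hu.mul hu' using 1
    linear_combination (a * a' * c * b' + b * c' * d * d') * h2
  · linear_combination (-(a * a' * b * c') * α - c * a' * d * c' * γ) * h2
  · linear_combination (-a * a' * c * b' * β - b * c' * d * d' * β) * h2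
  · linear_combination (-(a * b' * b * d') * α - c * b' * d * d' * γ) * h2

/-- The inverse is the adjugate over the determinant; without signs it is [d, b; c, a] divided by ad
+ bc. -/
theorem symm [CharP R 2] (h : FormCongr α β γ α' β' γ') : FormCongr α' β' γ' α β γ := by
  have h2 : (2 : R) = 0 := CharTwo.two_eq_zero
  obtain ⟨a, b, c, d, ⟨u, hu⟩, rfl, rfl, rfl⟩ := h
  have hv : (↑u⁻¹ : R) * (a * d + b * c) = 1 := by rw [← hu]; simp
  generalize (↑u⁻¹ : R) = v at hv
  have hw : IsUnit v := IsUnit.of_mul_eq_one _ hv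
  refine ⟨v * d, v * b, v * c, v * a, ?_, ?_, ?_, ?_⟩
  · rw [show v * d * (v * a) + v * b * (v * c) = v * (v * (a * d + b * c)) by ring, hv, mul_one]
    exact hw
  · linear_combination
      (-α * (v * (a * d + b * c) + 1)) * hv + (α * v ^ 2 * a * d * b * c - γ * v ^ 2 * c ^ 2 * d ^ 2) * h2
  · linear_combination (-β * (v * (a * d + b * c) + 1)) * hv -
      (v ^ 2 * α * a * b * (a * d + b * c) + v ^ 2 * γ * c * d * (a * d + b * c)) * h2
  · linear_combination
      (-γ * (v * (a * d + b * c) + 1)) * hv + (γ * v ^ 2 * a * d * b * c - α * v ^ 2 * a ^ 2 * b ^ 2) * h2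

theorem swap : FormCongr α β γ γ β α := ⟨0, 1, 1, 0, by simp, by ring, by ring, by ring⟩

theorem scale_left {u : R} (hu : IsUnit u) : FormCongr α β γ (u ^ 2 * α) (u * β) γ :=
  ⟨u, 0, 0, 1, by simpa, by ring, by ring, by ring⟩

theorem scale_right {u : R} (hu : IsUnit u) : FormCongr α β γ α (u * β) (u ^ 2 * γ) :=
  ⟨1, 0, 0, u, by simpa, by ring, by ring, by ring⟩

theorem shear_right (y : R) : FormCongr α β γ α (β + y * α) (γ + y ^ 2 * α) :=
  ⟨1, y, 0, 1, by simp, by ring, by ring, by ring⟩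

theorem shear_left (y : R) : FormCongr α β γ (α + y ^ 2 * γ) (β + y * γ) γ :=
  ⟨1, 0, y, 1, by simp, by ring, by ring, by ring⟩

end FormCongr

end Congr
end KleinSymplectic

namespace KleinSymplectic

open PowerSeries (X coeff)

/-! ### Labels as power series and reduction to normal form -/

section Series

variable {K : Type*} [Field K]

/-- The polynomial `c 0 + c 1 * X + … + c (s - 1) * X ^ (s - 1)` as a power series. -/
def finSeries {s : ℕ} (c : Fin s → K) : PowerSeries K := ∑ j, PowerSeries.C (c j) * X ^ (j : ℕ)

theorem coeff_finSeries {s : ℕ} (c : Fin s → K) (j : Fin s) : coeff j (finSeries c) = c j := by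
  simp [finSeries, PowerSeries.coeff_X_pow, Fin.val_inj]

theorem X_pow_dvd_sub_finSeries {s : ℕ} (p : PowerSeries K) :
    (X : PowerSeries K) ^ s ∣ p - finSeries (fun j : Fin s => coeff j p) := by
  rw [PowerSeries.X_pow_dvd_iff]
  intro m hm
  have := coeff_finSeries (fun j : Fin s => coeff j p) ⟨m, hm⟩
  simp only at this
  rw [map_sub, this, sub_self]

theorem finSeries_sq [CharP K 2] {s : ℕ} (c : Fin s → K) :
    finSeries c ^ 2 = ∑ j : Fin s, PowerSeries.C (c j ^ 2) * X ^ (2 * (j : ℕ)) := by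
  rw [finSeries, CharTwo.sum_sq]
  simp [mul_pow, pow_mul']

theorem finSeries_congr {s : ℕ} {c c' : Fin s → K}
    (h : (X : PowerSeries K) ^ s ∣ finSeries c - finSeries c') : c = c' := by
  funext j
  rw [PowerSeries.X_pow_dvd_iff] at h
  have := h j j.2
  rwa [map_sub, coeff_finSeries, coeff_finSeries, sub_eq_zero] at this

theorem isUnit_add_of_X_dvd {p q : PowerSeries K} (hp : IsUnit p) (hq : X ∣ q) :
    IsUnit (p + q) := by
  rw [PowerSeries.isUnit_iff_constantCoeff] at *
  rw [PowerSeries.X_dvd_iff] at hq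
  simpa [hq] using hp

theorem isUnit_of_isUnit_sq_add {p q : PowerSeries K} (h : IsUnit (p ^ 2 + X * q)) : IsUnit p := by
  rw [PowerSeries.isUnit_iff_constantCoeff] at *
  simpa using h

/-- Modulo `X ^ n`, every power series is `X ^ i` times a unit for some `i ≤ n`. -/
theorem exists_X_pow_mul_unit (n : ℕ) (p : PowerSeries K) :
    ∃ i ≤ n, ∃ a : PowerSeries K, IsUnit a ∧ (X : PowerSeries K) ^ n ∣ p - X ^ i * a := by
  by_cases h : (X : PowerSeries K) ^ n ∣ p
  · exact ⟨n, le_rfl, 1, isUnit_one, by simpa using h⟩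
  · have hp : p ≠ 0 := fun h0 => h (h0 ▸ dvd_zero _)
    refine ⟨p.order.toNat, ?_, PowerSeries.divXPowOrder p, ?_, ?_⟩
    · by_contra hlt
      refine h ((pow_dvd_pow _ (by omega)).trans PowerSeries.X_pow_order_dvd)
    · rw [PowerSeries.isUnit_iff_constantCoeff, isUnit_iff_ne_zero, ne_eq,
        PowerSeries.constantCoeff_divXPowOrder_eq_zero_iff]
      exact hp
    · rw [PowerSeries.X_pow_order_mul_divXPowOrder]; simp

namespace Label

variable {n : ℕ} (l : Label n K)

/-- The power series whose Hankel matrix is `φ`. -/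
def phiSeries : PowerSeries K :=
  X ^ (l.r - 1) + ∑ j : Fin l.s, PowerSeries.C (l.phi j) * X ^ (l.r + 2 * (j : ℕ))

/-- The power series whose Hankel matrix is `ψ`. -/
def psiSeries : PowerSeries K := 1 + finSeries l.psi

/-- The power series whose Hankel matrix is `μ`. -/
def muSeries : PowerSeries K := X ^ (l.r + 2 * l.s)

/-- Square roots of the `phi j` exhibit the two parts of φ: up to X ^ (r - 1), the even part is 1
and the odd part is a polynomial of degree less than s. -/
theorem phiSeries_eq [CharP K 2] {c : Fin l.s → K} (hc : ∀ j, c j ^ 2 = l.phi j) :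
    l.phiSeries = X ^ (l.r - 1) * (1 + X * finSeries c ^ 2) := by
  have hr := l.two_le_r
  rw [phiSeries, finSeries_sq, mul_add, mul_one, ← mul_assoc, ← pow_succ,
    Nat.sub_add_cancel (by omega), Finset.mul_sum]
  congr 1
  refine Finset.sum_congr rfl fun j _ => ?_
  rw [hc, pow_add]; ring

/-- The constant term is 1 + ψ₁ (or 1 if there are no ψᵢ); this is the role of the condition ψ₁ ≠ 1.
-/
theorem isUnit_psiSeries [CharP K 2] : IsUnit l.psiSeries := by
  rw [PowerSeries.isUnit_iff_constantCoeff, psiSeries, isUnit_iff_ne_zero, map_add, map_one,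
    ← PowerSeries.coeff_zero_eq_constantCoeff_apply]
  by_cases h : 0 < (n + 1 - l.r - 2 * l.s) / 2
  · rw [coeff_finSeries l.psi ⟨0, h⟩]
    exact fun h0 => l.psi_ne ⟨0, h⟩ rfl (CharTwo.add_eq_zero.1 h0).symm
  · have : finSeries l.psi = 0 := by
      rw [finSeries]
      exact Finset.sum_eq_zero fun j _ => absurd j.2 (by omega)
    simp [this]

theorem X_dvd_phiSeries : X ∣ l.phiSeries := by
  have hr := l.two_le_r
  refine dvd_add (dvd_pow_self _ (by omega)) (Finset.dvd_sum fun j _ => ?_)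
  exact (dvd_pow_self _ (by omega)).mul_left _

theorem X_dvd_muSeries : X ∣ l.muSeries := by
  have hr := l.two_le_r
  exact dvd_pow_self _ (by omega)

end Label

section Existence

variable {R : Type*} [CommRing R] (q : PowerSeries K →+* R) {n : ℕ}


theorem map_eq_of_dvd
    (hq : ∀ p, (X : PowerSeries K) ^ n ∣ p → q p = 0) {p p' : PowerSeries K} (h : (X : PowerSeries K) ^ n ∣ p - p') :
    q p = q p' := by
  rw [← sub_eq_zero, ← map_sub]; exact hq _ h

/-- A swap puts the diagonal entry of smaller order first, and r is that order plus one. Order n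
stands for the zero class, whence r = n + 1 is allowed. -/
theorem exists_leading_unit
    (hq : ∀ p, (X : PowerSeries K) ^ n ∣ p → q p = 0) (hn : 1 ≤ n) {α β γ : PowerSeries K} (hα : X ∣ α) (hγ : X ∣ γ) :
    ∃ r a c, 2 ≤ r ∧ r ≤ n + 1 ∧ IsUnit a ∧
      FormCongr (q α) (q β) (q γ) (q (X ^ (r - 1) * a)) (q β) (q (X ^ (r - 1) * c)) := by
  have key : ∀ p : PowerSeries K, X ∣ p → ∃ i, 1 ≤ i ∧ i ≤ n ∧ ∃ a, IsUnit a ∧ q p = q (X ^ i * a) := by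
    intro p hp
    obtain ⟨i, hi, a, ha, h⟩ := exists_X_pow_mul_unit n p
    refine ⟨i, ?_, hi, a, ha, map_eq_of_dvd q hq h⟩
    by_contra h0
    obtain rfl : i = 0 := by omega
    have h1 := (dvd_sub_right hp).1 ((dvd_pow_self X (by omega)).trans h)
    rw [pow_zero, one_mul] at h1
    exact PowerSeries.X_prime.not_isUnit (isUnit_of_dvd_unit h1 ha)
  obtain ⟨i, hi, hin, a, ha, h⟩ := key α hα
  obtain ⟨j, hj, hjn, c, hc, h'⟩ := key γ hγ
  rw [h, h']
  rcases le_total i j with hij | hij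
  · refine ⟨i + 1, a, X ^ (j - i) * c, by omega, by omega, ha, ?_⟩
    rw [Nat.add_sub_cancel, ← mul_assoc, ← pow_add, Nat.add_sub_cancel' hij]
    exact .refl
  · refine ⟨j + 1, c, X ^ (i - j) * a, by omega, by omega, hc, ?_⟩
    rw [Nat.add_sub_cancel, ← mul_assoc, ← pow_add, Nat.add_sub_cancel' hij]
    exact .swap

variable [CharP K 2] [CharP R 2]

/-- After scaling, the first entry is X ^ (r - 1) times a series with even part 1, so a shear can
clear the even part of the second entry. What is left is X ^ r times a square, and scaling by a unit
turns it into a pure power of X. -/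
theorem exists_normal_diagonal [PerfectRing K 2]
    (hq : ∀ p, (X : PowerSeries K) ^ n ∣ p → q p = 0) (hn : 1 ≤ n) {α β γ : PowerSeries K} (hα : X ∣ α)
    (hγ : X ∣ γ) (hβ : IsUnit β) :
    ∃ (r s : ℕ) (o β' : PowerSeries K), 2 ≤ r ∧ r + 2 * s ≤ n + 1 ∧ IsUnit β' ∧
      FormCongr (q α) (q β) (q γ) (q (X ^ (r - 1) * (1 + X * o ^ 2))) (q β')
        (q (X ^ (r + 2 * s))) := by
  have h2 : (2 : PowerSeries K) = 0 := CharTwo.two_eq_zero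
  obtain ⟨r, a, c, hr, hrn, ha, h⟩ := exists_leading_unit q hq hn (β := β) hα hγ
  obtain ⟨e, o, rfl⟩ := exists_sq_add_X_mul_sq a
  obtain ⟨p, g, rfl⟩ := exists_sq_add_X_mul_sq c
  obtain ⟨⟨e, e', he, he'⟩, rfl⟩ := isUnit_of_isUnit_sq_add ha
  simp only at h
  have hXr : (X : PowerSeries K) ^ (r - 1 + 1) = X ^ r := by rw [Nat.sub_add_cancel (by omega)]
  have hX : (X : PowerSeries K) ∣ X ^ (r - 1) := dvd_pow_self _ (by omega)
  have hue' : IsUnit e' := IsUnit.of_mul_eq_one _ he'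
  have h1 := h.trans (.scale_left (hue'.map q))
  rw [← map_pow, ← map_mul, ← map_mul, show e' ^ 2 * (X ^ (r - 1) * (e ^ 2 + X * o ^ 2)) =
    X ^ (r - 1) * (1 + X * (e' * o) ^ 2) by
      linear_combination (X ^ (r - 1) * (e * e' + 1)) * he] at h1
  generalize e' * o = o at h1
  -- Adding p² times the first entry cancels p² and leaves X ^ r times the square of g + p * o.
  have h3 := h1.trans (.shear_right (q p))
  rw [← map_pow, ← map_mul, ← map_mul, ← map_add, ← map_add,
    show X ^ (r - 1) * (p ^ 2 + X * g ^ 2) + p ^ 2 * (X ^ (r - 1) * (1 + X * o ^ 2)) =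
      X ^ r * (g + p * o) ^ 2 by
      rw [← hXr]
      linear_combination (X ^ (r - 1) * p ^ 2 - X ^ (r - 1 + 1) * g * p * o) * h2] at h3
  have hβ' : IsUnit (e' * β + p * (X ^ (r - 1) * (1 + X * o ^ 2))) :=
    isUnit_add_of_X_dvd (hue'.mul hβ) ((hX.mul_right _).mul_left _)
  generalize e' * β + p * (X ^ (r - 1) * (1 + X * o ^ 2)) = β' at h3 hβ'
  generalize g + p * o = w at h3
  obtain ⟨s, z, hs, hz, hw⟩ : ∃ s z, r + 2 * s ≤ n + 1 ∧ IsUnit z ∧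
      q (X ^ r * w ^ 2) = q (X ^ (r + 2 * s) * z ^ 2) := by
    -- If `w` is this divisible, the entry is zero modulo X ^ n, and the maximal s = (n + 1 - r) / 2
    -- represents it.
    by_cases hdvd : (X : PowerSeries K) ^ ((n + 1 - r) / 2) ∣ w
    · refine ⟨(n + 1 - r) / 2, 1, by omega, isUnit_one, ?_⟩
      obtain ⟨v, rfl⟩ := hdvd
      have hle : (X : PowerSeries K) ^ n ∣ X ^ (r + 2 * ((n + 1 - r) / 2)) :=
        pow_dvd_pow _ (by omega)
      rw [hq, hq]
      · exact hle.mul_right _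
      · rw [show X ^ r * (X ^ ((n + 1 - r) / 2) * v) ^ 2 =
          X ^ (r + 2 * ((n + 1 - r) / 2)) * v ^ 2 by ring]
        exact hle.mul_right _
    · have hw0 : w ≠ 0 := fun h0 => hdvd (h0 ▸ dvd_zero _)
      refine ⟨w.order.toNat, w.divXPowOrder, ?_, ?_, ?_⟩
      · by_contra hlt
        exact hdvd ((pow_dvd_pow _ (by omega)).trans PowerSeries.X_pow_order_dvd)
      · rw [PowerSeries.isUnit_iff_constantCoeff, isUnit_iff_ne_zero, ne_eq,
          PowerSeries.constantCoeff_divXPowOrder_eq_zero_iff]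
        exact hw0
      · conv_lhs => rw [← PowerSeries.X_pow_order_mul_divXPowOrder (f := w)]
        congr 1; ring
  rw [hw] at h3
  obtain ⟨⟨z, z', hz, hz'⟩, rfl⟩ := hz
  have huz' : IsUnit z' := IsUnit.of_mul_eq_one _ hz'
  have h4 := h3.trans (.scale_right (huz'.map q))
  simp only at h4
  rw [← map_pow, ← map_mul, ← map_mul, show z' ^ 2 * (X ^ (r + 2 * s) * z ^ 2) = X ^ (r + 2 * s) by
      linear_combination (X ^ (r + 2 * s) * (z * z' + 1)) * hz] at h4
  exact ⟨r, s, o, z' * β', hr, hs, huz'.mul hβ', h4⟩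

/-- Every form `[α, β; β, γ]` over `K[X] / (X ^ n)` with `α`, `γ` nilpotent and `β` a unit is
congruent to the normal form of a label. -/
theorem exists_label_formCongr [PerfectRing K 2]
    (hq : ∀ p, (X : PowerSeries K) ^ n ∣ p → q p = 0) (hn : 1 ≤ n) {α β γ : PowerSeries K} (hα : X ∣ α)
    (hγ : X ∣ γ) (hβ : IsUnit β) :
    ∃ l : Label n K,
      FormCongr (q α) (q β) (q γ) (q l.phiSeries) (q l.psiSeries) (q l.muSeries) := by
  have h2 : (2 : PowerSeries K) = 0 := CharTwo.two_eq_zero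
  obtain ⟨r, s, o, β₁, hr, hs, hβ₁, h⟩ := exists_normal_diagonal q hq hn hα hγ hβ
  obtain ⟨y, hy⟩ := X_pow_dvd_sub_finSeries (s := s) o
  have hXr : (X : PowerSeries K) ^ (r - 1 + 1) = X ^ r := by rw [Nat.sub_add_cancel (by omega)]
  -- The tail X ^ s * y of `o` contributes X ^ (r + 2s) * y², which is y² times the second entry;
  -- the shear removes it and truncates `o` below degree s.
  have h1 := h.trans (.shear_left (q y))
  obtain ⟨o₁, ho₁⟩ : ∃ o₁, o₁ = finSeries fun j : Fin s => coeff j o := ⟨_, rfl⟩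
  rw [← ho₁] at hy
  have ho : o = o₁ + X ^ s * y := by rw [← hy]; ring
  rw [ho, ← map_pow, ← map_mul, ← map_mul, ← map_add, ← map_add,
    show X ^ (r - 1) * (1 + X * (o₁ + X ^ s * y) ^ 2) + y ^ 2 * X ^ (r + 2 * s) =
      X ^ (r - 1) * (1 + X * o₁ ^ 2) by
      rw [pow_add, ← hXr]
      linear_combination
        (X ^ (r - 1 + 1) * o₁ * X ^ s * y + y ^ 2 * X ^ (r - 1 + 1) * X ^ (2 * s)) * h2] at h1
  have hβ₂ : IsUnit (β₁ + y * X ^ (r + 2 * s)) :=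
    isUnit_add_of_X_dvd hβ₁ ((dvd_pow_self _ (by omega)).mul_left _)
  generalize β₁ + y * X ^ (r + 2 * s) = β₂ at h1 hβ₂
  let t := (n + 1 - r - 2 * s) / 2
  let l : Label n K :=
    { r := r
      s := s
      two_le_r := hr
      r_le := by omega
      s_le := hs
      phi := fun j => coeff j o ^ 2
      psi := fun j => coeff j (β₂ - 1)
      psi_ne := fun j hj => by
        rw [hj, PowerSeries.coeff_zero_eq_constantCoeff_apply, map_sub, map_one,
          CharTwo.sub_eq_add]
        intro h0
        rw [add_eq_right] at h0
        rw [PowerSeries.isUnit_iff_constantCoeff, h0] at hβ₂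
        exact not_isUnit_zero hβ₂ }
  have hφ : l.phiSeries = X ^ (r - 1) * (1 + X * o₁ ^ 2) := by
    rw [ho₁]; exact l.phiSeries_eq fun _ => rfl
  have hψ : (X : PowerSeries K) ^ t ∣ β₂ - l.psiSeries := by
    rw [Label.psiSeries, ← sub_sub]
    exact X_pow_dvd_sub_finSeries _
  refine ⟨l, ?_⟩
  rw [hφ]
  refine h1.trans ?_
  obtain ⟨⟨b, b', hb, hb'⟩, rfl⟩ := hβ₂
  simp only at hψ ⊢
  -- Scaling by ψ/β makes the off-diagonal entry ψ. Since ψ ≡ β modulo X ^ t, the square of this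
  -- factor is 1 modulo X ^ (2t), and r + 2s + 2t ≥ n keeps the second diagonal entry unchanged
  -- modulo X ^ n.
  have hu : IsUnit (b' * l.psiSeries) := (IsUnit.of_mul_eq_one _ hb').mul l.isUnit_psiSeries
  convert FormCongr.scale_right (α := q (X ^ (r - 1) * (1 + X * o₁ ^ 2))) (hu.map q) using 1
  · rw [← map_mul]
    congr 1
    linear_combination (-l.psiSeries) * hb
  · rw [← map_pow, ← map_mul]
    refine map_eq_of_dvd q hq ?_
    obtain ⟨v, hv⟩ := hψ
    have : l.muSeries - (b' * l.psiSeries) ^ 2 * X ^ (r + 2 * s) =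
        X ^ (r + 2 * s + 2 * t) * (b' * v) ^ 2 := by
      rw [show l.muSeries = X ^ (r + 2 * s) from rfl, show l.psiSeries = b - X ^ t * v by
        rw [← hv]; ring]
      linear_combination (-X ^ (r + 2 * s) * (b * b' + 1)) * hb +
        (X ^ (r + 2 * s) * X ^ t * v * b' * b' * b - X ^ (r + 2 * s + 2 * t) * (b' * v) ^ 2) * h2
    rw [this]
    exact (pow_dvd_pow _ (by omega)).mul_right _

end Existence

end Series

end KleinSymplectic

namespace KleinSymplectic

open PowerSeries (X coeff)

/-! ### Uniqueness of the normal form -/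

section Uniqueness

variable {K : Type*} [Field K] {n : ℕ}

/-- The normal forms of two labels are related modulo `X ^ n` by the matrix `[a, b; c, d]`. -/
def SeriesRel (l l' : Label n K) (a b c d : PowerSeries K) : Prop :=
  (X : PowerSeries K) ^ n ∣ l'.phiSeries - (a ^ 2 * l.phiSeries + c ^ 2 * l.muSeries) ∧
  (X : PowerSeries K) ^ n ∣
    l'.psiSeries - (a * b * l.phiSeries + (a * d + b * c) * l.psiSeries + c * d * l.muSeries) ∧
  (X : PowerSeries K) ^ n ∣ l'.muSeries - (b ^ 2 * l.phiSeries + d ^ 2 * l.muSeries)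

variable {l l' : Label n K} {a b c d : PowerSeries K}

/-- If r' < r, then φ and μ, hence φ', are divisible by X ^ r', but the coefficient of X ^ (r' - 1)
in φ' is 1. -/
theorem SeriesRel.r_le (h : SeriesRel l l' a b c d) : l.r ≤ l'.r := by
  by_contra! hlt
  have hr := l.r_le
  have hr' := l'.two_le_r
  have hφ : (X : PowerSeries K) ^ l'.r ∣ l.phiSeries := by
    refine dvd_add (pow_dvd_pow _ (by omega)) (Finset.dvd_sum fun j _ => ?_)
    exact (pow_dvd_pow _ (by omega)).mul_left _
  have hμ : (X : PowerSeries K) ^ l'.r ∣ l.muSeries := pow_dvd_pow _ (by omega)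
  have h1 : (X : PowerSeries K) ^ l'.r ∣ l'.phiSeries :=
    (dvd_sub_left (dvd_add (hφ.mul_left _) (hμ.mul_left _))).1
      ((pow_dvd_pow _ (by omega)).trans h.1)
  rw [PowerSeries.X_pow_dvd_iff] at h1
  have h2 := h1 (l'.r - 1) (by omega)
  have h3 : coeff (l'.r - 1)
      (∑ j : Fin l'.s, PowerSeries.C (l'.phi j) * X ^ (l'.r + 2 * (j : ℕ))) = 0 := by
    rw [map_sum]
    refine Finset.sum_eq_zero fun j _ => ?_
    rw [PowerSeries.coeff_C_mul, PowerSeries.coeff_X_pow, if_neg (by omega), mul_zero]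
  rw [Label.phiSeries, map_add, h3, PowerSeries.coeff_X_pow_self] at h2
  simp at h2

theorem X_pow_dvd_of_mul {i j m : ℕ} {p : PowerSeries K} (h : (X : PowerSeries K) ^ m ∣ X ^ i * p)
    (hm : i + j ≤ m) : (X : PowerSeries K) ^ j ∣ p := by
  have h1 := (pow_dvd_pow _ hm).trans h
  rw [pow_add] at h1
  exact (mul_dvd_mul_iff_left (pow_ne_zero _ PowerSeries.X_ne_zero)).1 h1

variable [CharP K 2]

theorem Label.exists_phiSeries_eq [PerfectRing K 2] (l : Label n K) :
    ∃ c : Fin l.s → K, (∀ j, c j ^ 2 = l.phi j) ∧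
      l.phiSeries = X ^ (l.r - 1) * (1 + X * finSeries c ^ 2) :=
  have h : ∀ j : Fin l.s, (frobeniusEquiv K 2).symm (l.phi j) ^ 2 = l.phi j := fun _ =>
    frobeniusEquiv_symm_pow_p K 2 _
  ⟨_, h, l.phiSeries_eq h⟩

/-- The parts of a relation between two normal forms with the same `r`. -/
theorem SeriesRel.dvd [PerfectRing K 2] (h : SeriesRel l l' a b c d) (hr : l'.r = l.r)
    {o : PowerSeries K} (ho : l.phiSeries = X ^ (l.r - 1) * (1 + X * o ^ 2))
    {o' : PowerSeries K} (ho' : l'.phiSeries = X ^ (l'.r - 1) * (1 + X * o' ^ 2)) :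
    (X : PowerSeries K) ^ ((n + 1 - l.r + 1) / 2) ∣ 1 + a ∧
      (X : PowerSeries K) ^ ((n + 1 - l.r) / 2) ∣ o' + (a * o + c * X ^ l.s) ∧
      (X : PowerSeries K) ^ ((n + 1 - l.r + 1) / 2) ∣ b ∧
      (X : PowerSeries K) ^ ((n + 1 - l.r) / 2) ∣ X ^ l'.s + (b * o + d * X ^ l.s) := by
  have h2 : (2 : PowerSeries K) = 0 := CharTwo.two_eq_zero
  have hr2 := l.two_le_r
  have hrn := l.r_le
  have hXr : (X : PowerSeries K) ^ l.r = X ^ (l.r - 1) * X := by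
    rw [← pow_succ, Nat.sub_add_cancel (by omega)]
  obtain ⟨h1, -, h3⟩ := h
  rw [hr] at ho'
  -- All terms of the diagonal relation collect into X ^ (r - 1) times a square plus X times a
  -- square; after cancelling the power, both squares vanish separately.
  rw [Label.muSeries, ho, ho', show X ^ (l.r - 1) * (1 + X * o' ^ 2) -
      (a ^ 2 * (X ^ (l.r - 1) * (1 + X * o ^ 2)) + c ^ 2 * X ^ (l.r + 2 * l.s)) =
      X ^ (l.r - 1) * ((1 + a) ^ 2 + X * (o' + (a * o + c * X ^ l.s)) ^ 2) by
    rw [pow_add, hXr]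
    linear_combination (-X ^ (l.r - 1) * (a + a ^ 2 + X * (o' * (a * o + c * X ^ l.s) + a * o * c * X ^ l.s +
      a ^ 2 * o ^ 2 + c ^ 2 * X ^ (2 * l.s)))) * h2] at h1
  rw [Label.muSeries, Label.muSeries, ho, hr, show X ^ (l.r + 2 * l'.s) -
      (b ^ 2 * (X ^ (l.r - 1) * (1 + X * o ^ 2)) + d ^ 2 * X ^ (l.r + 2 * l.s)) =
      X ^ (l.r - 1) * (b ^ 2 + X * (X ^ l'.s + (b * o + d * X ^ l.s)) ^ 2) by
    rw [pow_add, pow_add, hXr]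
    linear_combination (-X ^ (l.r - 1) * (b ^ 2 + X * (X ^ l'.s * (b * o + d * X ^ l.s) +
      b * o * d * X ^ l.s + b ^ 2 * o ^ 2 + d ^ 2 * X ^ (2 * l.s)))) * h2] at h3
  obtain ⟨h4, h5⟩ := X_pow_dvd_sq_add_X_mul_sq (N := n + 1 - l.r)
    (X_pow_dvd_of_mul h1 (by omega))
  obtain ⟨h6, h7⟩ := X_pow_dvd_sq_add_X_mul_sq (N := n + 1 - l.r)
    (X_pow_dvd_of_mul h3 (by omega))
  exact ⟨h4, h5, h6, h7⟩

/-- Modulo X ^ ((n + 1 - r) / 2), X ^ s' equals b * o + d * X ^ s up to sign. The precision is at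
least s and X ^ s divides b, so X ^ s divides X ^ s'. -/
theorem SeriesRel.s_le [PerfectRing K 2] (h : SeriesRel l l' a b c d) (hr : l'.r = l.r) :
    l.s ≤ l'.s := by
  obtain ⟨o, -, ho⟩ := l.exists_phiSeries_eq
  obtain ⟨o', -, ho'⟩ := l'.exists_phiSeries_eq
  obtain ⟨-, -, h1, h2⟩ := h.dvd hr ho ho'
  have hs := l.s_le
  have h3 : (X : PowerSeries K) ^ l.s ∣ b := (pow_dvd_pow _ (by omega)).trans h1
  have h4 : (X : PowerSeries K) ^ l.s ∣ X ^ l'.s :=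
    (dvd_add_left (dvd_add (h3.mul_right _) (dvd_mul_left _ _))).1
      ((pow_dvd_pow _ (by omega)).trans h2)
  exact (pow_dvd_pow_iff PowerSeries.X_ne_zero PowerSeries.X_prime.not_isUnit).1 h4

/-- Since a ≡ 1 and b ≡ 0, the odd parts `o`, `o'` agree modulo X ^ s, hence as polynomials.
Cancelling X ^ s then gives c ≡ 0 and d ≡ 1 modulo X ^ t, so the transformation is trivial to the
precision to which ψ is recorded. -/
theorem SeriesRel.eq [PerfectRing K 2] (h : SeriesRel l l' a b c d) (hr : l'.r = l.r)
    (hs : l'.s = l.s) : l' = l := by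
  have h2 : (2 : PowerSeries K) = 0 := CharTwo.two_eq_zero
  obtain ⟨o, hoφ, ho⟩ := l.exists_phiSeries_eq
  obtain ⟨o', hoφ', ho'⟩ := l'.exists_phiSeries_eq
  obtain ⟨ha, hc, hb, hd⟩ := h.dvd hr ho ho'
  have hψ := h.2.1
  clear h ho ho'
  obtain ⟨r, s, hr2, hrn, hsn, φ, ψ, hψ0⟩ := l
  obtain ⟨r', s', hr2', hrn', hsn', φ', ψ', hψ0'⟩ := l'
  simp only at hr hs
  subst hr hs
  simp only at *
  set e := (n + 1 - r') / 2 with he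
  have hb' : (X : PowerSeries K) ^ e ∣ b := (pow_dvd_pow _ (by omega)).trans hb
  have ha' : (X : PowerSeries K) ^ e ∣ 1 + a := (pow_dvd_pow _ (by omega)).trans ha
  have hse : s' ≤ e := by omega
  have hoo : o' = o := by
    refine finSeries_congr ?_
    have h3 : (X : PowerSeries K) ^ s' ∣ 1 + a := (pow_dvd_pow _ hse).trans ha'
    have h4 := (pow_dvd_pow _ hse).trans hc
    rw [show finSeries o' - finSeries o = (finSeries o' + (a * finSeries o + c * X ^ s')) -
      ((1 + a) * finSeries o + c * X ^ s') by ring]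
    exact dvd_sub h4 (dvd_add (h3.mul_right _) (dvd_mul_left _ _))
  subst hoo
  obtain rfl : φ' = φ := by
    funext j
    rw [← hoφ, ← hoφ']
  have hc' : (X : PowerSeries K) ^ ((n + 1 - r' - 2 * s') / 2) ∣ c := by
    refine X_pow_dvd_of_mul (i := s') (m := e) ?_ (by omega)
    rw [show X ^ s' * c = (finSeries o' + (a * finSeries o' + c * X ^ s')) -
      (1 + a) * finSeries o' by ring]
    exact dvd_sub hc (ha'.mul_right _)
  have hd' : (X : PowerSeries K) ^ ((n + 1 - r' - 2 * s') / 2) ∣ 1 + d := by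
    refine X_pow_dvd_of_mul (i := s') (m := e) ?_ (by omega)
    rw [show X ^ s' * (1 + d) = (X ^ s' + (b * finSeries o' + d * X ^ s')) -
      b * finSeries o' by ring]
    exact dvd_sub hd (hb'.mul_right _)
  have hb'' : (X : PowerSeries K) ^ ((n + 1 - r' - 2 * s') / 2) ∣ b := (pow_dvd_pow _ (by omega)).trans hb'
  have ha'' : (X : PowerSeries K) ^ ((n + 1 - r' - 2 * s') / 2) ∣ 1 + a := (pow_dvd_pow _ (by omega)).trans ha'
  obtain rfl : ψ' = ψ := by
    refine finSeries_congr ?_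
    -- The diagonal entries may be arbitrary here: they are multiplied by ab and cd, and b and c
    -- vanish modulo X ^ t.
    have key : ∀ F G : PowerSeries K, (X : PowerSeries K) ^ ((n + 1 - r' - 2 * s') / 2) ∣
        1 + finSeries ψ' -
          (a * b * F + (a * d + b * c) * (1 + finSeries ψ) + c * d * G) →
        (X : PowerSeries K) ^ ((n + 1 - r' - 2 * s') / 2) ∣ finSeries ψ' - finSeries ψ := by
      intro F G h5
      rw [show finSeries ψ' - finSeries ψ = (1 + finSeries ψ' -
        (a * b * F + (a * d + b * c) * (1 + finSeries ψ) + c * d * G)) +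
        (b * (a * F) + (b * (c * (1 + finSeries ψ)) + (c * (d * G) +
          ((1 + d) * (a * (1 + finSeries ψ)) - (1 + a) * (1 + finSeries ψ))))) by ring]
      exact dvd_add h5 (dvd_add (hb''.mul_right _) (dvd_add (hb''.mul_right _)
        (dvd_add (hc'.mul_right _) (dvd_sub (hd'.mul_right _) (ha''.mul_right _)))))
    exact key _ _ ((pow_dvd_pow _ (by omega)).trans hψ)
  rfl

/-- Congruent normal forms have the same label. -/
theorem label_eq_of_formCongr [PerfectRing K 2] {R : Type*} [CommRing R] [CharP R 2]
    (q : PowerSeries K →+* R) (hq : ∀ p, q p = 0 → (X : PowerSeries K) ^ n ∣ p)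
    (hsurj : Function.Surjective q)
    (h : FormCongr (q l.phiSeries) (q l.psiSeries) (q l.muSeries)
      (q l'.phiSeries) (q l'.psiSeries) (q l'.muSeries)) : l' = l := by
  have key : ∀ l l' : Label n K, FormCongr (q l.phiSeries) (q l.psiSeries) (q l.muSeries)
      (q l'.phiSeries) (q l'.psiSeries) (q l'.muSeries) → ∃ a b c d, SeriesRel l l' a b c d := by
    rintro l l' ⟨a, b, c, d, -, h1, h2, h3⟩
    obtain ⟨a, rfl⟩ := hsurj a
    obtain ⟨b, rfl⟩ := hsurj b
    obtain ⟨c, rfl⟩ := hsurj c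
    obtain ⟨d, rfl⟩ := hsurj d
    refine ⟨a, b, c, d, hq _ ?_, hq _ ?_, hq _ ?_⟩ <;>
      simp only [map_sub, map_add, map_mul, map_pow, h1, h2, h3, sub_self]
  obtain ⟨a, b, c, d, h1⟩ := key _ _ h
  obtain ⟨a', b', c', d', h2⟩ := key _ _ h.symm
  -- Each relation only bounds r and s from one side; congruence is symmetric, so both bounds are
  -- available.
  have hr := le_antisymm h2.r_le h1.r_le
  exact h1.eq hr (le_antisymm (h2.s_le hr.symm) (h1.s_le hr))

end Uniqueness

end KleinSymplectic

namespace KleinSymplectic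

/-! ### Four-group modules as N × N: automorphisms and symplectic forms -/

theorem V4_cases (g : V4) : g = 1 ∨ g = g₁ ∨ g = g₂ ∨ g = g₁ * g₂ := by
  revert g
  unfold g₁ g₂
  decide

section Coords

variable {k M N : Type*} [Field k] [AddCommGroup M] [Module k M]
  [AddCommGroup N] [Module k N]

/-- Coordinates identifying a module over the Klein four group with `N × N`, where `g₁` acts as
`[1, 1; 0, 1]` and `g₂` acts as `[1, T; 0, 1]`. -/
structure Coords (ρ : Representation k V4 M) (T : N →ₗ[k] N) where
  e : M ≃ₗ[k] N × N
  apply_g₁ : ∀ x, e (ρ g₁ x) = ((e x).1 + (e x).2, (e x).2)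
  apply_g₂ : ∀ x, e (ρ g₂ x) = ((e x).1 + T (e x).2, (e x).2)

/-- An invertible relation that holds at the two generators holds on the whole group. -/
theorem forall_V4 (ρ : Representation k V4 M) {p : (M →ₗ[k] M) → Prop} (h1 : p 1)
    (hg₁ : p (ρ g₁)) (hg₂ : p (ρ g₂)) (hmul : p (ρ g₁) → p (ρ g₂) → p (ρ g₁ * ρ g₂)) (g : V4) :
    p (ρ g) := by
  rcases V4_cases g with rfl | rfl | rfl | rfl
  · rwa [map_one]
  · exact hg₁
  · exact hg₂
  · rw [map_mul]; exact hmul hg₁ hg₂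

theorem isModuleAut_iff {ρ : Representation k V4 M} {α : M ≃ₗ[k] M} : IsModuleAut ρ α ↔
    (∀ x, α (ρ g₁ x) = ρ g₁ (α x)) ∧ ∀ x, α (ρ g₂ x) = ρ g₂ (α x) :=
  ⟨fun h => ⟨h _, h _⟩, fun h => forall_V4 ρ (p := fun f => ∀ x, α (f x) = f (α x))
    (fun _ => rfl) h.1 h.2 fun h h' x => by simp [h, h']⟩

theorem invariant_iff {ρ : Representation k V4 M} {B : LinearMap.BilinForm k M} :
    (∀ g x y, B (ρ g x) (ρ g y) = B x y) ↔
    (∀ x y, B (ρ g₁ x) (ρ g₁ y) = B x y) ∧ ∀ x y, B (ρ g₂ x) (ρ g₂ y) = B x y :=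
  ⟨fun h => ⟨h _, h _⟩, fun h => forall_V4 ρ (p := fun f => ∀ x y, B (f x) (f y) = B x y)
    (fun _ _ => rfl) h.1 h.2 fun h h' x => by simp [h, h']⟩

theorem qinvariant_iff {ρ : Representation k V4 M} {q : QuadraticForm k M} :
    (∀ g x, q (ρ g x) = q x) ↔ (∀ x, q (ρ g₁ x) = q x) ∧ ∀ x, q (ρ g₂ x) = q x :=
  ⟨fun h => ⟨h _, h _⟩, fun h => forall_V4 ρ (p := fun f => ∀ x, q (f x) = q x)
    (fun _ => rfl) h.1 h.2 fun h h' x => by simp [h, h']⟩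

theorem submodule_invariant_iff {ρ : Representation k V4 M} {P : Submodule k M} :
    (∀ g, ∀ x ∈ P, ρ g x ∈ P) ↔ (∀ x ∈ P, ρ g₁ x ∈ P) ∧ ∀ x ∈ P, ρ g₂ x ∈ P :=
  ⟨fun h => ⟨h _, h _⟩, fun h => forall_V4 ρ (p := fun f => ∀ x ∈ P, f x ∈ P)
    (fun _ => id) h.1 h.2 fun h h' _ hx => h _ (h' _ hx)⟩

/-- The non-degenerate symmetric forms for which `T` is self-adjoint. -/
structure IsAdmissible (T : N →ₗ[k] N) (s : LinearMap.BilinForm k N) : Prop where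
  symm : ∀ x y, s x y = s y x
  adj : ∀ x y, s (T x) y = s x (T y)
  nondeg : ∀ x, (∀ y, s x y = 0) → x = 0

namespace Coords

variable {ρ : Representation k V4 M} {T : N →ₗ[k] N} (c : Coords ρ T)

/-- The form with Gram matrix `[0, s; s, 0]`. -/
def hyp (s : LinearMap.BilinForm k N) : LinearMap.BilinForm k M :=
  s.compl₁₂ (LinearMap.fst k N N ∘ₗ c.e.toLinearMap) (LinearMap.snd k N N ∘ₗ c.e.toLinearMap) +
  s.compl₁₂ (LinearMap.snd k N N ∘ₗ c.e.toLinearMap) (LinearMap.fst k N N ∘ₗ c.e.toLinearMap)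

theorem hyp_apply (s : LinearMap.BilinForm k N) (x y : M) :
    c.hyp s x y = s (c.e x).1 (c.e y).2 + s (c.e x).2 (c.e y).1 := rfl

theorem g₁_symm (u w : N) : ρ g₁ (c.e.symm (u, w)) = c.e.symm (u + w, w) := by
  apply c.e.injective; rw [c.apply_g₁]; simp

theorem g₂_symm (u w : N) : ρ g₂ (c.e.symm (u, w)) = c.e.symm (u + T w, w) := by
  apply c.e.injective; rw [c.apply_g₂]; simp

theorem symm_add (u w : N) : c.e.symm (u, w) = c.e.symm (u, 0) + c.e.symm (0, w) := by
  rw [← map_add]; simp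

/-- Applying g₁ changes the form by 2 s(x₂, y₂) = 0, and g₂ changes it by s(T x₂, y₂) + s(x₂, T y₂).
Invariance is therefore self-adjointness of T. -/
theorem isSymplectic_hyp_iff [CharP k 2] {s : LinearMap.BilinForm k N} (hs : ∀ x y, s x y = s y x) :
    IsSymplectic ρ (c.hyp s) ↔ IsAdmissible T s := by
  constructor
  · rintro ⟨-, hnd, hinv⟩
    refine ⟨hs, fun x y => ?_, fun x hx => ?_⟩
    · have := hinv g₂ (c.e.symm (0, x)) (c.e.symm (0, y))
      simp only [g₂_symm, hyp_apply, LinearEquiv.apply_symm_apply, zero_add, map_zero,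
        LinearMap.zero_apply] at this
      exact CharTwo.add_eq_zero.1 this
    · have h1 := hnd.1 (c.e.symm (x, 0)) fun y => by simp [hyp_apply, hx]
      simpa using h1
  · rintro ⟨-, hadj, hnd⟩
    refine ⟨fun x => ?_, ?_, invariant_iff.2 ⟨fun x y => ?_, fun x y => ?_⟩⟩
    · rw [hyp_apply, hs, CharTwo.add_self_eq_zero]
    · have hl : (c.hyp s).SeparatingLeft := by
        intro x hx
        apply c.e.injective
        rw [map_zero]
        ext
        · refine hnd _ fun y => ?_
          simpa [hyp_apply] using hx (c.e.symm (0, y))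
        · refine hnd _ fun y => ?_
          simpa [hyp_apply] using hx (c.e.symm (y, 0))
      refine ⟨hl, fun x hx => hl x fun y => ?_⟩
      rw [← hx y, hyp_apply, hyp_apply, hs, hs (c.e x).2, add_comm]
    · simp only [hyp_apply, c.apply_g₁, map_add, LinearMap.add_apply]
      rw [add_comm (s (c.e x).2 (c.e y).1), ← add_assoc, add_assoc (s (c.e x).1 (c.e y).2),
        CharTwo.add_self_eq_zero, add_zero]
    · simp only [hyp_apply, c.apply_g₂, map_add, LinearMap.add_apply, hadj]
      rw [add_comm (s (c.e x).2 (c.e y).1), ← add_assoc, add_assoc (s (c.e x).1 (c.e y).2),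
        CharTwo.add_self_eq_zero, add_zero]

/-- The automorphism of `M` with matrix `[A, B; 0, A]`. -/
def aut (A : N ≃ₗ[k] N) (B : N →ₗ[k] N) : M ≃ₗ[k] M :=
  let E : (N × N) ≃ₗ[k] N × N := LinearEquiv.ofLinearMap
    (LinearMap.prod (A.toLinearMap ∘ₗ LinearMap.fst k N N + B ∘ₗ LinearMap.snd k N N)
      (A.toLinearMap ∘ₗ LinearMap.snd k N N))
    (LinearMap.prod (A.symm.toLinearMap ∘ₗ LinearMap.fst k N N -
        A.symm.toLinearMap ∘ₗ B ∘ₗ A.symm.toLinearMap ∘ₗ LinearMap.snd k N N)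
      (A.symm.toLinearMap ∘ₗ LinearMap.snd k N N))
    (by ext x <;> simp) (by ext x <;> simp)
  c.e ≪≫ₗ E ≪≫ₗ c.e.symm

theorem e_aut (A : N ≃ₗ[k] N) (B : N →ₗ[k] N) (x : M) :
    c.e (c.aut A B x) = (A (c.e x).1 + B (c.e x).2, A (c.e x).2) := by
  simp [aut]

theorem isModuleAut_aut {A : N ≃ₗ[k] N} (hA : ∀ x, A (T x) = T (A x)) (B : N →ₗ[k] N) :
    IsModuleAut ρ (c.aut A B) := by
  refine isModuleAut_iff.2 ⟨fun x => ?_, fun x => ?_⟩ <;> apply c.e.injective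
  · simp only [e_aut, apply_g₁, map_add]
    rw [add_right_comm]
  · simp only [e_aut, apply_g₂, map_add, hA]
    rw [add_right_comm]

/-- (w, 0) is (g₁ - 1)(0, w) and (T w, 0) is (g₂ - 1)(0, w). Commuting with g₁ makes the two
diagonal blocks equal, and commuting with g₂ makes this block commute with T. -/
theorem exists_eq_aut [FiniteDimensional k N] {α : M ≃ₗ[k] M} (hα : IsModuleAut ρ α) :
    ∃ (A : N ≃ₗ[k] N) (B : N →ₗ[k] N), (∀ x, A (T x) = T (A x)) ∧
      ∀ x, c.e (α x) = (A (c.e x).1 + B (c.e x).2, A (c.e x).2) := by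
  let A₀ : N →ₗ[k] N := LinearMap.snd k N N ∘ₗ c.e.toLinearMap ∘ₗ α.toLinearMap ∘ₗ
    c.e.symm.toLinearMap ∘ₗ LinearMap.inr k N N
  let B : N →ₗ[k] N := LinearMap.fst k N N ∘ₗ c.e.toLinearMap ∘ₗ α.toLinearMap ∘ₗ
    c.e.symm.toLinearMap ∘ₗ LinearMap.inr k N N
  have hw : ∀ w, c.e (α (c.e.symm (0, w))) = (B w, A₀ w) := fun w => rfl
  have hu : ∀ w, c.e (α (c.e.symm (w, 0))) = (A₀ w, 0) := by
    intro w
    have h1 : c.e.symm (w, 0) = ρ g₁ (c.e.symm (0, w)) - c.e.symm (0, w) := by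
      rw [g₁_symm, ← map_sub]; simp
    rw [h1, map_sub, hα, map_sub, c.apply_g₁, hw]
    simp
  have hT : ∀ w, A₀ (T w) = T (A₀ w) := by
    intro w
    have h1 : c.e.symm (T w, 0) = ρ g₂ (c.e.symm (0, w)) - c.e.symm (0, w) := by
      rw [g₂_symm, ← map_sub]; simp
    have h2 := hu (T w)
    rw [h1, map_sub, hα, map_sub, c.apply_g₂, hw] at h2
    simpa using (congrArg Prod.fst h2).symm
  have hinj : Function.Injective A₀ := by
    rw [injective_iff_map_eq_zero]
    intro w h
    have h1 : c.e (α (c.e.symm (w, 0))) = 0 := by rw [hu, h]; rfl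
    simpa using h1
  refine ⟨LinearEquiv.ofInjectiveEndo A₀ hinj, B, hT, fun x => ?_⟩
  obtain ⟨⟨u, w⟩, rfl⟩ := c.e.symm.surjective x
  rw [symm_add, map_add, map_add, hu, hw]
  simp

/-- The pairing of the upper with the lower half only sees the diagonal block A. -/
theorem isometric_hyp_iff [FiniteDimensional k N] {s s' : LinearMap.BilinForm k N} :
    Isometric ρ (c.hyp s) (c.hyp s') ↔
      ∃ A : N ≃ₗ[k] N, (∀ x, A (T x) = T (A x)) ∧ ∀ x y, s (A x) (A y) = s' x y := by
  constructor
  · rintro ⟨α, hα, h⟩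
    obtain ⟨A, B, hT, hA⟩ := c.exists_eq_aut hα
    refine ⟨A, hT, fun x y => ?_⟩
    have := h (c.e.symm (x, 0)) (c.e.symm (0, y))
    simpa [hyp_apply, hA] using this
  · rintro ⟨A, hT, h⟩
    refine ⟨c.aut A 0, c.isModuleAut_aut hT 0, fun x y => ?_⟩
    simp [hyp_apply, e_aut, h]

end Coords

/-- In characteristic two (or any other), an alternating form is `c x y - c y x` for some `c`. -/
theorem exists_sub_flip_eq [FiniteDimensional k N] {b : LinearMap.BilinForm k N} (hb : b.IsAlt) :
    ∃ c : LinearMap.BilinForm k N, ∀ x y, b x y = c x y - c y x := by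
  let v := Module.finBasis k N
  let c := Matrix.toBilin v (Matrix.of fun i j => if i < j then b (v i) (v j) else 0)
  have h : b = c - c.flip := by
    refine LinearMap.BilinForm.ext_basis v fun i j => ?_
    have hc : ∀ i j, c (v i) (v j) = if i < j then b (v i) (v j) else 0 := by
      intro i j
      have := congrFun (congrFun (LinearMap.BilinForm.toMatrix_toBilin v
        (Matrix.of fun i j => if i < j then b (v i) (v j) else 0)) i) j
      rwa [LinearMap.BilinForm.toMatrix_apply] at this
    rw [LinearMap.sub_apply, LinearMap.sub_apply, LinearMap.BilinForm.flip_apply, hc, hc]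
    rcases lt_trichotomy i j with hij | rfl | hij
    · simp [hij, hij.not_gt]
    · simp [hb (v i)]
    · simp [hij, hij.not_gt, hb.neg_eq]
  refine ⟨c, fun x y => ?_⟩
  conv_lhs => rw [h]
  rfl

namespace Coords

variable {ρ : Representation k V4 M} {T : N →ₗ[k] N} (c : Coords ρ T) [CharP k 2]

/-- Every symplectic form is isometric to one with Gram matrix `[0, s; s, 0]`. -/
theorem exists_isometric_hyp [FiniteDimensional k N] {B : LinearMap.BilinForm k M}
    (hB : IsSymplectic ρ B) : ∃ s, IsAdmissible T s ∧ Isometric ρ B (c.hyp s) := by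
  obtain ⟨halt, hnd, hinv⟩ := hB
  have hsymm : ∀ x y, B x y = B y x := fun x y => by
    rw [← halt.neg_eq, CharTwo.neg_eq]
  let i₁ : N →ₗ[k] M := c.e.symm.toLinearMap ∘ₗ LinearMap.inl k N N
  let i₂ : N →ₗ[k] M := c.e.symm.toLinearMap ∘ₗ LinearMap.inr k N N
  let s : LinearMap.BilinForm k N := B.compl₁₂ i₁ i₂
  let b : LinearMap.BilinForm k N := B.compl₁₂ i₂ i₂
  have h1 : ∀ w : N, ρ g₁ (i₂ w) = i₁ w + i₂ w := fun w => by
    simp only [i₁, i₂, LinearMap.comp_apply, LinearEquiv.coe_coe, LinearMap.inl_apply,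
      LinearMap.inr_apply]
    rw [g₁_symm, symm_add, zero_add]
  have h2 : ∀ w : N, ρ g₂ (i₂ w) = i₁ (T w) + i₂ w := fun w => by
    simp only [i₁, i₂, LinearMap.comp_apply, LinearEquiv.coe_coe, LinearMap.inl_apply,
      LinearMap.inr_apply]
    rw [g₂_symm, symm_add, zero_add]
  have h3 : ∀ u : N, ρ g₁ (i₁ u) = i₁ u := fun w => by
    simp only [i₁, LinearMap.comp_apply, LinearEquiv.coe_coe, LinearMap.inl_apply]
    rw [g₁_symm, add_zero]
  -- g₁ fixes the upper vector and adds an upper vector to the lower one, so invariance forces the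
  -- upper half to be totally isotropic.
  have huu : ∀ u u', B (i₁ u) (i₁ u') = 0 := fun u u' => by
    have := hinv g₁ (i₁ u) (i₂ u')
    rw [h3, h1, map_add] at this
    simpa using this
  have hs : ∀ x y, s x y = s y x := fun x y => by
    have := hinv g₁ (i₂ x) (i₂ y)
    rw [h1, h1, map_add, map_add, LinearMap.add_apply, LinearMap.add_apply, huu, zero_add,
      ← add_assoc, add_eq_right, CharTwo.add_eq_zero, hsymm] at this
    exact this.symm
  have hdec : ∀ x, x = i₁ (c.e x).1 + i₂ (c.e x).2 := fun x => by
    simp only [i₁, i₂, LinearMap.comp_apply, LinearEquiv.coe_coe, LinearMap.inl_apply,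
      LinearMap.inr_apply]
    rw [← symm_add]; simp
  have hadm : IsAdmissible T s := by
    refine ⟨hs, fun x y => ?_, fun x hx => ?_⟩
    · have := hinv g₂ (i₂ x) (i₂ y)
      rw [h2, h2, map_add, map_add, LinearMap.add_apply, LinearMap.add_apply, huu, zero_add,
        ← add_assoc, add_eq_right, CharTwo.add_eq_zero, hsymm] at this
      rw [hs x]
      exact this.symm
    · have h4 := hnd.1 (i₁ x) fun y => by
        rw [hdec y, map_add, huu, zero_add]; exact hx _
      simpa [i₁] using h4
  have hbalt : b.IsAlt := fun x => halt _
  -- The block on the lower half is alternating, hence d minus its flip. The map D with s(D x, y) =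
  -- d(x, y) defines a shear whose cross terms cancel this block.
  obtain ⟨d, hd⟩ := exists_sub_flip_eq hbalt
  have hsnd : s.Nondegenerate := ⟨hadm.nondeg, fun x hx => hadm.nondeg x fun y => by
    rw [hs]; exact hx y⟩
  let D : N →ₗ[k] N := LinearMap.BilinForm.symmCompOfNondegenerate d s hsnd
  have hD : ∀ x y, s (D x) y = d x y := fun x y =>
    LinearMap.BilinForm.symmCompOfNondegenerate_left_apply d hsnd y x
  refine ⟨s, hadm, c.aut (LinearEquiv.refl k N) D, c.isModuleAut_aut (fun _ => rfl) D,
    fun x y => ?_⟩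
  rw [hdec (c.aut _ _ x), hdec (c.aut _ _ y), e_aut, e_aut, hyp_apply]
  simp only [LinearEquiv.refl_apply, map_add, LinearMap.add_apply, huu]
  have e1 : ∀ u w, B (i₁ u) (i₂ w) = s u w := fun _ _ => rfl
  have e2 : ∀ u w, B (i₂ w) (i₁ u) = s u w := fun _ _ => hsymm _ _
  have e3 : ∀ u w, B (i₂ u) (i₂ w) = b u w := fun _ _ => rfl
  rw [e1, e1, e2, e2, e3, hD, hD, hd, hs (c.e x).2]
  have h2 : (2 : k) = 0 := CharTwo.two_eq_zero
  linear_combination d (c.e x).2 (c.e y).2 * h2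

end Coords

end Coords

end KleinSymplectic

namespace KleinSymplectic

/-! ### Orthogonal decompositions of M and of N -/

section Decomposition

section Transfer

variable {k G M : Type*} [Field k] [Group G] [AddCommGroup M] [Module k M]
  {ρ : Representation k G M} {B B' : LinearMap.BilinForm k M}

theorem Isometric.symm (h : Isometric ρ B B') : Isometric ρ B' B := by
  obtain ⟨α, hα, h⟩ := h
  refine ⟨α.symm, fun g x => ?_, fun x y => ?_⟩
  · apply α.injective
    rw [hα]; simp
  · rw [← h]; simp

theorem Isometric.trans {B'' : LinearMap.BilinForm k M} (h : Isometric ρ B B')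
    (h' : Isometric ρ B' B'') : Isometric ρ B B'' := by
  obtain ⟨α, hα, h⟩ := h
  obtain ⟨β, hβ, h'⟩ := h'
  exact ⟨β.trans α, fun g x => by simp [hβ g x, hα g], fun x y => by simp [h, h']⟩

theorem Isometric.isSymplectic (h : Isometric ρ B B') (hB : IsSymplectic ρ B) :
    IsSymplectic ρ B' := by
  obtain ⟨α, hα, h⟩ := h
  obtain ⟨halt, hnd, hinv⟩ := hB
  refine ⟨fun x => by rw [← h]; exact halt _, ⟨fun x hx => ?_, fun x hx => ?_⟩, fun g x y => ?_⟩
  · refine α.map_eq_zero_iff.1 (hnd.1 _ fun y => ?_)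
    rw [← α.apply_symm_apply y, h]; exact hx _
  · refine α.map_eq_zero_iff.1 (hnd.2 _ fun y => ?_)
    rw [← α.apply_symm_apply y, h]; exact hx _
  · rw [← h, ← h, hα, hα, hinv]

theorem restrict_map_nondegenerate {α : M ≃ₗ[k] M} (h : ∀ x y, B (α x) (α y) = B' x y)
    {P : Submodule k M} (hP : (B'.restrict P).Nondegenerate) :
    (B.restrict (P.map α.toLinearMap)).Nondegenerate := by
  constructor
  · rintro ⟨-, x, hx, rfl⟩ hxy
    have h0 := hP.1 ⟨x, hx⟩ fun y => by
      have := hxy ⟨α y, Submodule.mem_map_of_mem y.2⟩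
      exact (h _ _).symm.trans this
    have : x = 0 := congrArg Subtype.val h0
    subst this
    ext; simp
  · rintro ⟨-, x, hx, rfl⟩ hxy
    have h0 := hP.2 ⟨x, hx⟩ fun y => by
      have := hxy ⟨α y, Submodule.mem_map_of_mem y.2⟩
      exact (h _ _).symm.trans this
    have : x = 0 := congrArg Subtype.val h0
    subst this
    ext; simp

theorem Isometric.isIndecomposableSymplectic (h : Isometric ρ B B')
    (hB : IsIndecomposableSymplectic ρ B) : IsIndecomposableSymplectic ρ B' := by
  refine ⟨h.isSymplectic hB.1, hB.2.1, ?_⟩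
  rintro ⟨P, Q, hP, hQ, hPt, hQt, hc, ho, hPn, hQn⟩
  obtain ⟨α, hα, h⟩ := h
  have hinv : ∀ P : Submodule k M, (∀ g, ∀ x ∈ P, ρ g x ∈ P) →
      ∀ g, ∀ x ∈ P.map α.toLinearMap, ρ g x ∈ P.map α.toLinearMap := by
    rintro P hP g - ⟨x, hx, rfl⟩
    exact ⟨ρ g x, hP g x hx, hα g x⟩
  have htop : ∀ P : Submodule k M, P ≠ ⊤ → P.map α.toLinearMap ≠ ⊤ := by
    intro P hP h0
    refine hP (Submodule.map_injective_of_injective α.injective ?_)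
    rw [h0, Submodule.map_top]
    exact (LinearMap.range_eq_top.2 α.surjective).symm
  refine hB.2.2 ⟨P.map α.toLinearMap, Q.map α.toLinearMap, hinv P hP, hinv Q hQ, htop P hPt,
    htop Q hQt, ?_, ?_, restrict_map_nondegenerate h hPn, restrict_map_nondegenerate h hQn⟩
  · exact hc.map (Submodule.orderIsoMapComap α)
  · rintro - ⟨x, hx, rfl⟩ - ⟨y, hy, rfl⟩
    exact (h x y).trans (ho x hx y hy)

end Transfer

variable {k M N : Type*} [Field k] [AddCommGroup M] [Module k M] [AddCommGroup N] [Module k N]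

/-- `s` is an orthogonal sum of forms on two non-zero `T`-invariant subspaces. -/
def Decomposes (T : N →ₗ[k] N) (s : LinearMap.BilinForm k N) : Prop :=
  ∃ W₁ W₂ : Submodule k N, (∀ x ∈ W₁, T x ∈ W₁) ∧ (∀ x ∈ W₂, T x ∈ W₂) ∧ W₁ ≠ ⊥ ∧ W₂ ≠ ⊥ ∧
    IsCompl W₁ W₂ ∧ ∀ x ∈ W₁, ∀ y ∈ W₂, s x y = 0

theorem restrict_nondegenerate_of_isCompl {B : LinearMap.BilinForm k M}
    (hB : ∀ x y, B x y = B y x) (hnd : B.Nondegenerate) {P Q : Submodule k M} (hc : IsCompl P Q)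
    (ho : ∀ x ∈ P, ∀ y ∈ Q, B x y = 0) : (B.restrict P).Nondegenerate := by
  have hl : ∀ x : P, (∀ y : P, B x y = 0) → x = 0 := by
    intro x hx
    refine Subtype.ext (hnd.1 _ fun z => ?_)
    obtain ⟨y, hy, z', hz, rfl⟩ := Submodule.mem_sup.1
      (hc.sup_eq_top ▸ Submodule.mem_top : z ∈ P ⊔ Q)
    rw [map_add, hx ⟨y, hy⟩, ho x x.2 z' hz, add_zero]
  exact ⟨hl, fun x hx => hl x fun y => (hB _ _).trans (hx y)⟩

namespace Coords

variable {ρ : Representation k V4 M} {T : N →ₗ[k] N} (c : Coords ρ T)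

/-- The projection of a submodule to the lower coordinate. -/
def lower (P : Submodule k M) : Submodule k N :=
  P.map (LinearMap.snd k N N ∘ₗ c.e.toLinearMap)

theorem mem_lower_of_mem {P : Submodule k M} {x : M} (hx : x ∈ P) : (c.e x).2 ∈ c.lower P :=
  ⟨x, hx, rfl⟩

/-- If w is the lower coordinate of x, then (w, 0) = (g₁ - 1)x and (T w, 0) = (g₂ - 1)x. -/
theorem symm_mem_of_mem_lower {P : Submodule k M} (hP : ∀ g, ∀ x ∈ P, ρ g x ∈ P) {w : N}
    (hw : w ∈ c.lower P) : c.e.symm (w, 0) ∈ P ∧ c.e.symm (T w, 0) ∈ P := by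
  obtain ⟨x, hx, rfl⟩ := hw
  have h1 : c.e.symm ((c.e x).2, 0) = ρ g₁ x - x := by
    apply c.e.injective; rw [map_sub, c.apply_g₁]; ext <;> simp
  have h2 : c.e.symm (T (c.e x).2, 0) = ρ g₂ x - x := by
    apply c.e.injective; rw [map_sub, c.apply_g₂]; ext <;> simp
  exact ⟨h1 ▸ P.sub_mem (hP _ _ hx) hx, h2 ▸ P.sub_mem (hP _ _ hx) hx⟩

theorem lower_isCompl {P Q : Submodule k M} (hP : ∀ g, ∀ x ∈ P, ρ g x ∈ P)
    (hQ : ∀ g, ∀ x ∈ Q, ρ g x ∈ Q) (hc : IsCompl P Q) : IsCompl (c.lower P) (c.lower Q) := by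
  constructor
  · rw [Submodule.disjoint_def]
    intro w h h'
    have := Submodule.disjoint_def.1 hc.disjoint _ (c.symm_mem_of_mem_lower hP h).1
      (c.symm_mem_of_mem_lower hQ h').1
    simpa using this
  · rw [codisjoint_iff, lower, lower, ← Submodule.map_sup, hc.sup_eq_top, Submodule.map_top,
      LinearMap.range_eq_top]
    exact Prod.snd_surjective.comp c.e.surjective

/-- Split u along the two lower projections. The component in the projection of Q, put in the upper
half, lies in both P and Q, so it is zero. -/
theorem mem_lower_of_symm_mem {P Q : Submodule k M} (hP : ∀ g, ∀ x ∈ P, ρ g x ∈ P)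
    (hQ : ∀ g, ∀ x ∈ Q, ρ g x ∈ Q) (hc : IsCompl P Q) {u : N} (hu : c.e.symm (u, 0) ∈ P) :
    u ∈ c.lower P := by
  obtain ⟨w, hw, w', hw', rfl⟩ := Submodule.mem_sup.1
    ((c.lower_isCompl hP hQ hc).sup_eq_top ▸ Submodule.mem_top : u ∈ c.lower P ⊔ c.lower Q)
  have h1 : c.e.symm (w', 0) ∈ P := by
    have := P.sub_mem hu (c.symm_mem_of_mem_lower hP hw).1
    rwa [← map_sub, Prod.mk_sub_mk, add_sub_cancel_left, sub_zero] at this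
  have := Submodule.disjoint_def.1 hc.disjoint _ h1 (c.symm_mem_of_mem_lower hQ hw').1
  obtain rfl : w' = 0 := by simpa using this
  simpa using hw

theorem lower_ne_bot {P Q : Submodule k M} (hP : ∀ g, ∀ x ∈ P, ρ g x ∈ P)
    (hQ : ∀ g, ∀ x ∈ Q, ρ g x ∈ Q) (hc : IsCompl P Q) (hQt : Q ≠ ⊤) : c.lower P ≠ ⊥ := by
  intro h
  have hPb : P = ⊥ := by
    rw [eq_bot_iff]
    intro x hx
    have h1 : (c.e x).2 = 0 := (Submodule.mem_bot k).1 (h ▸ c.mem_lower_of_mem hx)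
    have h2 : x = c.e.symm ((c.e x).1, 0) := by
      rw [← h1]; simp
    have h3 : (c.e x).1 = 0 :=
      (Submodule.mem_bot k).1 (h ▸ c.mem_lower_of_symm_mem hP hQ hc (h2 ▸ hx))
    rw [h2, h3]
    simp
  subst hPb
  exact hQt (eq_top_of_bot_isCompl hc)

/-- A splitting of M projects to one of N by lower coordinates, T-invariant because the upper and
lower halves of a summand then coincide; conversely W₁ and W₂ give W₁ × W₁ and W₂ × W₂.
Non-degeneracy on the summands follows from orthogonality. -/
theorem isIndecomposableSymplectic_hyp_iff [CharP k 2] {s : LinearMap.BilinForm k N}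
    (hs : IsAdmissible T s) [Nontrivial N] :
    IsIndecomposableSymplectic ρ (c.hyp s) ↔ ¬ Decomposes T s := by
  have hsy := (c.isSymplectic_hyp_iff hs.symm).2 hs
  have : Nontrivial M := c.e.toEquiv.nontrivial
  rw [IsIndecomposableSymplectic, and_iff_right hsy, and_iff_right this, not_iff_not]
  constructor
  · rintro ⟨P, Q, hP, hQ, hPt, hQt, hc, ho, -, -⟩
    refine ⟨c.lower P, c.lower Q, fun x hx => ?_, fun x hx => ?_, c.lower_ne_bot hP hQ hc hQt,
      c.lower_ne_bot hQ hP hc.symm hPt, c.lower_isCompl hP hQ hc, ?_⟩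
    · exact c.mem_lower_of_symm_mem hP hQ hc (c.symm_mem_of_mem_lower hP hx).2
    · exact c.mem_lower_of_symm_mem hQ hP hc.symm (c.symm_mem_of_mem_lower hQ hx).2
    · rintro x hx - ⟨y, hy, rfl⟩
      simpa [hyp_apply] using ho _ (c.symm_mem_of_mem_lower hP hx).1 y hy
  · rintro ⟨W₁, W₂, h₁, h₂, hb₁, hb₂, hc, ho⟩
    have hinv : ∀ W : Submodule k N, (∀ x ∈ W, T x ∈ W) →
        ∀ g, ∀ x ∈ (W.prod W).comap c.e.toLinearMap, ρ g x ∈ (W.prod W).comap c.e.toLinearMap := by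
      intro W hW
      refine submodule_invariant_iff.2 ⟨fun x hx => ?_, fun x hx => ?_⟩
      · simp only [Submodule.mem_comap, LinearEquiv.coe_coe, c.apply_g₁] at *
        exact ⟨W.add_mem hx.1 hx.2, hx.2⟩
      · simp only [Submodule.mem_comap, LinearEquiv.coe_coe, c.apply_g₂] at *
        exact ⟨W.add_mem hx.1 (hW _ hx.2), hx.2⟩
    have htop : ∀ W W' : Submodule k N, IsCompl W W' → W' ≠ ⊥ →
        (W.prod W).comap c.e.toLinearMap ≠ ⊤ := by
      intro W W' hc hb h
      have hW : W = ⊤ := by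
        rw [eq_top_iff]
        rintro x -
        have h1 : c.e.symm (x, 0) ∈ (W.prod W).comap c.e.toLinearMap := h ▸ Submodule.mem_top
        have h2 : c.e (c.e.symm (x, 0)) ∈ W.prod W := h1
        rw [LinearEquiv.apply_symm_apply] at h2
        exact h2.1
      subst hW
      exact hb (eq_bot_of_top_isCompl hc)
    have hcompl : IsCompl ((W₁.prod W₁).comap c.e.toLinearMap)
        ((W₂.prod W₂).comap c.e.toLinearMap) := by
      constructor
      · rw [Submodule.disjoint_def] at *
        intro x hx hx'
        apply c.e.injective
        have := Submodule.disjoint_def.1 hc.disjoint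
        exact Prod.ext (this _ hx.1 hx'.1) (this _ hx.2 hx'.2) |>.trans (map_zero _).symm
      · rw [codisjoint_iff, eq_top_iff]
        rintro x -
        have hd : ∀ y : N, ∃ a ∈ W₁, ∃ b ∈ W₂, a + b = y := fun y =>
          Submodule.mem_sup.1 (hc.sup_eq_top ▸ Submodule.mem_top)
        obtain ⟨a, ha, b, hb, h1⟩ := hd (c.e x).1
        obtain ⟨a', ha', b', hb', h2⟩ := hd (c.e x).2
        refine Submodule.mem_sup.2 ⟨c.e.symm (a, a'), ?_, c.e.symm (b, b'), ?_, ?_⟩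
        · simpa using ⟨ha, ha'⟩
        · simpa using ⟨hb, hb'⟩
        · apply c.e.injective
          simp [h1, h2]
    have hortho : ∀ x ∈ (W₁.prod W₁).comap c.e.toLinearMap,
        ∀ y ∈ (W₂.prod W₂).comap c.e.toLinearMap, c.hyp s x y = 0 := fun x hx y hy => by
      have h1 : s (c.e x).1 (c.e y).2 = 0 := ho _ hx.1 _ hy.2
      have h2 : s (c.e x).2 (c.e y).1 = 0 := ho _ hx.2 _ hy.1
      rw [hyp_apply, h1, h2, add_zero]
    have hsymm : ∀ x y, c.hyp s x y = c.hyp s y x := fun x y => by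
      rw [hyp_apply, hyp_apply, hs.symm, hs.symm (c.e x).2, add_comm]
    exact ⟨_, _, hinv W₁ h₁, hinv W₂ h₂, htop _ _ hc hb₂, htop _ _ hc.symm hb₁, hcompl, hortho,
      restrict_nondegenerate_of_isCompl hsymm hsy.2.1 hcompl hortho,
      restrict_nondegenerate_of_isCompl hsymm hsy.2.1 hcompl.symm fun x hx y hy =>
        (hsymm _ _).trans (hortho _ hy _ hx)⟩

end Coords

end Decomposition

end KleinSymplectic

namespace KleinSymplectic

/-! ### From k-forms with T self-adjoint to symmetric matrices over R -/

section RingCoords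

/-- The symmetric bilinear form on `R × R` with Gram matrix `[α, β; β, γ]`. -/
def bil {R : Type*} [CommRing R] (α β γ : R) (x y : R × R) : R :=
  α * (x.1 * y.1) + β * (x.1 * y.2 + x.2 * y.1) + γ * (x.2 * y.2)

/-- An identification of `N` with `R × R`, where `R` is a `k`-algebra generated by an element `τ`
acting as `T`, and `lam` is a linear functional on `R` with non-degenerate associated form. -/
structure RingCoords {k N : Type*} [Field k] [AddCommGroup N] [Module k N] (T : N →ₗ[k] N)
    (R : Type*) [CommRing R] [Algebra k R] where
  τ : R
  adjoin_eq : Algebra.adjoin k {τ} = ⊤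
  lam : R →ₗ[k] k
  lam_nondeg : ∀ x, (∀ y, lam (x * y) = 0) → x = 0
  θ : N ≃ₗ[k] R × R
  θ_apply : ∀ x, θ (T x) = τ • θ x

namespace RingCoords

variable {k N R : Type*} [Field k] [AddCommGroup N] [Module k N] {T : N →ₗ[k] N}
  [CommRing R] [Algebra k R] (D : RingCoords T R)

/-- The form `lam ∘ bil α β γ` on `N`. -/
def form (α β γ : R) : LinearMap.BilinForm k N :=
  LinearMap.mk₂ k (fun x y => D.lam (bil α β γ (D.θ x) (D.θ y)))
    (fun x x' y => by rw [← map_add]; congr 1; simp [bil]; ring)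
    (fun a x y => by rw [← map_smul]; congr 1; simp [bil, mul_add])
    (fun x y y' => by rw [← map_add]; congr 1; simp [bil]; ring)
    (fun a x y => by rw [← map_smul]; congr 1; simp [bil, mul_add])

theorem form_apply (α β γ : R) (x y : N) :
    D.form α β γ x y = D.lam (bil α β γ (D.θ x) (D.θ y)) := rfl

theorem θ_symm_apply (x : R × R) : T (D.θ.symm x) = D.θ.symm (D.τ • x) := by
  apply D.θ.injective; rw [D.θ_apply]; simp

/-- A `k`-bilinear map on `R × R` balanced over `τ` is balanced over `R`. -/
theorem adj_smul {s : LinearMap.BilinForm k N} (hs : ∀ x y, s (T x) y = s x (T y)) (r : R)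
    (x y : R × R) : s (D.θ.symm (r • x)) (D.θ.symm y) = s (D.θ.symm x) (D.θ.symm (r • y)) := by
  have hr : r ∈ Algebra.adjoin k {D.τ} := by rw [D.adjoin_eq]; trivial
  induction hr using Algebra.adjoin_induction generalizing x y with
  | mem a ha =>
    obtain rfl : a = D.τ := ha
    rw [← θ_symm_apply, hs, θ_symm_apply]
  | algebraMap a => simp [algebraMap_smul]
  | add a b _ _ ha hb => simp only [add_smul, map_add, LinearMap.add_apply, ha, hb]
  | mul a b _ _ ha hb => rw [mul_smul, ha, hb, smul_smul, mul_comm]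

theorem map_smul_of_comm {A : N →ₗ[k] N} (hA : ∀ x, A (T x) = T (A x)) (r : R) (x : R × R) :
    D.θ (A (D.θ.symm (r • x))) = r • D.θ (A (D.θ.symm x)) := by
  have hr : r ∈ Algebra.adjoin k {D.τ} := by rw [D.adjoin_eq]; trivial
  induction hr using Algebra.adjoin_induction generalizing x with
  | mem a ha =>
    obtain rfl : a = D.τ := ha
    rw [← θ_symm_apply, hA, θ_apply]
  | algebraMap a => simp [algebraMap_smul]
  | add a b _ _ ha hb => simp only [add_smul, map_add, ha, hb]
  | mul a b _ _ ha hb => rw [mul_smul, ha, hb, smul_smul]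

theorem smul_mem_of_invariant {W : Submodule k N} (hW : ∀ x ∈ W, T x ∈ W) (r : R) {x : R × R}
    (hx : D.θ.symm x ∈ W) : D.θ.symm (r • x) ∈ W := by
  have hr : r ∈ Algebra.adjoin k {D.τ} := by rw [D.adjoin_eq]; trivial
  induction hr using Algebra.adjoin_induction generalizing x with
  | mem a ha =>
    obtain rfl : a = D.τ := ha
    rw [← θ_symm_apply]; exact hW _ hx
  | algebraMap a =>
    rw [algebraMap_smul, map_smul]; exact W.smul_mem _ hx
  | add a b _ _ ha hb => rw [add_smul, map_add]; exact W.add_mem (ha hx) (hb hx)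
  | mul a b _ _ ha hb => rw [mul_smul]; exact ha (hb hx)

/-- Frobenius property: r ↦ lam(r · ) embeds R in its dual, and the dimensions agree. -/
theorem exists_lam_eq [FiniteDimensional k R] (f : R →ₗ[k] k) : ∃ r, ∀ x, f x = D.lam (r * x) := by
  let F : R →ₗ[k] Module.Dual k R := (LinearMap.mul k R).compr₂ D.lam
  have hF : Function.Injective F := by
    rw [injective_iff_map_eq_zero]
    exact fun x hx => D.lam_nondeg x fun y => LinearMap.congr_fun hx y
  have hs := (LinearMap.injective_iff_surjective_of_finrank_eq_finrank
    Subspace.dual_finrank_eq.symm).1 hF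
  obtain ⟨r, hr⟩ := hs f
  exact ⟨r, fun x => (LinearMap.congr_fun hr x).symm⟩

theorem lam_ext {x y : R} (h : ∀ z, D.lam (x * z) = D.lam (y * z)) : x = y := by
  rw [← sub_eq_zero]
  exact D.lam_nondeg _ fun z => by rw [sub_mul, map_sub, h, sub_self]

/-- Each Gram entry represents the functional x ↦ s(v, x w) for basis vectors v, w. Balancedness
over R and symmetry recover s from these three functionals. -/
theorem exists_eq_form [FiniteDimensional k R] {s : LinearMap.BilinForm k N}
    (hs : IsAdmissible T s) : ∃ α β γ, s = D.form α β γ := by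
  have hf : ∀ v w : R × R, ∃ r, ∀ x : R, s (D.θ.symm v) (D.θ.symm (x • w)) = D.lam (r * x) :=
    fun v w => D.exists_lam_eq (s (D.θ.symm v) ∘ₗ D.θ.symm.toLinearMap ∘ₗ
      (LinearMap.toSpanSingleton R (R × R) w).restrictScalars k)
  obtain ⟨α, hα⟩ := hf (1, 0) (1, 0)
  obtain ⟨β, hβ⟩ := hf (1, 0) (0, 1)
  obtain ⟨γ, hγ⟩ := hf (0, 1) (0, 1)
  refine ⟨α, β, γ, ?_⟩
  ext x y
  obtain ⟨x, rfl⟩ := D.θ.symm.surjective x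
  obtain ⟨y, rfl⟩ := D.θ.symm.surjective y
  rw [form_apply]
  simp only [LinearEquiv.apply_symm_apply]
  have hdec : ∀ x : R × R, x = x.1 • ((1, 0) : R × R) + x.2 • ((0, 1) : R × R) := fun x => by
    ext <;> simp
  have hβ' : ∀ x, s (D.θ.symm (0, 1)) (D.θ.symm (x • ((1, 0) : R × R))) = D.lam (β * x) := fun x => by
    rw [← D.adj_smul hs.adj, hs.symm]; exact hβ x
  conv_lhs => rw [hdec x, hdec y]
  simp only [map_add, LinearMap.add_apply, D.adj_smul hs.adj, smul_smul, hα, hβ, hβ', hγ]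
  simp only [← map_add]
  congr 1
  simp only [bil]
  ring

theorem form_symm (α β γ : R) (x y : N) : D.form α β γ x y = D.form α β γ y x := by
  rw [form_apply, form_apply]; congr 1; simp only [bil]; ring

theorem form_adj (α β γ : R) (x y : N) : D.form α β γ (T x) y = D.form α β γ x (T y) := by
  rw [form_apply, form_apply, θ_apply, θ_apply]; congr 1; simp only [bil, Prod.smul_fst,
    Prod.smul_snd, smul_eq_mul]; ring

theorem bil_smul_right (α β γ r : R) (x y : R × R) :
    bil α β γ x (r • y) = r * bil α β γ x y := by
  simp only [bil, Prod.smul_fst, Prod.smul_snd, smul_eq_mul]; ring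

/-- Orthogonality against an `R`-submodule can be tested before applying `lam`. -/
theorem bil_eq_zero {α β γ : R} {x y : R × R}
    (h : ∀ r : R, D.form α β γ (D.θ.symm x) (D.θ.symm (r • y)) = 0) : bil α β γ x y = 0 := by
  refine D.lam_nondeg _ fun r => ?_
  have := h r
  rwa [form_apply, LinearEquiv.apply_symm_apply, LinearEquiv.apply_symm_apply, bil_smul_right,
    mul_comm] at this

theorem isAdmissible_form {α β γ : R} (h : IsUnit (α * γ - β ^ 2)) :
    IsAdmissible T (D.form α β γ) := by
  refine ⟨D.form_symm α β γ, D.form_adj α β γ, fun x hx => ?_⟩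
  obtain ⟨x, rfl⟩ := D.θ.symm.surjective x
  have h1 := D.bil_eq_zero (y := (1, 0)) fun r => hx (D.θ.symm (r • (1, 0)))
  have h2 := D.bil_eq_zero (y := (0, 1)) fun r => hx (D.θ.symm (r • (0, 1)))
  simp only [bil, mul_one, mul_zero, add_zero, zero_add] at h1 h2
  rw [LinearEquiv.map_eq_zero_iff]
  ext
  · rw [Prod.fst_zero, ← h.mul_right_eq_zero]
    linear_combination γ * h1 - β * h2
  · rw [Prod.snd_zero, ← h.mul_right_eq_zero]
    linear_combination α * h2 - β * h1

/-- As τ generates R, maps commuting with T are 2 × 2 matrices over R. Non-degeneracy of `lam` turns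
equality of k-forms into equality of R-valued forms, whose diagonal loses the terms 2acβ and 2bdβ.
-/
theorem exists_isometry_form_iff [CharP R 2] {α β γ α' β' γ' : R} :
    (∃ A : N ≃ₗ[k] N, (∀ x, A (T x) = T (A x)) ∧
      ∀ x y, D.form α β γ (A x) (A y) = D.form α' β' γ' x y) ↔ FormCongr α β γ α' β' γ' := by
  have h2 : (2 : R) = 0 := CharTwo.two_eq_zero
  have hdec : ∀ x : R × R, x = x.1 • ((1, 0) : R × R) + x.2 • ((0, 1) : R × R) := fun x => by
    ext <;> simp
  constructor
  · rintro ⟨A, hA, h⟩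
    obtain ⟨⟨a, c⟩, hac⟩ : ∃ v, v = D.θ (A (D.θ.symm (1, 0))) := ⟨_, rfl⟩
    obtain ⟨⟨b, d⟩, hbd⟩ : ∃ v, v = D.θ (A (D.θ.symm (0, 1))) := ⟨_, rfl⟩
    have hAx : ∀ x : R × R, D.θ (A (D.θ.symm x)) = (x.1 * a + x.2 * b, x.1 * c + x.2 * d) := by
      intro x
      conv_lhs => rw [hdec x]
      rw [map_add, map_add, map_add]
      have h3 := D.map_smul_of_comm (A := A.toLinearMap) hA x.1 (1, 0)
      have h4 := D.map_smul_of_comm (A := A.toLinearMap) hA x.2 (0, 1)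
      simp only [LinearEquiv.coe_coe] at h3 h4
      rw [h3, h4, ← hac, ← hbd]
      ext <;> simp
    have hdet : IsUnit (a * d + b * c) := by
      obtain ⟨x, hx⟩ : ∃ x, D.θ (A (D.θ.symm x)) = (1, 0) :=
        ⟨D.θ (A.symm (D.θ.symm (1, 0))), by simp⟩
      obtain ⟨y, hy⟩ : ∃ x, D.θ (A (D.θ.symm x)) = (0, 1) :=
        ⟨D.θ (A.symm (D.θ.symm (0, 1))), by simp⟩
      rw [hAx, Prod.mk.injEq] at hx hy
      obtain ⟨x1, x2⟩ := hx
      obtain ⟨y1, y2⟩ := hy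
      refine IsUnit.of_mul_eq_one (x.1 * y.2 - x.2 * y.1) ?_
      linear_combination (y.1 * c + y.2 * d) * x1 + y2 - (x.1 * c + x.2 * d) * y1 +
        b * c * (x.1 * y.2 - x.2 * y.1) * h2
    have hb : ∀ x y : R × R, bil α β γ (D.θ (A (D.θ.symm x))) (D.θ (A (D.θ.symm y))) =
        bil α' β' γ' x y := by
      intro x y
      refine D.lam_ext fun z => ?_
      have h5 := h (D.θ.symm x) (D.θ.symm (z • y))
      have h6 := D.map_smul_of_comm (A := A.toLinearMap) hA z y
      simp only [LinearEquiv.coe_coe] at h6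
      rw [form_apply, form_apply, h6, bil_smul_right] at h5
      simp only [LinearEquiv.apply_symm_apply, bil_smul_right] at h5
      rw [mul_comm, h5, mul_comm]
    have e1 := hb (1, 0) (1, 0)
    have e2 := hb (1, 0) (0, 1)
    have e3 := hb (0, 1) (0, 1)
    simp only [hAx, bil] at e1 e2 e3
    refine ⟨a, b, c, d, hdet, ?_, ?_, ?_⟩
    · linear_combination -e1 + β * a * c * h2
    · linear_combination -e2
    · linear_combination -e3 + β * b * d * h2
  · rintro ⟨a, b, c, d, ⟨u, hu⟩, rfl, rfl, rfl⟩
    have hv : (↑u⁻¹ : R) * (a * d + b * c) = 1 := by rw [← hu]; simp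
    generalize (↑u⁻¹ : R) = v at hv
    let A₀ : (R × R) →ₗ[k] R × R :=
      { toFun := fun x => (a * x.1 + b * x.2, c * x.1 + d * x.2)
        map_add' := fun x y => by ext <;> simp <;> ring
        map_smul' := fun r x => by ext <;> simp }
    -- The adjugate divided by the determinant, without signs.
    let B₀ : (R × R) →ₗ[k] R × R :=
      { toFun := fun x => (v * (d * x.1 + b * x.2), v * (c * x.1 + a * x.2))
        map_add' := fun x y => by ext <;> simp <;> ring
        map_smul' := fun r x => by ext <;> simp [← smul_add] }
    have h12 : A₀ ∘ₗ B₀ = LinearMap.id := by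
      refine LinearMap.ext fun x => Prod.ext ?_ ?_
      · change a * (v * (d * x.1 + b * x.2)) + b * (v * (c * x.1 + a * x.2)) = x.1
        linear_combination x.1 * hv + a * v * b * x.2 * h2
      · change c * (v * (d * x.1 + b * x.2)) + d * (v * (c * x.1 + a * x.2)) = x.2
        linear_combination x.2 * hv + c * v * d * x.1 * h2
    have h21 : B₀ ∘ₗ A₀ = LinearMap.id := by
      refine LinearMap.ext fun x => Prod.ext ?_ ?_
      · change v * (d * (a * x.1 + b * x.2) + b * (c * x.1 + d * x.2)) = x.1
        linear_combination x.1 * hv + v * b * d * x.2 * h2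
      · change v * (c * (a * x.1 + b * x.2) + a * (c * x.1 + d * x.2)) = x.2
        linear_combination x.2 * hv + v * a * c * x.1 * h2
    let A : (R × R) ≃ₗ[k] R × R := LinearEquiv.ofLinearMap A₀ B₀ h12 h21
    have hA : ∀ x, A x = (a * x.1 + b * x.2, c * x.1 + d * x.2) := fun x => rfl
    refine ⟨D.θ ≪≫ₗ A ≪≫ₗ D.θ.symm, fun x => ?_, fun x y => ?_⟩
    · simp only [LinearEquiv.trans_apply, θ_symm_apply]
      congr 1
      rw [hA, hA, θ_apply]
      ext <;> simp <;> ring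
    · simp only [form_apply, LinearEquiv.trans_apply, LinearEquiv.apply_symm_apply, hA, bil]
      congr 1
      linear_combination (a * c * β * (D.θ x).1 * (D.θ y).1 + b * d * β * (D.θ x).2 * (D.θ y).2) * h2

end RingCoords

end RingCoords

end KleinSymplectic

namespace KleinSymplectic

/-! ### Decomposability over a local ring -/

namespace RingCoords

variable {k N R : Type*} [Field k] [AddCommGroup N] [Module k N] {T : N →ₗ[k] N}
  [CommRing R] [Algebra k R] (D : RingCoords T R)

theorem bil_comm (α β γ : R) (x y : R × R) : bil α β γ x y = bil α β γ y x := by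
  simp only [bil]; ring

/-- `bil α β γ v` as an `R`-linear map. -/
def bilLeft (α β γ : R) (v : R × R) : (R × R) →ₗ[R] R where
  toFun := bil α β γ v
  map_add' x y := by simp only [bil, Prod.fst_add, Prod.snd_add]; ring
  map_smul' r x := by simp [bil_smul_right]

/-- The preimage in `N` of an `R`-submodule of `R × R`. -/
def pull (P : Submodule R (R × R)) : Submodule k N := (P.restrictScalars k).comap D.θ.toLinearMap

theorem mem_pull {P : Submodule R (R × R)} {x : N} : x ∈ D.pull P ↔ D.θ x ∈ P := Iff.rfl

/-- A vector v of unit length splits off: R² is the sum of R v and its orthogonal complement. -/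
theorem decomposes_of_isUnit_bil {α β γ : R} {v : R × R} [Nontrivial R]
    (hv : IsUnit (bil α β γ v v)) : Decomposes T (D.form α β γ) := by
  have hinv : ∀ P : Submodule R (R × R), ∀ x ∈ D.pull P, T x ∈ D.pull P := fun P x hx => by
    rw [mem_pull, θ_apply]; exact P.smul_mem _ hx
  obtain ⟨u, hu⟩ := hv
  have hmem : ∀ x, x ∈ D.pull (LinearMap.ker (bilLeft α β γ v)) ↔ bil α β γ v (D.θ x) = 0 :=
    fun x => Iff.rfl
  refine ⟨D.pull (R ∙ v), D.pull (LinearMap.ker (bilLeft α β γ v)), hinv _, hinv _, ?_, ?_, ?_, ?_⟩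
  · intro h
    have h1 : D.θ.symm v ∈ D.pull (R ∙ v) := by
      rw [mem_pull, LinearEquiv.apply_symm_apply]; exact Submodule.mem_span_singleton_self v
    rw [h, Submodule.mem_bot, LinearEquiv.map_eq_zero_iff] at h1
    refine u.ne_zero ?_
    rw [hu, h1]; simp [bil]
  · intro h
    -- This vector is always orthogonal to v; if it were zero, the length of v would be zero too.
    have h1 : D.θ.symm (-(β * v.1 + γ * v.2), α * v.1 + β * v.2) ∈
        D.pull (LinearMap.ker (bilLeft α β γ v)) := by
      rw [hmem, LinearEquiv.apply_symm_apply]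
      simp only [bil]; ring
    rw [h, Submodule.mem_bot, LinearEquiv.map_eq_zero_iff, Prod.mk_eq_zero] at h1
    refine u.ne_zero ?_
    rw [hu]
    simp only [bil]
    linear_combination v.1 * h1.2 - v.2 * h1.1
  · constructor
    · rw [Submodule.disjoint_def]
      intro x hx hx'
      rw [mem_pull, Submodule.mem_span_singleton] at hx
      obtain ⟨r, hr⟩ := hx
      rw [hmem, ← hr, bil_smul_right, ← hu, Units.mul_left_eq_zero] at hx'
      rw [hx', zero_smul] at hr
      exact D.θ.map_eq_zero_iff.1 hr.symm
    · rw [codisjoint_iff, eq_top_iff]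
      rintro x -
      let r := (↑u⁻¹ : R) * bil α β γ v (D.θ x)
      refine Submodule.mem_sup.2 ⟨D.θ.symm (r • v), ?_, x - D.θ.symm (r • v), ?_, by abel⟩
      · rw [mem_pull, LinearEquiv.apply_symm_apply]
        exact Submodule.smul_mem _ _ (Submodule.mem_span_singleton_self v)
      · rw [hmem, map_sub, LinearEquiv.apply_symm_apply]
        have h1 := map_sub (bilLeft α β γ v) (D.θ x) (r • v)
        have h2 : bilLeft α β γ v (r • v) = r * bil α β γ v v := bil_smul_right _ _ _ _ _ _
        rw [h2, ← hu, mul_right_comm, Units.inv_mul, one_mul] at h1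
        exact h1.trans (sub_self _)
  · intro x hx y hy
    rw [mem_pull, Submodule.mem_span_singleton] at hx
    obtain ⟨r, hr⟩ := hx
    rw [form_apply, ← hr, bil_comm, bil_smul_right, bil_comm, (hmem y).1 hy, mul_zero, map_zero]

/-- Two vectors with invertible determinant in an invariant subspace generate everything. -/
theorem eq_top_of_isUnit_det {W : Submodule k N} (hW : ∀ x ∈ W, T x ∈ W) {x y : R × R}
    (hx : D.θ.symm x ∈ W) (hy : D.θ.symm y ∈ W) (h : IsUnit (x.1 * y.2 - x.2 * y.1)) : W = ⊤ := by
  rw [eq_top_iff]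
  rintro z -
  obtain ⟨z, rfl⟩ := D.θ.symm.surjective z
  obtain ⟨u, hu⟩ := h
  have hv : (↑u⁻¹ : R) * (x.1 * y.2 - x.2 * y.1) = 1 := by rw [← hu]; simp
  generalize (↑u⁻¹ : R) = v at hv
  have : z = (v * (z.1 * y.2 - z.2 * y.1)) • x + (v * (x.1 * z.2 - x.2 * z.1)) • y := by
    ext
    · simp only [Prod.fst_add, Prod.smul_fst, smul_eq_mul]
      linear_combination (-z.1) * hv
    · simp only [Prod.snd_add, Prod.smul_snd, smul_eq_mul]
      linear_combination (-z.2) * hv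
  rw [this, map_add]
  exact W.add_mem (D.smul_mem_of_invariant hW _ hx) (D.smul_mem_of_invariant hW _ hy)

/-- By locality, a splitting supplies vectors with unit determinant: both in one summand would make
it everything, so they come from different summands. The form is then diagonal in this basis with
unit discriminant. Since bil(a, a) = α a₁² + γ a₂² in characteristic two, α or γ must be a unit. -/
theorem decomposes_form_iff [CharP R 2] [IsLocalRing R] {α β γ : R}
    (h : IsUnit (α * γ - β ^ 2)) : Decomposes T (D.form α β γ) ↔ IsUnit α ∨ IsUnit γ := by
  have h2 : (2 : R) = 0 := CharTwo.two_eq_zero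
  constructor
  · rintro ⟨W₁, W₂, h₁, h₂, hb₁, hb₂, hc, ho⟩
    by_contra! hcon
    have hd : ∀ y : R × R, ∃ a b : R × R, D.θ.symm a ∈ W₁ ∧ D.θ.symm b ∈ W₂ ∧ a + b = y := by
      intro y
      obtain ⟨a, ha, b, hb, hab⟩ := Submodule.mem_sup.1
        (hc.sup_eq_top ▸ Submodule.mem_top : D.θ.symm y ∈ W₁ ⊔ W₂)
      refine ⟨D.θ a, D.θ b, by simpa, by simpa, ?_⟩
      rw [← map_add, hab, LinearEquiv.apply_symm_apply]
    have hmix : ∀ a b : R × R, D.θ.symm a ∈ W₁ → D.θ.symm b ∈ W₂ →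
        ¬ IsUnit (a.1 * b.2 - a.2 * b.1) := by
      intro a b ha hb hu
      have h3 : bil α β γ a b = 0 :=
        D.bil_eq_zero fun r => ho _ ha _ (D.smul_mem_of_invariant h₂ r hb)
      have h4 : (α * γ - β ^ 2) * (a.1 * b.2 - a.2 * b.1) ^ 2 =
          α * (a.1 ^ 2 * bil α β γ b b) + γ * (a.2 ^ 2 * bil α β γ b b) := by
        -- The Gram determinant of a and b is the discriminant times the squared determinant of
        -- their coordinates.
        have h5 : (α * γ - β ^ 2) * (a.1 * b.2 - a.2 * b.1) ^ 2 =
          bil α β γ a a * bil α β γ b b - bil α β γ a b ^ 2 := by simp only [bil]; ring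
        rw [h5, h3]
        simp only [bil]
        linear_combination (β * a.1 * a.2) * (α * (b.1 * b.1) + β * (b.1 * b.2 + b.2 * b.1) +
          γ * (b.2 * b.2)) * h2
      have h6 := h.mul (hu.pow 2)
      rw [h4] at h6
      rcases IsLocalRing.isUnit_or_isUnit_of_isUnit_add h6 with h7 | h7
      · exact hcon.1 (isUnit_of_mul_isUnit_left h7)
      · exact hcon.2 (isUnit_of_mul_isUnit_left h7)
    obtain ⟨a, b, ha, hb, hab⟩ := hd (1, 0)
    obtain ⟨a', b', ha', hb', hab'⟩ := hd (0, 1)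
    -- Splitting both basis vectors expands the determinant 1 into four determinants, one of which
    -- is a unit.
    have e : IsUnit ((a.1 * a'.2 - a.2 * a'.1) + (a.1 * b'.2 - a.2 * b'.1) +
        ((b.1 * a'.2 - b.2 * a'.1) + (b.1 * b'.2 - b.2 * b'.1))) := by
      rw [Prod.ext_iff] at hab hab'
      simp only [Prod.fst_add, Prod.snd_add] at hab hab'
      convert isUnit_one (M := R) using 1
      linear_combination (a'.2 + b'.2) * hab.1 + hab'.2 - (a'.1 + b'.1) * hab.2
    rcases IsLocalRing.isUnit_or_isUnit_of_isUnit_add e with e | e <;>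
      rcases IsLocalRing.isUnit_or_isUnit_of_isUnit_add e with e | e
    · have := D.eq_top_of_isUnit_det h₁ ha ha' e
      subst this
      exact hb₂ (eq_bot_of_top_isCompl hc)
    · exact hmix a b' ha hb' e
    · refine hmix a' b ha' hb ?_
      convert e.neg using 1; ring
    · have := D.eq_top_of_isUnit_det h₂ hb hb' e
      subst this
      exact hb₁ (eq_bot_of_isCompl_top hc)
  · rintro (h | h)
    · exact D.decomposes_of_isUnit_bil (v := (1, 0)) (by simpa [bil] using h)
    · exact D.decomposes_of_isUnit_bil (v := (0, 1)) (by simpa [bil] using h)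

/-- The off-diagonal entry of a non-degenerate form with non-unit diagonal is a unit. -/
theorem isUnit_of_isAdmissible_form [IsLocalRing R] {z : R} (hz : z ≠ 0)
    (hz' : ∀ r, ¬ IsUnit r → r * z = 0) {α β γ : R} (h : IsAdmissible T (D.form α β γ))
    (hα : ¬ IsUnit α) : IsUnit β := by
  by_contra hβ
  have := h.nondeg (D.θ.symm (z, 0)) fun y => by
    rw [form_apply, LinearEquiv.apply_symm_apply]
    have : bil α β γ (z, 0) (D.θ y) = 0 := by
      simp only [bil]
      linear_combination (D.θ y).1 * hz' α hα + (D.θ y).2 * hz' β hβ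
    rw [this, map_zero]
  rw [LinearEquiv.map_eq_zero_iff, Prod.mk_eq_zero] at this
  exact hz this.1

end RingCoords

end KleinSymplectic

namespace KleinSymplectic

open PowerSeries (X coeff)
open scoped Polynomial

/-! ### The ring K[[X]]/(X ^ n) and its identification with k[T]/(f ^ n) -/

section TruncSeries

/-- The ring `K[X] / (X ^ n)`. -/
abbrev TruncSeries (K : Type*) [Field K] (n : ℕ) : Type _ :=
  PowerSeries K ⧸ Ideal.span {(X : PowerSeries K) ^ n}

namespace TruncSeries

variable {K : Type*} [Field K] {n : ℕ}

/-- The projection onto `K[X] / (X ^ n)`. -/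
abbrev proj (K : Type*) [Field K] (n : ℕ) : PowerSeries K →+* TruncSeries K n :=
  Ideal.Quotient.mk _

theorem proj_eq_zero_iff {p : PowerSeries K} : proj K n p = 0 ↔ (X : PowerSeries K) ^ n ∣ p := by
  rw [Ideal.Quotient.eq_zero_iff_mem, Ideal.mem_span_singleton]

theorem proj_surjective : Function.Surjective (proj K n) := Ideal.Quotient.mk_surjective

theorem nontrivial (hn : 1 ≤ n) : Nontrivial (TruncSeries K n) := by
  refine Ideal.Quotient.nontrivial_iff.2 fun h => ?_
  rw [Ideal.span_singleton_eq_top] at h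
  exact PowerSeries.X_prime.not_isUnit (isUnit_of_dvd_unit (dvd_pow_self _ (by omega)) h)

theorem isLocalRing (hn : 1 ≤ n) : IsLocalRing (TruncSeries K n) :=
  have := nontrivial (K := K) hn
  .of_surjective' (proj K n) proj_surjective

theorem isUnit_proj_iff (hn : 1 ≤ n) {p : PowerSeries K} : IsUnit (proj K n p) ↔ ¬ X ∣ p := by
  rw [PowerSeries.X_dvd_iff]
  constructor
  · intro h h0
    obtain ⟨r, hr⟩ := h.exists_right_inv
    obtain ⟨r, rfl⟩ := proj_surjective r
    rw [← map_mul, ← map_one (proj K n), ← sub_eq_zero, ← map_sub, proj_eq_zero_iff] at hr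
    have := (dvd_pow_self X (by omega)).trans hr
    rw [PowerSeries.X_dvd_iff] at this
    simp [h0] at this
  · intro h
    exact ((PowerSeries.isUnit_iff_constantCoeff).2 (isUnit_iff_ne_zero.2 h)).map _

theorem charP [CharP K 2] (hn : 1 ≤ n) : CharP (TruncSeries K n) 2 := by
  have := nontrivial (K := K) hn
  refine CharTwo.of_one_ne_zero_of_two_eq_zero one_ne_zero ?_
  rw [← map_ofNat (proj K n) 2, charTwo_series, map_zero]

/-- The socle of `K[X] / (X ^ n)`. -/
theorem mul_socle (hn : 1 ≤ n) {r : TruncSeries K n} (hr : ¬ IsUnit r) :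
    r * proj K n (X ^ (n - 1)) = 0 := by
  obtain ⟨p, rfl⟩ := proj_surjective r
  rw [isUnit_proj_iff hn, not_not] at hr
  obtain ⟨p, rfl⟩ := hr
  rw [← map_mul, proj_eq_zero_iff]
  refine ⟨p, ?_⟩
  obtain ⟨m, rfl⟩ : ∃ m, n = m + 1 := ⟨n - 1, by omega⟩
  rw [Nat.add_sub_cancel, pow_succ]; ring

theorem socle_ne_zero (hn : 1 ≤ n) : proj K n (X ^ (n - 1)) ≠ 0 := by
  rw [ne_eq, proj_eq_zero_iff, pow_dvd_pow_iff PowerSeries.X_ne_zero PowerSeries.X_prime.not_isUnit]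
  omega

variable (k : Type*) [Field k] [Algebra k K]

/-- The first `n` coefficients. -/
def coeffs : TruncSeries K n →ₗ[k] Fin n → K :=
  (((Ideal.span {(X : PowerSeries K) ^ n}).restrictScalars k).liftQ
    (LinearMap.pi fun i : Fin n => (coeff (R := K) i).restrictScalars k) (by
      intro p hp
      have hp' : (X : PowerSeries K) ^ n ∣ p := Ideal.mem_span_singleton.1 hp
      rw [PowerSeries.X_pow_dvd_iff] at hp'
      ext i
      exact hp' i i.2)) ∘ₗ
    (Submodule.Quotient.restrictScalarsEquiv k
      (Ideal.span {(X : PowerSeries K) ^ n})).symm.toLinearMap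

theorem coeffs_injective : Function.Injective (coeffs (K := K) (n := n) k) := by
  rw [injective_iff_map_eq_zero]
  intro r hr
  obtain ⟨p, rfl⟩ := proj_surjective r
  rw [proj_eq_zero_iff, PowerSeries.X_pow_dvd_iff]
  exact fun m hm => congrFun hr ⟨m, hm⟩

/-- The functional `p ↦ Tr (coeff (n - 1) p)`. -/
def lam (hn : 1 ≤ n) : TruncSeries K n →ₗ[k] k :=
  Algebra.trace k K ∘ₗ LinearMap.proj (⟨n - 1, by omega⟩ : Fin n) ∘ₗ coeffs k

theorem lam_proj (hn : 1 ≤ n) (p : PowerSeries K) :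
    lam k hn (proj K n p) = Algebra.trace k K (coeff (n - 1) p) := rfl

theorem trace_nondeg [FiniteDimensional k K] [Algebra.IsSeparable k K] {x : K}
    (h : ∀ y, Algebra.trace k K (x * y) = 0) : x = 0 :=
  (traceForm_nondegenerate k K).1 x h

/-- Multiplying by y * X ^ (n - 1 - i) moves the i-th coefficient to the top, and the trace form of
the separable extension detects it. -/
theorem lam_nondeg [FiniteDimensional k K] [Algebra.IsSeparable k K] (hn : 1 ≤ n)
    (r : TruncSeries K n) (h : ∀ y, lam k hn (r * y) = 0) : r = 0 := by
  obtain ⟨p, rfl⟩ := proj_surjective r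
  rw [proj_eq_zero_iff, PowerSeries.X_pow_dvd_iff]
  intro i hi
  refine trace_nondeg k fun y => ?_
  have := h (proj K n (PowerSeries.C y * X ^ (n - 1 - i)))
  rw [← map_mul, lam_proj, mul_left_comm, PowerSeries.coeff_C_mul,
    PowerSeries.coeff_mul_X_pow', if_pos (by omega), show n - 1 - (n - 1 - i) = i by omega,
    mul_comm] at this
  exact this

end TruncSeries

section Generator

variable {k K : Type*} [Field k] [Field K] [Algebra k K] {f : k[X]} {ε : K}

/-- The element `ε + X` of `K[[X]]`. -/
def gen (ε : K) : PowerSeries K := PowerSeries.C ε + X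

theorem constantCoeff_aeval_gen (p : k[X]) :
    PowerSeries.constantCoeff (Polynomial.aeval (gen ε) p) = Polynomial.aeval ε p := by
  induction p using Polynomial.induction_on' with
  | add p q hp hq => simp [hp, hq]
  | monomial i a =>
    simp [Polynomial.aeval_monomial, gen, PowerSeries.algebraMap_apply]

/-- Taylor expansion at ε: f(ε + X) = f'(ε) X + c X², with f'(ε) ≠ 0 since f is separable over a
perfect field. -/
theorem exists_aeval_gen_eq [PerfectField k] (hirr : Irreducible f)
    (hε : Polynomial.aeval ε f = 0) :
    ∃ u, IsUnit u ∧ Polynomial.aeval (gen ε) f = X * u := by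
  have hsep := PerfectField.separable_of_irreducible hirr
  have hd := hsep.aeval_derivative_ne_zero hε
  set F := f.map (algebraMap k (PowerSeries K)) with hF
  obtain ⟨c, hc⟩ := F.binomExpansion (PowerSeries.C ε) X
  have h1 : ∀ p : k[X], (p.map (algebraMap k (PowerSeries K))).eval (PowerSeries.C ε) =
      PowerSeries.C (Polynomial.aeval ε p) := by
    intro p
    rw [Polynomial.eval_map_algebraMap]
    induction p using Polynomial.induction_on' with
    | add p q hp hq => simp [hp, hq]
    | monomial i a => simp [Polynomial.aeval_monomial, PowerSeries.algebraMap_apply]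
  refine ⟨PowerSeries.C (Polynomial.aeval ε f.derivative) + X * c, ?_, ?_⟩
  · rw [PowerSeries.isUnit_iff_constantCoeff]
    simpa using hd
  · rw [hF, Polynomial.eval_map_algebraMap, ← hF, hF, h1, hε, map_zero, zero_add,
      Polynomial.derivative_map, h1] at hc
    rw [gen, hc]; ring

/-- A zero constant term means that ε is a root, so f divides p; cancelling f(ε + X), which is X
times a unit, lowers the exponent by one. -/
theorem pow_dvd_of_X_pow_dvd [PerfectField k] (hf : f.Monic) (hirr : Irreducible f)
    (hε : Polynomial.aeval ε f = 0) (n : ℕ) (p : k[X])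
    (h : (X : PowerSeries K) ^ n ∣ Polynomial.aeval (gen ε) p) : f ^ n ∣ p := by
  obtain ⟨u, hu, hfu⟩ := exists_aeval_gen_eq hirr hε
  induction n generalizing p with
  | zero => simp
  | succ n ih =>
    have h1 := (dvd_pow_self X n.succ_ne_zero).trans h
    rw [PowerSeries.X_dvd_iff, constantCoeff_aeval_gen] at h1
    have h2 : f ∣ p := by
      rw [minpoly.eq_of_irreducible_of_monic hirr hε hf]
      exact minpoly.dvd k ε h1
    obtain ⟨p, rfl⟩ := h2
    rw [pow_succ']
    refine mul_dvd_mul_left _ (ih p ?_)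
    rw [map_mul, hfu, pow_succ', mul_assoc, mul_dvd_mul_iff_left PowerSeries.X_ne_zero,
      hu.dvd_mul_left] at h
    exact h

end Generator

section PowerMap

variable {k K : Type*} [Field k] [Field K] [Algebra k K] {f : k[X]} {ε : K}

/-- The image of `ε + X` in `K[X] / (X ^ n)`. -/
def tau (n : ℕ) (ε : K) : TruncSeries K n := TruncSeries.proj K n (gen ε)

theorem aeval_tau (n : ℕ) (p : k[X]) :
    Polynomial.aeval (tau n ε) p = TruncSeries.proj K n (Polynomial.aeval (gen ε) p) :=
  Polynomial.aeval_algHom_apply (Ideal.Quotient.mkₐ k (Ideal.span {(X : PowerSeries K) ^ n})) _ p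

theorem finrank_eq_natDegree (hf : f.Monic) (hirr : Irreducible f)
    (hε : Polynomial.aeval ε f = 0) (hK : Algebra.adjoin k {ε} = ⊤) :
    FiniteDimensional k K ∧ Module.finrank k K = f.natDegree := by
  have hint : IsIntegral k ε := ⟨f, hf, hε⟩
  let b := PowerBasis.ofAdjoinEqTop hint hK
  refine ⟨b.finite, ?_⟩
  rw [b.finrank, minpoly.eq_of_irreducible_of_monic hirr hε hf]
  rfl

/-- The map `x ↦ ∑ x_s τ ^ s`. -/
def powerMap (k : Type*) [Field k] [Algebra k K] (n d : ℕ) (ε : K) :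
    (Fin d → k) →ₗ[k] TruncSeries K n :=
  Fintype.linearCombination k fun s : Fin d => tau n ε ^ (s : ℕ)

theorem powerMap_single (n d : ℕ) (s : Fin d) :
    powerMap k n d ε (Pi.single s 1) = tau n ε ^ (s : ℕ) := by
  rw [powerMap, Fintype.linearCombination_apply_single, one_smul]

/-- A kernel vector is a polynomial of degree below that of f ^ n that is divisible by f ^ n, hence
zero. Both sides have dimension mn over k. -/
theorem powerMap_bijective [PerfectField k] (hf : f.Monic) (hirr : Irreducible f)
    (hε : Polynomial.aeval ε f = 0) (hK : Algebra.adjoin k {ε} = ⊤) (n : ℕ) :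
    Function.Bijective (powerMap k n (f ^ n).natDegree ε) := by
  have hinj : Function.Injective (powerMap k n (f ^ n).natDegree ε) := by
    rw [injective_iff_map_eq_zero]
    intro x hx
    let p : k[X] := ∑ s : Fin (f ^ n).natDegree, Polynomial.C (x s) * Polynomial.X ^ (s : ℕ)
    have hp : Polynomial.aeval (tau n ε) p = 0 := by
      rw [← hx, powerMap, Fintype.linearCombination_apply]
      simp only [p, map_sum, map_mul, Polynomial.aeval_C, map_pow, Polynomial.aeval_X]
      exact Finset.sum_congr rfl fun i _ => (Algebra.smul_def _ _).symm
    rw [aeval_tau, TruncSeries.proj_eq_zero_iff] at hp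
    have h0 : p = 0 := by
      refine Polynomial.eq_zero_of_dvd_of_degree_lt (pow_dvd_of_X_pow_dvd hf hirr hε n p hp) ?_
      rw [Polynomial.degree_eq_natDegree (hf.pow n).ne_zero]
      exact Polynomial.degree_sum_fin_lt x
    funext s
    have := Polynomial.coeff_zero (R := k) s
    rw [← h0, Polynomial.finsetSum_coeff] at this
    simpa [Polynomial.coeff_X_pow, Fin.val_inj] using this
  refine ⟨hinj, ?_⟩
  obtain ⟨hfin, hrank⟩ := finrank_eq_natDegree hf hirr hε hK
  have h1 : Function.Injective (TruncSeries.coeffs k ∘ₗ powerMap k n (f ^ n).natDegree ε) :=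
    (TruncSeries.coeffs_injective k).comp hinj
  have h2 := (LinearMap.injective_iff_surjective_of_finrank_eq_finrank (by
    rw [Module.finrank_fin_fun, Module.finrank_pi_fintype]
    simp [hrank, hf.natDegree_pow])).1 h1
  intro r
  obtain ⟨x, hx⟩ := h2 (TruncSeries.coeffs k r)
  exact ⟨x, TruncSeries.coeffs_injective k hx⟩

/-- On τ ^ j with j below the top exponent both sides shift the exponent; in the last column the
relation f ^ n (τ) = 0 expresses the top power. -/
theorem powerMap_companion [PerfectField k] (hf : f.Monic) (hirr : Irreducible f)
    (hε : Polynomial.aeval ε f = 0) (n : ℕ) (x : Fin (f ^ n).natDegree → k) :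
    powerMap k n _ ε (Matrix.toLin' (companion (f ^ n)) x) =
      tau n ε * powerMap k n (f ^ n).natDegree ε x := by
  have h : powerMap k n (f ^ n).natDegree ε ∘ₗ Matrix.toLin' (companion (f ^ n)) =
      LinearMap.mulLeft k (tau n ε) ∘ₗ powerMap k n (f ^ n).natDegree ε := by
    refine LinearMap.pi_ext' fun j => LinearMap.ext_ring ?_
    simp only [LinearMap.comp_apply, LinearMap.mulLeft_apply, LinearMap.single_apply,
      powerMap_single]
    rw [Matrix.toLin'_apply, Matrix.mulVec_single_one, powerMap, Fintype.linearCombination_apply,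
      ← pow_succ']
    simp only [Matrix.col_apply, companion, Matrix.of_apply]
    by_cases hj : (j : ℕ) + 1 = (f ^ n).natDegree
    · simp only [if_pos hj]
      have h0 : Polynomial.aeval (tau n ε) (f ^ n) = 0 := by
        obtain ⟨u, -, hu⟩ := exists_aeval_gen_eq hirr hε
        rw [aeval_tau, TruncSeries.proj_eq_zero_iff, map_pow, hu]
        exact pow_dvd_pow_of_dvd (dvd_mul_right _ _) n
      rw [Polynomial.aeval_eq_sum_range, Finset.sum_range_succ, (hf.pow n).coeff_natDegree,
        one_smul, Finset.sum_range, add_comm] at h0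
      rw [hj, eq_neg_of_add_eq_zero_left h0, ← Finset.sum_neg_distrib]
      exact Finset.sum_congr rfl fun i _ => neg_smul _ _
    · simp only [if_neg hj]
      have hj' : (j : ℕ) + 1 < (f ^ n).natDegree := by have := j.2; omega
      rw [Finset.sum_eq_single ⟨(j : ℕ) + 1, hj'⟩]
      · simp
      · intro i _ hi
        rw [if_neg fun h => hi (Fin.ext h), zero_smul]
      · simp
  exact LinearMap.congr_fun h x

theorem adjoin_tau [PerfectField k] (hf : f.Monic) (hirr : Irreducible f)
    (hε : Polynomial.aeval ε f = 0) (hK : Algebra.adjoin k {ε} = ⊤) (n : ℕ) :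
    Algebra.adjoin k {tau n ε} = ⊤ := by
  rw [eq_top_iff]
  rintro r -
  obtain ⟨x, rfl⟩ := (powerMap_bijective hf hirr hε hK n).2 r
  rw [powerMap, Fintype.linearCombination_apply]
  exact Subalgebra.sum_mem _ fun s _ => Subalgebra.smul_mem _
    (Subalgebra.pow_mem _ (Algebra.self_mem_adjoin_singleton _ _) _) _

end PowerMap

end TruncSeries

end KleinSymplectic

namespace KleinSymplectic

open PowerSeries (X coeff)
open Matrix
open scoped Polynomial

/-! ### Hankel matrices, Jordan blocks and the operator 𝒱 in terms of series -/

section Hankel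

variable {K : Type*} [Field K] {n : ℕ}

/-- The Hankel matrix of a power series. -/
def hankel (n : ℕ) (c : PowerSeries K) : Matrix (Fin n) (Fin n) K :=
  Matrix.of fun a b => if n ≤ (a : ℕ) + b + 1 then coeff ((a : ℕ) + b + 1 - n) c else 0

/-- The antidiagonal H_{n+1} corresponds to the constant term, and each later antidiagonal to one
more factor X. -/
theorem H_eq_hankel (i : ℕ) (x : K) : H n (n + 1 + i) x = hankel n (PowerSeries.C x * X ^ i) := by
  ext a b
  simp only [H, hankel, Matrix.of_apply, PowerSeries.coeff_C_mul, PowerSeries.coeff_X_pow]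
  split_ifs <;> first | omega | simp

theorem hankel_add (c c' : PowerSeries K) : hankel n (c + c') = hankel n c + hankel n c' := by
  ext a b
  simp only [hankel, Matrix.of_apply, Matrix.add_apply, map_add]
  split_ifs <;> simp

theorem hankel_sum {ι : Type*} (s : Finset ι) (c : ι → PowerSeries K) :
    hankel n (∑ i ∈ s, c i) = ∑ i ∈ s, hankel n (c i) := by
  classical
  induction s using Finset.induction_on with
  | empty => ext a b; simp [hankel]
  | insert i s hi ih => rw [Finset.sum_insert hi, Finset.sum_insert hi, hankel_add, ih]

theorem Label.φ_eq (l : Label n K) : l.φ = hankel n l.phiSeries := by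
  have hr := l.two_le_r
  rw [Label.φ, Label.phiSeries, hankel_add, hankel_sum]
  congr 1
  · rw [show n + l.r = n + 1 + (l.r - 1) by omega, H_eq_hankel, map_one, one_mul]
  · refine Finset.sum_congr rfl fun j _ => ?_
    rw [show n + l.r + (2 * (j : ℕ) + 1) = n + 1 + (l.r + 2 * j) by omega, H_eq_hankel]

theorem Label.ψ_eq (l : Label n K) : l.ψ = hankel n l.psiSeries := by
  rw [Label.ψ, Label.psiSeries, finSeries, hankel_add, hankel_sum]
  congr 1
  · rw [← add_zero (n + 1), H_eq_hankel, map_one, one_mul, pow_zero]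
  · refine Finset.sum_congr rfl fun j _ => ?_
    rw [show n + ((j : ℕ) + 1) = n + 1 + j by omega, H_eq_hankel]

theorem Label.μ_eq (l : Label n K) : l.μ = hankel n l.muSeries := by
  rw [Label.μ, Label.muSeries, show n + l.r + 2 * l.s + 1 = n + 1 + (l.r + 2 * l.s) by omega,
    H_eq_hankel, map_one, one_mul]

theorem jordan_mulVec (ε : K) (v : Fin n → K) (a : Fin n) :
    (jordan n ε *ᵥ v) a = ε * v a + if h : (a : ℕ) + 1 < n then v ⟨a + 1, h⟩ else 0 := by
  have h1 : jordan n ε = ε • (1 : Matrix (Fin n) (Fin n) K) +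
      Matrix.of fun s t : Fin n => if (t : ℕ) = s + 1 then 1 else 0 := by
    ext s t
    simp only [jordan, Matrix.of_apply, Matrix.add_apply, Matrix.smul_apply, Matrix.one_apply,
      smul_eq_mul]
    by_cases hst : s = t
    · subst hst; simp
    · simp [hst]
  rw [h1, Matrix.add_mulVec, Matrix.smul_mulVec, Matrix.one_mulVec, Pi.add_apply, Pi.smul_apply,
    smul_eq_mul]
  congr 1
  simp only [Matrix.mulVec, dotProduct, Matrix.of_apply, ite_mul, one_mul, zero_mul]
  split_ifs with h
  · rw [Finset.sum_eq_single ⟨a + 1, h⟩]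
    · simp
    · intro b _ hb
      rw [if_neg fun h => hb (Fin.ext h)]
    · simp
  · refine Finset.sum_eq_zero fun b _ => ?_
    rw [if_neg (by have := b.2; omega)]

/-- Multiplication by ε + X on truncated series, with coefficients listed in reverse order, is the
Jordan block, and the last unit vector is the series 1. -/
theorem V'_apply (d : ℕ) (ε : K) (a : Fin n) (s : Fin d) :
    V' n d ε a s = coeff (n - 1 - a) (gen ε ^ (s : ℕ)) := by
  have key : ∀ (s : ℕ) (a : Fin n),
      (jordan n ε ^ s *ᵥ lastVec K n) a = coeff (n - 1 - a) (gen ε ^ s) := by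
    intro s
    induction s with
    | zero =>
      intro a
      have := a.2
      rw [pow_zero, Matrix.one_mulVec, pow_zero, PowerSeries.coeff_one, lastVec]
      congr 1
      simp only [eq_iff_iff]; omega
    | succ s ih =>
      intro a
      rw [pow_succ', ← Matrix.mulVec_mulVec, jordan_mulVec, ih, pow_succ', gen, add_mul, map_add,
        PowerSeries.coeff_C_mul]
      congr 1
      split_ifs with h
      · rw [ih, show n - 1 - (a : ℕ) = (n - 1 - (a + 1)) + 1 by omega, PowerSeries.coeff_succ_X_mul]
        rfl
      · have := a.2
        rw [show n - 1 - (a : ℕ) = 0 by omega, PowerSeries.coeff_zero_X_mul]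
  exact key s a

theorem coeff_mul_eq_sum {m : ℕ} (hm : m < n) (p q : PowerSeries K) :
    coeff m (p * q) = ∑ i : Fin n, if (i : ℕ) ≤ m then coeff i p * coeff (m - i) q else 0 := by
  rw [PowerSeries.coeff_mul, Finset.Nat.sum_antidiagonal_eq_sum_range_succ_mk,
    Fin.sum_univ_eq_sum_range (fun i => if i ≤ m then coeff i p * coeff (m - i) q else 0) n,
    ← Finset.sum_filter]
  refine Finset.sum_congr ?_ fun _ _ => rfl
  ext i
  simp only [Finset.mem_range, Finset.mem_filter]
  omega

/-- The top coefficient of c · p · q is bilinear in the coefficients of p and q, with a Hankel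
matrix once both lists of coefficients are reversed. -/
theorem hankel_congr_apply (hn : 1 ≤ n) (d : ℕ) (ε : K) (c : PowerSeries K) (s t : Fin d) :
    ((V' n d ε)ᵀ * hankel n c * V' n d ε) s t =
      coeff (n - 1) (c * (gen ε ^ (s : ℕ) * gen ε ^ (t : ℕ))) := by
  rw [Matrix.mul_assoc, Matrix.mul_apply, ← Equiv.sum_comp Fin.revPerm,
    show c * (gen ε ^ (s : ℕ) * gen ε ^ (t : ℕ)) = gen ε ^ (s : ℕ) * (gen ε ^ (t : ℕ) * c) by ring,
    coeff_mul_eq_sum (n := n) (by omega)]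
  refine Finset.sum_congr rfl fun i _ => ?_
  have hi := i.2
  rw [if_pos (by omega), Matrix.transpose_apply, V'_apply, Fin.revPerm_apply, Fin.val_rev,
    show n - 1 - (n - (i + 1)) = (i : ℕ) by omega]
  congr 1
  rw [Matrix.mul_apply, ← Equiv.sum_comp Fin.revPerm, coeff_mul_eq_sum (n := n) (by omega)]
  refine Finset.sum_congr rfl fun j _ => ?_
  have hj := j.2
  rw [V'_apply, Fin.revPerm_apply, hankel, Matrix.of_apply, Fin.val_rev, Fin.val_rev,
    show n - 1 - (n - (j + 1)) = (j : ℕ) by omega]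
  by_cases h : (j : ℕ) ≤ n - 1 - i
  · rw [if_pos (by omega), if_pos h, mul_comm]
    congr 3; omega
  · rw [if_neg (by omega), if_neg h, zero_mul]

/-- Thus 𝒱 of a Hankel matrix is the Gram matrix of (x, y) ↦ lam(c x y) in the basis of powers of τ,
which is the basis of unit vectors of the companion module. -/
theorem calV_hankel (k : Type*) [Field k] [Algebra k K] (hn : 1 ≤ n) (d : ℕ) (ε : K)
    (c : PowerSeries K) (s t : Fin d) :
    calV k d ε (hankel n c) s t =
      TruncSeries.lam k hn (TruncSeries.proj K n c * (tau n ε ^ (s : ℕ) * tau n ε ^ (t : ℕ))) := by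
  rw [calV, Matrix.map_apply, hankel_congr_apply hn, tau, ← map_pow, ← map_pow, ← map_mul,
    ← map_mul, TruncSeries.lam_proj]

end Hankel

/-! ### The coordinates of C_n(f) ⊕ C_n(f) -/

section Standard

variable {k : Type*} [Field k]

/-- The endomorphism by which `g₂ - 1` maps the lower to the upper half of `C_n(f) ⊕ C_n(f)`. -/
def companionEnd (f : k[X]) (n : ℕ) : Module.End k
    (Fin (f ^ n).natDegree ⊕ Fin (f ^ n).natDegree → k) :=
  Matrix.toLin' (Matrix.fromBlocks (companion (f ^ n)) 0 0 (companion (f ^ n)))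

/-- The separation of the upper and the lower half of `k ^ (2 d) ⊕ k ^ (2 d)`. -/
def halves (k : Type*) [Field k] (d : ℕ) : ((Fin d ⊕ Fin d → k) × (Fin d ⊕ Fin d → k)) ≃ₗ[k]
    (Fin d ⊕ Fin d → k) × (Fin d ⊕ Fin d → k) where
  toFun x := (Sum.elim (x.1 ∘ Sum.inl) (x.2 ∘ Sum.inl), Sum.elim (x.1 ∘ Sum.inr) (x.2 ∘ Sum.inr))
  invFun x := (Sum.elim (x.1 ∘ Sum.inl) (x.2 ∘ Sum.inl), Sum.elim (x.1 ∘ Sum.inr) (x.2 ∘ Sum.inr))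
  map_add' x y := by ext i <;> rcases i with i | i <;> rfl
  map_smul' r x := by ext i <;> rcases i with i | i <;> rfl
  left_inv x := by ext i <;> rcases i with i | i <;> rfl
  right_inv x := by ext i <;> rcases i with i | i <;> rfl

theorem stdBasis_repr_inl (d : ℕ) (x : (Fin d ⊕ Fin d → k) × (Fin d ⊕ Fin d → k))
    (i : Fin d ⊕ Fin d) : (stdBasis k d).repr x (Sum.inl i) = (halves k d x).1 i := by
  rcases i with i | i <;> simp [stdBasis, halves]

theorem stdBasis_repr_inr (d : ℕ) (x : (Fin d ⊕ Fin d → k) × (Fin d ⊕ Fin d → k))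
    (i : Fin d ⊕ Fin d) : (stdBasis k d).repr x (Sum.inr i) = (halves k d x).2 i := by
  rcases i with i | i <;> simp [stdBasis, halves]

theorem toBilin_stdBasis_fromBlocks {d : ℕ} (A B C D : Matrix (Fin d ⊕ Fin d) (Fin d ⊕ Fin d) k)
    (x y : (Fin d ⊕ Fin d → k) × (Fin d ⊕ Fin d → k)) :
    Matrix.toBilin (stdBasis k d) (Matrix.fromBlocks A B C D) x y =
      Matrix.toBilin' A (halves k d x).1 (halves k d y).1 +
      Matrix.toBilin' B (halves k d x).1 (halves k d y).2 +
      Matrix.toBilin' C (halves k d x).2 (halves k d y).1 +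
      Matrix.toBilin' D (halves k d x).2 (halves k d y).2 := by
  rw [Matrix.toBilin_apply]
  simp only [Matrix.toBilin'_apply, Fintype.sum_sum_type, stdBasis_repr_inl, stdBasis_repr_inr,
    Matrix.fromBlocks_apply₁₁, Matrix.fromBlocks_apply₁₂, Matrix.fromBlocks_apply₂₁,
    Matrix.fromBlocks_apply₂₂, Finset.sum_add_distrib]
  ring

/-- The upper and lower halves as coordinates of `C_n(f) ⊕ C_n(f)`. -/
def C2coords [CharP k 2] (f : k[X]) (n : ℕ) : Coords (C2 f n) (companionEnd f n) where
  e := halves k _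
  apply_g₁ x := by
    have h1 : C2 f n g₁ x = (C f n g₁ x.1, C f n g₁ x.2) := rfl
    rw [h1, C, blockRep_g₁]
    ext i <;> rcases i with i | i <;>
      simp [halves, Matrix.fromBlocks_mulVec]
  apply_g₂ x := by
    have h1 : C2 f n g₂ x = (C f n g₂ x.1, C f n g₂ x.2) := rfl
    rw [h1, C, blockRep_g₂]
    ext i <;> rcases i with i | i <;>
      simp [halves, Matrix.fromBlocks_mulVec, companionEnd]

theorem S_eq_hyp [CharP k 2] (f : k[X]) (n : ℕ)
    (σ : Matrix (Fin (f ^ n).natDegree ⊕ Fin (f ^ n).natDegree)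
      (Fin (f ^ n).natDegree ⊕ Fin (f ^ n).natDegree) k) :
    S σ = (C2coords f n).hyp (Matrix.toBilin' σ) := by
  refine LinearMap.ext₂ fun x y => ?_
  rw [S, toBilin_stdBasis_fromBlocks, Coords.hyp_apply]
  simp [C2coords]

variable [PerfectField k] {K : Type*} [Field K] [Algebra k K] {f : k[X]} {ε : K}

/-- The identification of `k ^ d ⊕ k ^ d` with the square of `K[X] / (X ^ n)`. -/
def C2ringCoords (hf : f.Monic) (hirr : Irreducible f) {n : ℕ} (hn : 1 ≤ n)
    (hε : Polynomial.aeval ε f = 0) (hK : Algebra.adjoin k {ε} = ⊤) :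
    RingCoords (companionEnd f n) (TruncSeries K n) where
  τ := tau n ε
  adjoin_eq := adjoin_tau hf hirr hε hK n
  lam := TruncSeries.lam k hn
  lam_nondeg :=
    have := (finrank_eq_natDegree hf hirr hε hK).1
    TruncSeries.lam_nondeg k hn
  θ := LinearEquiv.sumArrowLequivProdArrow _ _ k k ≪≫ₗ
    LinearEquiv.prodCongr (.ofBijective _ (powerMap_bijective hf hirr hε hK n))
      (.ofBijective _ (powerMap_bijective hf hirr hε hK n))
  θ_apply x := by
    have h := powerMap_companion hf hirr hε n
    have h1 : companionEnd f n x = Sum.elim (Matrix.toLin' (companion (f ^ n)) (x ∘ Sum.inl))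
        (Matrix.toLin' (companion (f ^ n)) (x ∘ Sum.inr)) := by
      rw [companionEnd, Matrix.toLin'_apply, Matrix.fromBlocks_mulVec]
      simp
    rw [h1]
    exact Prod.ext (h _) (h _)

theorem C2ringCoords_θ (hf : f.Monic) (hirr : Irreducible f) {n : ℕ} (hn : 1 ≤ n)
    (hε : Polynomial.aeval ε f = 0) (hK : Algebra.adjoin k {ε} = ⊤)
    (x : Fin (f ^ n).natDegree ⊕ Fin (f ^ n).natDegree → k) :
    (C2ringCoords hf hirr hn hε hK).θ x =
      (powerMap k n _ ε (x ∘ Sum.inl), powerMap k n _ ε (x ∘ Sum.inr)) := rfl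

theorem toBilin'_sigma (hf : f.Monic) (hirr : Irreducible f) {n : ℕ} (hn : 1 ≤ n)
    (hε : Polynomial.aeval ε f = 0) (hK : Algebra.adjoin k {ε} = ⊤) (α β γ : PowerSeries K) :
    Matrix.toBilin' (sigma k (f ^ n).natDegree ε (hankel n α) (hankel n β) (hankel n γ)) =
      (C2ringCoords hf hirr hn hε hK).form (TruncSeries.proj K n α) (TruncSeries.proj K n β)
        (TruncSeries.proj K n γ) := by
  refine LinearMap.BilinForm.ext_basis (Pi.basisFun k _) fun i j => ?_
  have hinl : ∀ i : Fin (f ^ n).natDegree, (C2ringCoords hf hirr hn hε hK).θ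
      (Pi.single (Sum.inl i) 1) = (tau n ε ^ (i : ℕ), 0) := by
    intro i
    rw [C2ringCoords_θ, ← powerMap_single (k := k),
      show (Pi.single (Sum.inl i) 1 : _ ⊕ _ → k) ∘ Sum.inl = Pi.single i 1 by
        ext j; simp [Pi.single_apply],
      show (Pi.single (Sum.inl i) 1 : _ ⊕ _ → k) ∘ Sum.inr = 0 by ext j; simp, map_zero]
  have hinr : ∀ i : Fin (f ^ n).natDegree, (C2ringCoords hf hirr hn hε hK).θ
      (Pi.single (Sum.inr i) 1) = (0, tau n ε ^ (i : ℕ)) := by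
    intro i
    rw [C2ringCoords_θ, ← powerMap_single (k := k),
      show (Pi.single (Sum.inr i) 1 : _ ⊕ _ → k) ∘ Sum.inr = Pi.single i 1 by
        ext j; simp [Pi.single_apply],
      show (Pi.single (Sum.inr i) 1 : _ ⊕ _ → k) ∘ Sum.inl = 0 by ext j; simp, map_zero]
  rw [Pi.basisFun_apply, Pi.basisFun_apply, Matrix.toBilin'_single, RingCoords.form_apply]
  change _ = TruncSeries.lam k hn _
  rcases i with i | i <;> rcases j with j | j <;>
    simp only [sigma, Matrix.fromBlocks_apply₁₁, Matrix.fromBlocks_apply₁₂,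
      Matrix.fromBlocks_apply₂₁, Matrix.fromBlocks_apply₂₂, calV_hankel k hn, hinl, hinr, bil,
      mul_zero, zero_mul, add_zero, zero_add]

end Standard

end KleinSymplectic

namespace KleinSymplectic

open PowerSeries (X coeff)
open Matrix
open scoped Polynomial

/-! ### Classification of the indecomposable symplectic forms -/

section Classification

variable {k : Type*} [Field k] {K : Type*} [Field K] [Algebra k K]

theorem perfectRing_of_finiteDimensional [PerfectField k] [FiniteDimensional k K] [CharP K 2] :
    PerfectRing K 2 :=
  have := Algebra.IsAlgebraic.perfectField k (L := K)
  PerfectField.toPerfectRing 2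

variable [PerfectField k] {f : k[X]} {n : ℕ} {ε : K}

theorem toBilin'_sigma_label (hf : f.Monic) (hirr : Irreducible f) (hn : 1 ≤ n)
    (hε : Polynomial.aeval ε f = 0) (hK : Algebra.adjoin k {ε} = ⊤) (l : Label n K) :
    Matrix.toBilin' (sigma k (f ^ n).natDegree ε l.φ l.ψ l.μ) =
    (C2ringCoords hf hirr hn hε hK).form (TruncSeries.proj K n l.phiSeries)
      (TruncSeries.proj K n l.psiSeries) (TruncSeries.proj K n l.muSeries) := by
  rw [l.φ_eq, l.ψ_eq, l.μ_eq, toBilin'_sigma hf hirr hn hε hK]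

variable [CharP k 2]

theorem S_label_eq (hf : f.Monic) (hirr : Irreducible f) (hn : 1 ≤ n)
    (hε : Polynomial.aeval ε f = 0) (hK : Algebra.adjoin k {ε} = ⊤)
    (l : Label n K) : S (sigma k (f ^ n).natDegree ε l.φ l.ψ l.μ) =
    (C2coords f n).hyp ((C2ringCoords hf hirr hn hε hK).form (TruncSeries.proj K n l.phiSeries)
      (TruncSeries.proj K n l.psiSeries) (TruncSeries.proj K n l.muSeries)) := by
  rw [S_eq_hyp, toBilin'_sigma_label hf hirr hn hε hK]

theorem Label.isUnit_det [CharP K 2] (l : Label n K) :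
    IsUnit (TruncSeries.proj K n l.phiSeries * TruncSeries.proj K n l.muSeries -
      TruncSeries.proj K n l.psiSeries ^ 2) := by
  rw [← map_pow, ← map_mul, ← map_sub]
  refine IsUnit.map _ ?_
  rw [sub_eq_neg_add]
  exact isUnit_add_of_X_dvd (l.isUnit_psiSeries.pow 2).neg (l.X_dvd_phiSeries.mul_right _)

theorem isIndecomposableSymplectic_S_label (hf : f.Monic) (hirr : Irreducible f) (hn : 1 ≤ n)
    (hε : Polynomial.aeval ε f = 0) (hK : Algebra.adjoin k {ε} = ⊤)
    (l : Label n K) :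
    IsIndecomposableSymplectic (C2 f n) (S (sigma k (f ^ n).natDegree ε l.φ l.ψ l.μ)) := by
  have : CharP K 2 := charP_of_injective_algebraMap (algebraMap k K).injective 2
  have := TruncSeries.charP (K := K) hn
  have := TruncSeries.nontrivial (K := K) hn
  have := TruncSeries.isLocalRing (K := K) hn
  have hnt := (C2ringCoords hf hirr hn hε hK).θ.toEquiv.nontrivial
  rw [S_label_eq hf hirr hn hε hK, Coords.isIndecomposableSymplectic_hyp_iff _
    (RingCoords.isAdmissible_form _ l.isUnit_det), RingCoords.decomposes_form_iff _ l.isUnit_det,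
    TruncSeries.isUnit_proj_iff hn, TruncSeries.isUnit_proj_iff hn]
  simp [l.X_dvd_phiSeries, l.X_dvd_muSeries]

theorem isometric_S_label_iff (hf : f.Monic) (hirr : Irreducible f) (hn : 1 ≤ n)
    (hε : Polynomial.aeval ε f = 0) (hK : Algebra.adjoin k {ε} = ⊤)
    (l l' : Label n K) :
    Isometric (C2 f n) (S (sigma k (f ^ n).natDegree ε l.φ l.ψ l.μ))
      (S (sigma k (f ^ n).natDegree ε l'.φ l'.ψ l'.μ)) ↔ l' = l := by
  have : CharP K 2 := charP_of_injective_algebraMap (algebraMap k K).injective 2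
  have := (finrank_eq_natDegree hf hirr hε hK).1
  have := perfectRing_of_finiteDimensional (k := k) (K := K)
  have := TruncSeries.charP (K := K) hn
  rw [S_label_eq hf hirr hn hε hK, S_label_eq hf hirr hn hε hK, Coords.isometric_hyp_iff,
    RingCoords.exists_isometry_form_iff]
  constructor
  · exact label_eq_of_formCongr _ (fun p => TruncSeries.proj_eq_zero_iff.1)
      TruncSeries.proj_surjective
  · rintro rfl
    exact .refl

theorem exists_isometric_S_label (hf : f.Monic) (hirr : Irreducible f) (hn : 1 ≤ n)
    (hε : Polynomial.aeval ε f = 0) (hK : Algebra.adjoin k {ε} = ⊤)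
    {B : LinearMap.BilinForm k
    ((Fin (f ^ n).natDegree ⊕ Fin (f ^ n).natDegree → k) ×
      (Fin (f ^ n).natDegree ⊕ Fin (f ^ n).natDegree → k))}
    (hB : IsIndecomposableSymplectic (C2 f n) B) :
    ∃ l : Label n K, Isometric (C2 f n) B (S (sigma k (f ^ n).natDegree ε l.φ l.ψ l.μ)) := by
  have : CharP K 2 := charP_of_injective_algebraMap (algebraMap k K).injective 2
  have := (finrank_eq_natDegree hf hirr hε hK).1
  have := perfectRing_of_finiteDimensional (k := k) (K := K)
  have := TruncSeries.charP (K := K) hn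
  have := TruncSeries.nontrivial (K := K) hn
  have := TruncSeries.isLocalRing (K := K) hn
  let D := C2ringCoords hf hirr hn hε hK
  have hnt := D.θ.toEquiv.nontrivial
  have : FiniteDimensional k (TruncSeries K n) :=
    .of_injective (TruncSeries.coeffs k) (TruncSeries.coeffs_injective k)
  obtain ⟨s, hs, hiso⟩ := (C2coords f n).exists_isometric_hyp hB.1
  have hdec := ((C2coords f n).isIndecomposableSymplectic_hyp_iff hs).1
    (hiso.isIndecomposableSymplectic hB)
  obtain ⟨α, β, γ, rfl⟩ := D.exists_eq_form hs
  -- A unit on the diagonal would split off a summand. Then β must be a unit as well: otherwise the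
  -- socle element X ^ (n - 1) would give a vector in the radical.
  have hα : ¬ IsUnit α := fun h => hdec (D.decomposes_of_isUnit_bil (v := (1, 0)) (by simpa [bil]))
  have hγ : ¬ IsUnit γ := fun h => hdec (D.decomposes_of_isUnit_bil (v := (0, 1)) (by simpa [bil]))
  have hβ := D.isUnit_of_isAdmissible_form (TruncSeries.socle_ne_zero hn)
    (fun _ => TruncSeries.mul_socle hn) hs hα
  obtain ⟨α, rfl⟩ := TruncSeries.proj_surjective α
  obtain ⟨β, rfl⟩ := TruncSeries.proj_surjective β
  obtain ⟨γ, rfl⟩ := TruncSeries.proj_surjective γ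
  rw [TruncSeries.isUnit_proj_iff hn, not_not] at hα hγ
  rw [TruncSeries.isUnit_proj_iff hn, PowerSeries.X_dvd_iff] at hβ
  obtain ⟨l, hl⟩ := exists_label_formCongr (TruncSeries.proj K n)
    (fun p => TruncSeries.proj_eq_zero_iff.2) hn hα hγ
    (PowerSeries.isUnit_iff_constantCoeff.2 (isUnit_iff_ne_zero.2 hβ))
  refine ⟨l, hiso.trans ?_⟩
  rw [S_label_eq hf hirr hn hε hK, Coords.isometric_hyp_iff, RingCoords.exists_isometry_form_iff]
  exact hl

/-- Different labels give different triples of Hankel matrices. -/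
theorem label_triple_injective (hf : f.Monic) (hirr : Irreducible f) (hn : 1 ≤ n)
    (hε : Polynomial.aeval ε f = 0) (hK : Algebra.adjoin k {ε} = ⊤) :
    Function.Injective (fun l : Label n K => (l.φ, l.ψ, l.μ)) := by
  intro l l' h
  simp only [Prod.mk.injEq] at h
  refine ((isometric_S_label_iff hf hirr hn hε hK l l').1 ?_).symm
  rw [h.1, h.2.1, h.2.2]
  exact ⟨.refl _ _, fun _ _ => rfl, fun _ _ => rfl⟩

theorem isFullSetOfReps_S_label (hf : f.Monic) (hirr : Irreducible f) (hn : 1 ≤ n)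
    (hε : Polynomial.aeval ε f = 0) (hK : Algebra.adjoin k {ε} = ⊤) :
    IsFullSetOfReps {B | IsIndecomposableSymplectic (C2 f n) B}
    (Isometric (C2 f n))
    (fun T : calK n K => S (sigma k (f ^ n).natDegree ε T.1.1 T.1.2.1 T.1.2.2)) := by
  constructor
  · rintro ⟨-, l, rfl⟩
    exact isIndecomposableSymplectic_S_label hf hirr hn hε hK l
  · intro B hB
    obtain ⟨l, hl⟩ := exists_isometric_S_label hf hirr hn hε hK hB
    refine ⟨⟨_, l, rfl⟩, hl, ?_⟩
    rintro ⟨-, l', rfl⟩ hl'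
    rw [(isometric_S_label_iff hf hirr hn hε hK l l').1 (hl.symm.trans hl')]

theorem natCard_isometryClass (hf : f.Monic) (hirr : Irreducible f) (hn : 1 ≤ n)
    (hε : Polynomial.aeval ε f = 0) (hK : Algebra.adjoin k {ε} = ⊤) :
    Nat.card (IsometryClass (C2 f n)) = Nat.card (Label n K) := by
  refine (Nat.card_congr (Equiv.ofBijective (fun l : Label n K =>
    (Quotient.mk (isometrySetoid (C2 f n))
      ⟨_, isIndecomposableSymplectic_S_label hf hirr hn hε hK l⟩)) ⟨?_, ?_⟩)).symm
  · intro l l' h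
    exact ((isometric_S_label_iff hf hirr hn hε hK l l').1 (Quotient.exact h)).symm
  · intro c
    induction c using Quotient.inductionOn with
    | h B =>
      obtain ⟨l, hl⟩ := exists_isometric_S_label hf hirr hn hε hK B.2
      exact ⟨l, Quotient.sound hl.symm⟩

end Classification

end KleinSymplectic

namespace KleinSymplectic

/-! ### Counting labels -/

section Count

variable {K : Type*} [Field K]

theorem natCard_first_ne_one [Finite K] (t : ℕ) :
    Nat.card {ψ : Fin t → K // ∀ j : Fin t, (j : ℕ) = 0 → ψ j ≠ 1} =
      if t = 0 then 1 else (Nat.card K - 1) * Nat.card K ^ (t - 1) := by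
  classical
  have := Fintype.ofFinite K
  rw [Nat.card_congr (Equiv.subtypePiEquivPi (p := fun (j : Fin t) (x : K) => (j : ℕ) = 0 → x ≠ 1)),
    Nat.card_pi]
  rcases t with _ | t
  · simp
  · rw [Fin.prod_univ_succ, if_neg (by omega)]
    congr 1
    · simp
    · simp

/-- A label consists of the pair `(r, s)` and of its coefficients. -/
def labelEquiv (n : ℕ) (K : Type*) [Field K] : Label n K ≃
    Σ p : ((Finset.Icc 2 (n + 1)).sigma fun r => Finset.range ((n + 1 - r) / 2 + 1) :
      Finset (Σ _ : ℕ, ℕ)), (Fin p.1.2 → K) ×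
        {ψ : Fin ((n + 1 - p.1.1 - 2 * p.1.2) / 2) → K //
          ∀ j : Fin _, (j : ℕ) = 0 → ψ j ≠ 1} where
  toFun l := ⟨⟨⟨l.r, l.s⟩, by
    have := l.two_le_r
    have := l.r_le
    have := l.s_le
    simp only [Finset.mem_sigma, Finset.mem_Icc, Finset.mem_range]
    omega⟩, l.phi, l.psi, l.psi_ne⟩
  invFun p :=
    have h := p.1.2
    have h1 := Finset.mem_Icc.1 (Finset.mem_sigma.1 h).1
    have h2 := Finset.mem_range.1 (Finset.mem_sigma.1 h).2
    { r := p.1.1.1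
      s := p.1.1.2
      two_le_r := h1.1
      r_le := h1.2
      s_le := by omega
      phi := p.2.1
      psi := p.2.2.1
      psi_ne := p.2.2.2 }
  left_inv _ := rfl
  right_inv _ := rfl

/-- The count depends on r only through N = n + 1 - r, which runs over 0, …, n - 1; the number of
ψ-coefficients is ⌊N/2⌋ - s. -/
theorem natCard_label_eq_sum [Finite K] (n : ℕ) : Nat.card (Label n K) =
    ∑ N ∈ Finset.range n, ∑ s ∈ Finset.range (N / 2 + 1), Nat.card K ^ s *
      if N / 2 - s = 0 then 1 else (Nat.card K - 1) * Nat.card K ^ (N / 2 - s - 1) := by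
  rw [Nat.card_congr (labelEquiv n K), Nat.card_sigma]
  simp only [Nat.card_prod, natCard_first_ne_one, Nat.card_fun, Nat.card_fin]
  rw [Finset.sum_coe_sort ((Finset.Icc 2 (n + 1)).sigma fun r =>
      Finset.range ((n + 1 - r) / 2 + 1)) (fun p => Nat.card K ^ p.2 *
        if (n + 1 - p.1 - 2 * p.2) / 2 = 0 then 1
        else (Nat.card K - 1) * Nat.card K ^ ((n + 1 - p.1 - 2 * p.2) / 2 - 1)),
    Finset.sum_sigma]
  refine Finset.sum_nbij' (fun r => n + 1 - r) (fun N => n + 1 - N) ?_ ?_ ?_ ?_ ?_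
  · intro r hr
    rw [Finset.mem_Icc] at hr
    rw [Finset.mem_range]
    omega
  · intro N hN
    rw [Finset.mem_range] at hN
    rw [Finset.mem_Icc]
    omega
  · intro r hr
    rw [Finset.mem_Icc] at hr
    omega
  · intro N hN
    rw [Finset.mem_range] at hN
    omega
  · intro r _
    refine Finset.sum_congr rfl fun s _ => ?_
    rw [show (n + 1 - r - 2 * s) / 2 = (n + 1 - r) / 2 - s by omega]

/-- Every s < a contributes the same number, because the exponents s and a - s - 1 add up to a - 1.
-/
theorem sum_labels_eq {q : ℕ} (a : ℕ) :
    (∑ s ∈ Finset.range (a + 1), q ^ s * if a - s = 0 then 1 else (q - 1) * q ^ (a - s - 1)) =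
      a * ((q - 1) * q ^ (a - 1)) + q ^ a := by
  rw [Finset.sum_range_succ, Nat.sub_self, if_pos rfl, mul_one]
  congr 1
  rw [Finset.sum_congr rfl (g := fun _ => (q - 1) * q ^ (a - 1)), Finset.sum_const,
    Finset.card_range, smul_eq_mul]
  intro s hs
  rw [Finset.mem_range] at hs
  rw [if_neg (by omega), mul_left_comm, ← pow_add]
  congr 2; omega

/-- N = 2a and N = 2a + 1 give the same term (a + 1) q ^ a - a q ^ (a - 1), so the sum telescopes.
-/
theorem sum_even {q : ℕ} (hq : 1 ≤ q) (b : ℕ) :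
    ∑ N ∈ Finset.range (2 * (b + 1)), (N / 2 * ((q - 1) * q ^ (N / 2 - 1)) + q ^ (N / 2)) =
      2 * (b + 1) * q ^ b := by
  obtain ⟨q, rfl⟩ : ∃ p, q = p + 1 := ⟨q - 1, by omega⟩
  rw [Nat.add_sub_cancel]
  induction b with
  | zero => simp [Finset.sum_range_succ]
  | succ b ih =>
    rw [show 2 * (b + 1 + 1) = 2 * (b + 1) + 1 + 1 by ring, Finset.sum_range_succ,
      Finset.sum_range_succ, ih, show 2 * (b + 1) / 2 = b + 1 by omega,
      show (2 * (b + 1) + 1) / 2 = b + 1 by omega, Nat.add_sub_cancel]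
    ring

theorem natCard_label [Finite K] {n : ℕ} (hn : 1 ≤ n) : Nat.card (Label n K) =
    if Even n then n * Nat.card K ^ ((n - 2) / 2)
    else (n + 1) / 2 * Nat.card K ^ ((n - 1) / 2) + (n - 1) / 2 * Nat.card K ^ ((n - 3) / 2) := by
  have hq : 1 ≤ Nat.card K := Nat.card_pos
  rw [natCard_label_eq_sum]
  simp only [sum_labels_eq]
  rcases Nat.even_or_odd' n with ⟨b, rfl | rfl⟩
  · obtain ⟨b, rfl⟩ : ∃ c, b = c + 1 := ⟨b - 1, by omega⟩
    rw [if_pos (even_two_mul _), sum_even hq, show (2 * (b + 1) - 2) / 2 = b by omega]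
  · rw [if_neg (by simp), Finset.sum_range_succ]
    -- For n = 1 the exponent (n - 3) / 2 is truncated to zero, which is harmless as its coefficient
    -- (n - 1) / 2 is zero.
    rcases b with _ | b
    · simp
    · rw [sum_even hq, show (2 * (b + 1) + 1 + 1) / 2 = b + 2 by omega,
        show (2 * (b + 1) + 1 - 1) / 2 = b + 1 by omega,
        show (2 * (b + 1) + 1 - 3) / 2 = b by omega, show 2 * (b + 1) / 2 = b + 1 by omega,
        Nat.add_sub_cancel]
      generalize Nat.card K = q at hq
      obtain ⟨q, rfl⟩ : ∃ p, q = p + 1 := ⟨q - 1, by omega⟩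
      rw [Nat.add_sub_cancel]
      ring

end Count

end KleinSymplectic

namespace KleinSymplectic

open Matrix

/-! ### Invariant quadratic forms and their isometry invariant -/

section Quadratic

variable {k M N : Type*} [Field k] [AddCommGroup M] [Module k M]
  [AddCommGroup N] [Module k N]

theorem map_add_of_polarBilin_eq {q : QuadraticForm k M} {B : LinearMap.BilinForm k M}
    (h : QuadraticMap.polarBilin q = B) (x y : M) : q (x + y) = q x + q y + B x y := by
  rw [← h, QuadraticMap.polarBilin_apply_apply, QuadraticMap.polar]
  ring

namespace Coords

variable {ρ : Representation k V4 M} {T : N →ₗ[k] N} (c : Coords ρ T)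

/-- The upper half of `M`. -/
def up (u : N) : M := c.e.symm (u, 0)

/-- The lower half of `M`. -/
def low (w : N) : M := c.e.symm (0, w)

theorem eq_up_add_low (x : M) : x = c.up (c.e x).1 + c.low (c.e x).2 := by
  rw [up, low, ← symm_add]; simp

theorem hyp_up_low (s : LinearMap.BilinForm k N) (u w : N) :
    c.hyp s (c.up u) (c.low w) = s u w := by simp [hyp_apply, up, low]

theorem hyp_low_low (s : LinearMap.BilinForm k N) (u w : N) :
    c.hyp s (c.low u) (c.low w) = 0 := by simp [hyp_apply, low]

theorem hyp_up_up (s : LinearMap.BilinForm k N) (u w : N) :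
    c.hyp s (c.up u) (c.up w) = 0 := by simp [hyp_apply, up]

theorem hyp_up (s : LinearMap.BilinForm k N) (x : M) (u : N) :
    c.hyp s x (c.up u) = s (c.e x).2 u := by simp [hyp_apply, up]

theorem g₁_apply_eq (x : M) : ρ g₁ x = x + c.up (c.e x).2 := by
  apply c.e.injective
  rw [c.apply_g₁, map_add, up, LinearEquiv.apply_symm_apply]
  ext <;> simp

theorem g₂_apply_eq (x : M) : ρ g₂ x = x + c.up (T (c.e x).2) := by
  apply c.e.injective
  rw [c.apply_g₂, map_add, up, LinearEquiv.apply_symm_apply]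
  ext <;> simp

theorem e_low (w : N) : c.e (c.low w) = (0, w) := by simp [low]

theorem e_up (w : N) : c.e (c.up w) = (w, 0) := by simp [up]

variable [CharP k 2]

/-- Invariance of a quadratic form with associated form `[0, s; s, 0]`. -/
theorem isInvariantQuadratic_iff {s : LinearMap.BilinForm k N} (hs : ∀ x y, s x y = s y x)
    {q : QuadraticForm k M} : IsInvariantQuadratic ρ (c.hyp s) q ↔
      QuadraticMap.polarBilin q = c.hyp s ∧ (∀ w, q (c.up w) = s w w) ∧
        ∀ w, q (c.up (T w)) = s (T w) w := by
  rw [IsInvariantQuadratic, and_comm]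
  refine and_congr_right fun hq => ?_
  have hadd := map_add_of_polarBilin_eq hq
  rw [qinvariant_iff]
  have h1 : ∀ x, q (ρ g₁ x) = q x ↔ q (c.up (c.e x).2) = s (c.e x).2 (c.e x).2 := fun x => by
    rw [c.g₁_apply_eq, hadd, hyp_up, add_assoc, add_eq_left, CharTwo.add_eq_zero]
  have h2 : ∀ x, q (ρ g₂ x) = q x ↔ q (c.up (T (c.e x).2)) = s (T (c.e x).2) (c.e x).2 := fun x => by
    rw [c.g₂_apply_eq, hadd, hyp_up, add_assoc, add_eq_left, CharTwo.add_eq_zero, hs]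
  simp only [h1, h2]
  constructor
  · rintro ⟨h3, h4⟩
    exact ⟨fun w => by simpa [e_low] using h3 (c.low w), fun w => by simpa [e_low] using h4 (c.low w)⟩
  · rintro ⟨h3, h4⟩
    exact ⟨fun x => h3 _, fun x => h4 _⟩

theorem sq_injective {a b : k} (h : a ^ 2 = b ^ 2) : a = b := by
  rw [← CharTwo.add_eq_zero, ← CharTwo.add_sq, sq_eq_zero_iff, CharTwo.add_eq_zero] at h
  exact h

/-- The value at `h` on the lower half is an isometry invariant up to elements `y ^ 2 + y`. -/
theorem exists_sq_add_of_qIsometric [FiniteDimensional k N] {s : LinearMap.BilinForm k N}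
    (hs : IsAdmissible T s) {h : N} (hh : ∀ w, s w w = s h w ^ 2) {q q' : QuadraticForm k M}
    (hq : IsInvariantQuadratic ρ (c.hyp s) q) (hq' : IsInvariantQuadratic ρ (c.hyp s) q')
    (hqq : QIsometric ρ q q') : ∃ y, q (c.low h) - q' (c.low h) = y ^ 2 + y := by
  obtain ⟨α, hα, hαq⟩ := hqq
  obtain ⟨A, B, -, hA⟩ := c.exists_eq_aut hα
  have hadd := map_add_of_polarBilin_eq hq.2
  have hadd' := map_add_of_polarBilin_eq hq'.2
  have hpol : ∀ x y, c.hyp s (α x) (α y) = c.hyp s x y := by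
    intro x y
    have h1 := hadd' x y
    rw [← hαq, ← hαq, ← hαq, map_add, hadd] at h1
    exact add_left_cancel h1
  have hsA : ∀ x y, s (A x) (A y) = s x y := by
    intro x y
    have h1 := hpol (c.up x) (c.low y)
    rw [hyp_up_low, hyp_apply, hA, hA, e_low, e_up] at h1
    simpa using h1
  -- A preserves w ↦ s(w, w) = s(h, w)², and square roots are unique in characteristic two, so A
  -- preserves the vector h that represents them.
  have hAh : A h = h := by
    have h1 : ∀ w, s h (A w) = s h w := fun w => sq_injective (by rw [← hh, ← hh, hsA])
    rw [← sub_eq_zero]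
    refine hs.nondeg _ fun y => ?_
    obtain ⟨w, rfl⟩ := A.surjective y
    rw [map_sub, LinearMap.sub_apply, hsA, h1, sub_self]
  have h1 : α (c.low h) = c.up (B h) + c.low h := by
    rw [c.eq_up_add_low (α (c.low h)), hA, e_low]
    simp [hAh]
  -- The isometry adds the upper vector B h to h; its value contributes the square of s(h, B h), and
  -- the cross term contributes s(h, B h) itself.
  refine ⟨s h (B h), ?_⟩
  have h2 := hαq (c.low h)
  rw [h1, hadd, hyp_up_low, ((c.isInvariantQuadratic_iff hs.symm).1 hq).2.1, hh, hs.symm (B h)] at h2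
  rw [← h2]
  have h3 : (2 : k) = 0 := CharTwo.two_eq_zero
  linear_combination (-(s h (B h) ^ 2 + s h (B h))) * h3

/-- The converse construction: a self-adjoint `B` moves `q` to `q'`. -/
theorem qIsometric_of_selfAdjoint {s : LinearMap.BilinForm k N}
    (hs : IsAdmissible T s) {q q' : QuadraticForm k M}
    (hq : IsInvariantQuadratic ρ (c.hyp s) q) (hq' : IsInvariantQuadratic ρ (c.hyp s) q')
    {B : N →ₗ[k] N} (hB : ∀ w, s (B w) (B w) + s (B w) w + q (c.low w) = q' (c.low w)) :
    QIsometric ρ q q' := by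
  have hadd := map_add_of_polarBilin_eq hq.2
  have hadd' := map_add_of_polarBilin_eq hq'.2
  have hup := ((c.isInvariantQuadratic_iff hs.symm).1 hq).2.1
  have hup' := ((c.isInvariantQuadratic_iff hs.symm).1 hq').2.1
  refine ⟨c.aut (LinearEquiv.refl k N) B, c.isModuleAut_aut (fun _ => rfl) B, fun x => ?_⟩
  have h1 : c.aut (LinearEquiv.refl k N) B x =
      c.up (c.e x).1 + (c.up (B (c.e x).2) + c.low (c.e x).2) := by
    rw [c.eq_up_add_low (c.aut _ _ x), e_aut, ← add_assoc]
    congr 1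
    simp [up, ← map_add]
  conv_rhs => rw [c.eq_up_add_low x, hadd', hyp_up_low, hup', ← hB]
  rw [h1, hadd, hadd, map_add, hyp_up_up, hyp_up_low, hyp_up_low, hup, hup]
  ring

end Coords

/-- A symmetric matrix with prescribed diagonal `e` and prescribed value `v` at a vector `h`. -/
theorem exists_symm_matrix [CharP k 2] {ι : Type*} [Fintype ι] [DecidableEq ι] {h v e : ι → k} {u : ι}
    (hu : h u ≠ 0) (hv : ∑ i, e i * h i ^ 2 = ∑ i, h i * v i) :
    ∃ A : Matrix ι ι k, (∀ i j, A i j = A j i) ∧ (∀ i, A i i = e i) ∧ ∀ i, (A *ᵥ h) i = v i := by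
  -- Off the diagonal only row and column u are used. Row i ≠ u of the equation A h = v determines b
  -- i; row u is then equivalent to the compatibility condition `hv`.
  let b : ι → k := fun i => (v i - e i * h i) / h u
  let A : Matrix ι ι k := Matrix.of fun i j =>
    if i = j then e i else if i = u then b j else if j = u then b i else 0
  have hb : ∀ i, b i * h u = v i - e i * h i := fun i => div_mul_cancel₀ _ hu
  refine ⟨A, ?_, ?_, ?_⟩
  · intro i j
    simp only [A, Matrix.of_apply]
    split_ifs <;> simp_all
  · intro i; simp [A]
  · intro i
    rw [Matrix.mulVec, dotProduct]
    by_cases hi : i = u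
    · subst hi
      rw [← Finset.add_sum_erase _ _ (Finset.mem_univ i)] at hv ⊢
      conv at hv => rhs; rw [← Finset.add_sum_erase _ _ (Finset.mem_univ i)]
      have h1 : ∑ j ∈ Finset.univ.erase i, A i j * h j =
          ∑ j ∈ Finset.univ.erase i, b j * h j :=
        Finset.sum_congr rfl fun j hj => by
          have : i ≠ j := (Finset.ne_of_mem_erase hj).symm
          simp [A, this]
      have h2 : (∑ j ∈ Finset.univ.erase i, b j * h j) * h i =
          ∑ j ∈ Finset.univ.erase i, h j * v j - ∑ j ∈ Finset.univ.erase i, e j * h j ^ 2 := by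
        rw [Finset.sum_mul, ← Finset.sum_sub_distrib]
        exact Finset.sum_congr rfl fun j _ => by linear_combination h j * hb j
      rw [h1]
      refine mul_right_cancel₀ hu ?_
      have h3 : (2 : k) = 0 := CharTwo.two_eq_zero
      have h4 : A i i = e i := by simp [A]
      rw [add_mul, h2, h4]
      linear_combination (-1 : k) * hv + (e i * h i ^ 2 - h i * v i) * h3
    · have h1 : ∀ j, A i j * h j = (if i = j then e i * h i else 0) + if j = u then v i - e i * h i else 0 := by
        intro j
        rw [← hb]
        by_cases hij : i = j
        · subst hij; simp [A, hi]
        · by_cases hj : j = u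
          · subst hj; simp [A, hi]
          · simp [A, hi, hij, hj]
      simp only [h1, Finset.sum_add_distrib, Finset.sum_ite_eq, Finset.sum_ite_eq', Finset.mem_univ,
        if_true]
      ring

end Quadratic

end KleinSymplectic

namespace KleinSymplectic

open Matrix
open scoped Polynomial

/-! ### Diagonal forms and the forms Q_σ(D') -/

section Diagonal

variable {k ι : Type*} [Field k] [Fintype ι] [DecidableEq ι]

/-- An additive function that scales by squares is a diagonal form. -/
theorem eq_sum_mul_sq {g : (ι → k) → k} (hadd : ∀ x y, g (x + y) = g x + g y)
    (hsmul : ∀ (a : k) x, g (a • x) = a ^ 2 * g x) (w : ι → k) :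
    g w = ∑ i, g (Pi.single i 1) * w i ^ 2 := by
  let G : (ι → k) →+ k := AddMonoidHom.mk' g hadd
  have h1 : g w = G (∑ i, w i • Pi.single i 1) := by
    rw [← pi_eq_sum_univ' w]; rfl
  rw [h1, map_sum]
  refine Finset.sum_congr rfl fun i _ => ?_
  change g _ = _
  rw [hsmul, mul_comm]

theorem toBilin'_diagonal (v x y : ι → k) :
    Matrix.toBilin' (Matrix.diagonal v) x y = ∑ i, v i * (x i * y i) := by
  rw [Matrix.toBilin'_apply', dotProduct]
  refine Finset.sum_congr rfl fun i _ => ?_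
  rw [Matrix.mulVec_diagonal]; ring

variable [CharP k 2]

theorem toBilin'_self {A : Matrix ι ι k} (hA : ∀ i j, A i j = A j i) (w : ι → k) :
    Matrix.toBilin' A w w = ∑ i, A i i * w i ^ 2 := by
  have hsymm : ∀ x y, Matrix.toBilin' A x y = Matrix.toBilin' A y x := fun x y => by
    rw [Matrix.toBilin'_apply, Matrix.toBilin'_apply, Finset.sum_comm]
    refine Finset.sum_congr rfl fun i _ => Finset.sum_congr rfl fun j _ => ?_
    rw [hA j i]; ring
  rw [eq_sum_mul_sq (g := fun w => Matrix.toBilin' A w w)]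
  · simp
  · intro x y
    simp only [map_add, LinearMap.add_apply]
    rw [hsymm y x]
    have h2 : (2 : k) = 0 := CharTwo.two_eq_zero
    linear_combination Matrix.toBilin' A x y * h2
  · intro a x
    simp only [map_smul, LinearMap.smul_apply, smul_eq_mul]
    ring

end Diagonal

section Standard

variable {k : Type*} [Field k] [CharP k 2] {f : k[X]} {n : ℕ}
  {σ : Matrix (Fin (f ^ n).natDegree ⊕ Fin (f ^ n).natDegree)
    (Fin (f ^ n).natDegree ⊕ Fin (f ^ n).natDegree) k}

theorem Q_apply (v : Fin (f ^ n).natDegree ⊕ Fin (f ^ n).natDegree → k)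
    (x : (Fin (f ^ n).natDegree ⊕ Fin (f ^ n).natDegree → k) ×
      (Fin (f ^ n).natDegree ⊕ Fin (f ^ n).natDegree → k)) :
    Q σ (Matrix.diagonal v) x = ∑ i, σ i i * ((C2coords f n).e x).1 i ^ 2 +
      Matrix.toBilin' σ ((C2coords f n).e x).1 ((C2coords f n).e x).2 +
      ∑ i, v i * ((C2coords f n).e x).2 i ^ 2 := by
  have h : Q σ (Matrix.diagonal v) x = Matrix.toBilin (stdBasis k (f ^ n).natDegree)
    (Matrix.fromBlocks (diagPart σ) σ 0 (Matrix.diagonal v)) x x := rfl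
  rw [h, toBilin_stdBasis_fromBlocks, diagPart, toBilin'_diagonal, toBilin'_diagonal]
  simp only [map_zero, LinearMap.zero_apply, add_zero, ← pow_two]
  rfl

theorem Q_low (v w : Fin (f ^ n).natDegree ⊕ Fin (f ^ n).natDegree → k) :
    Q σ (Matrix.diagonal v) ((C2coords f n).low w) = ∑ i, v i * w i ^ 2 := by
  rw [Q_apply, Coords.e_low]; simp

theorem Q_up (hσ : ∀ i j, σ i j = σ j i)
    (v w : Fin (f ^ n).natDegree ⊕ Fin (f ^ n).natDegree → k) :
    Q σ (Matrix.diagonal v) ((C2coords f n).up w) = Matrix.toBilin' σ w w := by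
  rw [Q_apply, Coords.e_up, toBilin'_self hσ]; simp

theorem polarBilin_Q (hs : ∀ x y, Matrix.toBilin' σ x y = Matrix.toBilin' σ y x)
    (v : Fin (f ^ n).natDegree ⊕ Fin (f ^ n).natDegree → k) :
    QuadraticMap.polarBilin (Q σ (Matrix.diagonal v)) =
      (C2coords f n).hyp (Matrix.toBilin' σ) := by
  rw [Q, LinearMap.BilinMap.polarBilin_toQuadraticMap]
  refine LinearMap.ext₂ fun x y => ?_
  rw [LinearMap.add_apply, LinearMap.add_apply, LinearMap.flip_apply, toBilin_stdBasis_fromBlocks,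
    toBilin_stdBasis_fromBlocks, Coords.hyp_apply, diagPart]
  simp only [toBilin'_diagonal, map_zero, LinearMap.zero_apply, add_zero]
  have h1 : ∀ a x y : Fin (f ^ n).natDegree ⊕ Fin (f ^ n).natDegree → k,
      ∑ i, a i * (x i * y i) = ∑ i, a i * (y i * x i) := fun a x y =>
    Finset.sum_congr rfl fun i _ => by ring
  rw [h1 _ (halves k _ y).1, h1 v (halves k _ y).2, hs (halves k _ y).1]
  have h2 : (2 : k) = 0 := CharTwo.two_eq_zero
  change _ = Matrix.toBilin' σ (halves k _ x).1 (halves k _ y).2 +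
    Matrix.toBilin' σ (halves k _ x).2 (halves k _ y).1
  linear_combination (∑ i, σ i i * ((halves k _ x).1 i * (halves k _ y).1 i) +
    ∑ i, v i * ((halves k _ x).2 i * (halves k _ y).2 i)) * h2

theorem isInvariantQuadratic_Q (hσ : ∀ i j, σ i j = σ j i)
    (hs : IsAdmissible (companionEnd f n) (Matrix.toBilin' σ))
    (hT : ∀ w, Matrix.toBilin' σ (companionEnd f n w) (companionEnd f n w) =
      Matrix.toBilin' σ (companionEnd f n w) w)
    (v : Fin (f ^ n).natDegree ⊕ Fin (f ^ n).natDegree → k) :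
    IsInvariantQuadratic (C2 f n) (S σ) (Q σ (Matrix.diagonal v)) := by
  rw [S_eq_hyp, Coords.isInvariantQuadratic_iff _ hs.symm]
  exact ⟨polarBilin_Q hs.symm v, fun w => Q_up hσ v w, fun w => (Q_up hσ v _).trans (hT w)⟩

/-- g₁ prescribes q(up w) = s(w, w) and g₂ prescribes q(up(T w)) = s(T w, w); consistency of the two
prescriptions is the only obstruction. -/
theorem exists_isInvariantQuadratic_iff (hσ : ∀ i j, σ i j = σ j i)
    (hs : IsAdmissible (companionEnd f n) (Matrix.toBilin' σ)) :
    (∃ q, IsInvariantQuadratic (C2 f n) (S σ) q) ↔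
      ∀ w, Matrix.toBilin' σ (companionEnd f n w) (companionEnd f n w) =
        Matrix.toBilin' σ (companionEnd f n w) w := by
  constructor
  · rintro ⟨q, hq⟩ w
    rw [S_eq_hyp, Coords.isInvariantQuadratic_iff _ hs.symm] at hq
    rw [← hq.2.1, hq.2.2]
  · exact fun h => ⟨_, isInvariantQuadratic_Q hσ hs h 0⟩

/-- The lower half is isotropic for the associated form, so the restriction of q to it is additive.
-/
theorem low_eq_sum {s : LinearMap.BilinForm k (Fin (f ^ n).natDegree ⊕ Fin (f ^ n).natDegree → k)}
    {q : QuadraticForm k ((Fin (f ^ n).natDegree ⊕ Fin (f ^ n).natDegree → k) ×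
      (Fin (f ^ n).natDegree ⊕ Fin (f ^ n).natDegree → k))}
    (hq : IsInvariantQuadratic (C2 f n) ((C2coords f n).hyp s) q)
    (w : Fin (f ^ n).natDegree ⊕ Fin (f ^ n).natDegree → k) :
    q ((C2coords f n).low w) = ∑ i, q ((C2coords f n).low (Pi.single i 1)) * w i ^ 2 := by
  refine eq_sum_mul_sq (g := fun w => q ((C2coords f n).low w)) (fun x y => ?_) (fun a x => ?_) w
  · have : (C2coords f n).low (x + y) = (C2coords f n).low x + (C2coords f n).low y := by
      simp [Coords.low, ← map_add]
    rw [this, map_add_of_polarBilin_eq hq.2, Coords.hyp_low_low, add_zero]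
  · have : (C2coords f n).low (a • x) = a • (C2coords f n).low x := by
      simp [Coords.low, ← map_smul]
    rw [this, QuadraticMap.map_smul, smul_eq_mul, pow_two]

theorem setOf_isInvariantQuadratic_eq (hσ : ∀ i j, σ i j = σ j i)
    (hs : IsAdmissible (companionEnd f n) (Matrix.toBilin' σ))
    (hT : ∀ w, Matrix.toBilin' σ (companionEnd f n w) (companionEnd f n w) =
      Matrix.toBilin' σ (companionEnd f n w) w) :
    {q | IsInvariantQuadratic (C2 f n) (S σ) q} =
      Set.range fun v => Q σ (Matrix.diagonal v) := by
  ext q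
  constructor
  · intro hq
    have hq' : IsInvariantQuadratic (C2 f n) ((C2coords f n).hyp (Matrix.toBilin' σ)) q := by
      rw [← S_eq_hyp]; exact hq
    refine ⟨fun i => q ((C2coords f n).low (Pi.single i 1)), ?_⟩
    ext x
    have h1 := ((C2coords f n).isInvariantQuadratic_iff hs.symm).1 hq'
    conv_rhs => rw [(C2coords f n).eq_up_add_low x, map_add_of_polarBilin_eq h1.1, h1.2.1,
      Coords.hyp_up_low, low_eq_sum hq', toBilin'_self hσ]
    rw [Q_apply]
    ring
  · rintro ⟨v, rfl⟩
    exact isInvariantQuadratic_Q hσ hs hT v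

/-- The classification of the quadratic forms by the value at the vector `h`. -/
theorem qIsometric_iff (hs : IsAdmissible (companionEnd f n) (Matrix.toBilin' σ))
    {h : Fin (f ^ n).natDegree ⊕ Fin (f ^ n).natDegree → k}
    (hh : ∀ w, Matrix.toBilin' σ w w = Matrix.toBilin' σ h w ^ 2)
    {q q' : QuadraticForm k ((Fin (f ^ n).natDegree ⊕ Fin (f ^ n).natDegree → k) ×
      (Fin (f ^ n).natDegree ⊕ Fin (f ^ n).natDegree → k))}
    (hq : IsInvariantQuadratic (C2 f n) (S σ) q) (hq' : IsInvariantQuadratic (C2 f n) (S σ) q') :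
    QIsometric (C2 f n) q q' ↔
      ∃ y, q ((C2coords f n).low h) - q' ((C2coords f n).low h) = y ^ 2 + y := by
  rw [S_eq_hyp] at hq hq'
  refine ⟨(C2coords f n).exists_sq_add_of_qIsometric hs hh hq hq', ?_⟩
  rintro ⟨y, hy⟩
  have h2 : (2 : k) = 0 := CharTwo.two_eq_zero
  let Δ : Fin (f ^ n).natDegree ⊕ Fin (f ^ n).natDegree → k := fun i =>
    q ((C2coords f n).low (Pi.single i 1)) - q' ((C2coords f n).low (Pi.single i 1))
  have hΔ : ∀ w, q ((C2coords f n).low w) - q' ((C2coords f n).low w) = ∑ i, Δ i * w i ^ 2 := by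
    intro w
    rw [low_eq_sum hq, low_eq_sum hq', ← Finset.sum_sub_distrib]
    exact Finset.sum_congr rfl fun i _ => by simp only [Δ]; ring
  -- A is to be the Gram matrix of (x, w) ↦ s(B x, w). With A h = v, the change s(B w, B w) + s(B w,
  -- w) equals (v · w)² + ∑ A_ii w_i², so it is ∑ Δ_i w_i² exactly when A_ii = Δ_i + v_i².
  obtain ⟨A, v, hA, hAd, hAh⟩ : ∃ (A : Matrix _ _ k) (v : _ → k), (∀ i j, A i j = A j i) ∧
      (∀ i, A i i = Δ i + v i ^ 2) ∧ ∀ i, (A *ᵥ h) i = v i := by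
    by_cases h0 : h = 0
    · refine ⟨Matrix.diagonal Δ, 0, fun i j => ?_, fun i => by simp, fun i => by simp [h0]⟩
      by_cases hij : i = j
      · rw [hij]
      · rw [Matrix.diagonal_apply_ne _ hij, Matrix.diagonal_apply_ne _ (Ne.symm hij)]
    · obtain ⟨u, hu⟩ := Function.ne_iff.1 h0
      -- With v supported at u and h · v = y, the compatibility condition reads Δ(h) + y² = y, which
      -- is the hypothesis on the values at h.
      have hv : ∑ i, h i * (Pi.single u (y / h u) : _ → k) i = y := by
        rw [Finset.sum_eq_single u (fun i _ hi => by simp [hi]) (by simp), Pi.single_eq_same]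
        exact mul_div_cancel₀ _ hu
      obtain ⟨A, h1, h3, h4⟩ := exists_symm_matrix (v := Pi.single u (y / h u))
        (e := fun i => Δ i + (Pi.single u (y / h u) : _ → k) i ^ 2) hu (by
          simp only [add_mul, Finset.sum_add_distrib]
          rw [← hΔ, hy, hv]
          have : ∑ i, (Pi.single u (y / h u) : _ → k) i ^ 2 * h i ^ 2 = y ^ 2 := by
            conv_rhs => rw [← hv, CharTwo.sum_sq]
            exact Finset.sum_congr rfl fun i _ => by ring
          rw [this]
          linear_combination y ^ 2 * h2)
      exact ⟨A, _, h1, h3, h4⟩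
  have hnd : (Matrix.toBilin' σ).Nondegenerate :=
    ⟨hs.nondeg, fun x hx => hs.nondeg x fun y => by rw [hs.symm]; exact hx y⟩
  have hB := LinearMap.BilinForm.symmCompOfNondegenerate_left_apply (Matrix.toBilin' A) hnd
  refine (C2coords f n).qIsometric_of_selfAdjoint hs hq hq'
    (B := LinearMap.BilinForm.symmCompOfNondegenerate (Matrix.toBilin' A) _ hnd) fun w => ?_
  rw [hh, hs.symm h, hB, hB, toBilin'_self hA, Matrix.toBilin'_apply', dotProduct]
  simp only [hAh, hAd, add_mul, Finset.sum_add_distrib]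
  rw [← hΔ, CharTwo.sum_sq]
  have : ∑ i, v i ^ 2 * w i ^ 2 = ∑ i, (w i * v i) ^ 2 :=
    Finset.sum_congr rfl fun i _ => by ring
  rw [this]
  linear_combination (∑ i, (w i * v i) ^ 2 + q ((C2coords f n).low w) -
    q' ((C2coords f n).low w)) * h2

/-- The vector `h` with `σ (w, w) = σ (h, w) ^ 2`, whose squared entries are those of `η`. -/
theorem exists_diag_vector [PerfectField k] (hσ : ∀ i j, σ i j = σ j i)
    (hs : IsAdmissible (companionEnd f n) (Matrix.toBilin' σ)) :
    ∃ h : Fin (f ^ n).natDegree ⊕ Fin (f ^ n).natDegree → k,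
      (∀ w, Matrix.toBilin' σ w w = Matrix.toBilin' σ h w ^ 2) ∧ ∀ t, eta σ t t = h t ^ 2 := by
  have : PerfectRing k 2 := PerfectField.toPerfectRing 2
  let v : Fin (f ^ n).natDegree ⊕ Fin (f ^ n).natDegree → k := fun i =>
    (frobeniusEquiv k 2).symm (σ i i)
  have hv : ∀ i, v i ^ 2 = σ i i := fun i => frobeniusEquiv_symm_pow_p k 2 _
  have hnd : (Matrix.toBilin' σ).Nondegenerate :=
    ⟨hs.nondeg, fun x hx => hs.nondeg x fun y => by rw [hs.symm]; exact hx y⟩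
  have hdet : IsUnit σ.det :=
    isUnit_iff_ne_zero.2 (LinearMap.BilinForm.nondegenerate_toBilin'_iff_det_ne_zero.1 hnd)
  -- Indeed σ(w, w) = ∑ σ_ii w_i² is the square of v · w, so h must solve σ h = v.
  refine ⟨σ⁻¹ *ᵥ v, fun w => ?_, fun t => ?_⟩
  · rw [hs.symm (σ⁻¹ *ᵥ v), toBilin'_self hσ, Matrix.toBilin'_apply', Matrix.mulVec_mulVec,
      Matrix.mul_nonsing_inv _ hdet, Matrix.one_mulVec, dotProduct, CharTwo.sum_sq]
    exact Finset.sum_congr rfl fun i _ => by rw [← hv]; ring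
  · rw [eta, diagPart, Matrix.mul_apply, Matrix.mulVec, dotProduct, CharTwo.sum_sq]
    refine Finset.sum_congr rfl fun i _ => ?_
    rw [Matrix.mul_diagonal, Matrix.transpose_apply, mul_pow, hv]
    ring

end Standard

end KleinSymplectic

namespace KleinSymplectic

open PowerSeries (X coeff)

/-! ### The parity condition on the coefficients of a label -/

section Vanishing

variable {K : Type*} [Field K] {n : ℕ}

/-- The coefficients of `g` of index `i < n` with `i ≡ n - 1` modulo two vanish. -/
def Vanishes (n : ℕ) (g : PowerSeries K) : Prop := ∀ i < n, i % 2 = (n - 1) % 2 → coeff i g = 0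

theorem coeff_mul_quadratic (δ : K) (g : PowerSeries K) (i : ℕ) :
    coeff i (g * (PowerSeries.C δ + X + X ^ 2)) =
      δ * coeff i g + (if 1 ≤ i then coeff (i - 1) g else 0) +
        if 2 ≤ i then coeff (i - 2) g else 0 := by
  rw [show g * (PowerSeries.C δ + X + X ^ 2) = PowerSeries.C δ * g + X ^ 1 * g + X ^ 2 * g by ring,
    map_add, map_add, PowerSeries.coeff_C_mul, PowerSeries.coeff_X_pow_mul',
    PowerSeries.coeff_X_pow_mul']

theorem hankel_eq_zero_iff {p : PowerSeries K} :
    hankel n p = 0 ↔ ∀ i < n, coeff i p = 0 := by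
  constructor
  · intro h i hi
    have := congrFun (congrFun h ⟨n - 1, by omega⟩) ⟨i, hi⟩
    simp only [hankel, Matrix.of_apply, Matrix.zero_apply] at this
    rwa [if_pos (by omega), show n - 1 + i + 1 - n = i by omega] at this
  · intro h
    ext a b
    simp only [hankel, Matrix.of_apply, Matrix.zero_apply]
    split_ifs with hab
    · exact h _ (by omega)
    · rfl

namespace Label

variable (l : Label n K)

theorem coeff_phiSeries (i : ℕ) : coeff i l.phiSeries =
    (if i = l.r - 1 then 1 else 0) + ∑ j : Fin l.s, if i = l.r + 2 * (j : ℕ) then l.phi j else 0 := by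
  rw [phiSeries, map_add, map_sum, PowerSeries.coeff_X_pow]
  congr 1
  refine Finset.sum_congr rfl fun j _ => ?_
  rw [PowerSeries.coeff_C_mul, PowerSeries.coeff_X_pow, mul_ite, mul_one, mul_zero]

/-- The exponents in φ separate by parity: the class of r carries the parameters φ_i, while the
class of r - 1 contains only the leading 1. -/
theorem coeff_phiSeries_add (j : ℕ) : coeff (l.r + 2 * j) l.phiSeries =
    if h : j < l.s then l.phi ⟨j, h⟩ else 0 := by
  have hr := l.two_le_r
  rw [coeff_phiSeries, if_neg (by omega), zero_add]
  split_ifs with h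
  · rw [Finset.sum_eq_single ⟨j, h⟩ (fun b _ hb => if_neg fun h' => hb (Fin.ext (by simp; omega)))
      (by simp)]
    simp
  · exact Finset.sum_eq_zero fun b _ => if_neg (by have := b.2; omega)

theorem coeff_phiSeries_sub (j : ℕ) : coeff (l.r - 1 + 2 * j) l.phiSeries =
    if j = 0 then 1 else 0 := by
  have hr := l.two_le_r
  rw [coeff_phiSeries, Finset.sum_eq_zero fun b _ => if_neg (by omega), add_zero]
  congr 1
  simp

theorem coeff_phiSeries_of_lt {i : ℕ} (hi : i < l.r - 1) : coeff i l.phiSeries = 0 := by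
  rw [coeff_phiSeries, if_neg (by omega), Finset.sum_eq_zero fun b _ => if_neg (by omega), add_zero]

theorem coeff_muSeries (i : ℕ) :
    coeff i l.muSeries = if i = l.r + 2 * l.s then 1 else 0 := by
  rw [muSeries, PowerSeries.coeff_X_pow]

theorem φ_eq_zero_iff : l.φ = 0 ↔ l.r = n + 1 := by
  have hr := l.two_le_r
  have hrn := l.r_le
  rw [l.φ_eq, hankel_eq_zero_iff]
  constructor
  · intro h
    by_contra hne
    have h1 := l.coeff_phiSeries_sub 0
    rw [mul_zero, add_zero, h _ (by omega), if_pos rfl] at h1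
    exact zero_ne_one h1
  · exact fun h i hi => l.coeff_phiSeries_of_lt (by omega)

theorem μ_eq_zero_iff : l.μ = 0 ↔ n ≤ l.r + 2 * l.s := by
  rw [l.μ_eq, hankel_eq_zero_iff]
  constructor
  · intro h
    by_contra! hne
    have h1 := l.coeff_muSeries (l.r + 2 * l.s)
    rw [h _ hne, if_pos rfl] at h1
    exact zero_ne_one h1
  · intro h i hi
    rw [coeff_muSeries, if_neg (by omega)]

theorem coeff_phiSeries_mul_sub (δ : K) : coeff (l.r - 1)
    (l.phiSeries * (PowerSeries.C δ + X + X ^ 2)) = δ := by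
  have hr := l.two_le_r
  have h1 := l.coeff_phiSeries_sub 0
  rw [mul_zero, add_zero, if_pos rfl] at h1
  rw [coeff_mul_quadratic, h1, if_pos (by omega), l.coeff_phiSeries_of_lt (by omega)]
  split_ifs
  · rw [l.coeff_phiSeries_of_lt (by omega)]; ring
  · ring

theorem coeff_phiSeries_mul_sub_succ (δ : K) (j : ℕ) : coeff (l.r - 1 + 2 * (j + 1))
    (l.phiSeries * (PowerSeries.C δ + X + X ^ 2)) =
      (if h : j < l.s then l.phi ⟨j, h⟩ else 0) + if j = 0 then 1 else 0 := by
  have hr := l.two_le_r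
  rw [coeff_mul_quadratic, coeff_phiSeries_sub, if_neg (by omega), if_pos (by omega),
    if_pos (by omega), show l.r - 1 + 2 * (j + 1) - 1 = l.r + 2 * j by omega,
    show l.r - 1 + 2 * (j + 1) - 2 = l.r - 1 + 2 * j by omega, coeff_phiSeries_add,
    coeff_phiSeries_sub, mul_zero, zero_add]

theorem coeff_phiSeries_mul_zero (δ : K) : coeff l.r
    (l.phiSeries * (PowerSeries.C δ + X + X ^ 2)) =
      δ * (if h : 0 < l.s then l.phi ⟨0, h⟩ else 0) + 1 := by
  have hr := l.two_le_r
  have h1 := l.coeff_phiSeries_sub 0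
  rw [mul_zero, add_zero, if_pos rfl] at h1
  have h2 := l.coeff_phiSeries_add 0
  rw [mul_zero, add_zero] at h2
  rw [coeff_mul_quadratic, h1, h2, if_pos (by omega), if_pos (by omega),
    l.coeff_phiSeries_of_lt (by omega), add_zero]

theorem coeff_phiSeries_mul_succ (δ : K) (j : ℕ) : coeff (l.r + 2 * (j + 1))
    (l.phiSeries * (PowerSeries.C δ + X + X ^ 2)) =
      δ * (if h : j + 1 < l.s then l.phi ⟨j + 1, h⟩ else 0) +
        if h : j < l.s then l.phi ⟨j, h⟩ else 0 := by
  have hr := l.two_le_r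
  rw [coeff_mul_quadratic, coeff_phiSeries_add, if_pos (by omega), if_pos (by omega),
    show l.r + 2 * (j + 1) - 1 = l.r - 1 + 2 * (j + 1) by omega, coeff_phiSeries_sub,
    if_neg (by omega), show l.r + 2 * (j + 1) - 2 = l.r + 2 * j by omega, coeff_phiSeries_add,
    add_zero]

/-- Suppose X ^ (r + 2s) survives modulo X ^ n. If n + r is even, the tested coefficient of index r
+ 2s + 1 is 1. If n + r is odd, index r + 2s forces δ = 0, but then the coefficient of index r in
the product with φ is 1. -/
theorem le_of_vanishes {δ : K}
    (h : Vanishes n (l.phiSeries * (PowerSeries.C δ + X + X ^ 2)))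
    (h' : Vanishes n (l.muSeries * (PowerSeries.C δ + X + X ^ 2))) : n ≤ l.r + 2 * l.s := by
  have hr := l.two_le_r
  by_contra! hlt
  rcases Nat.mod_two_eq_zero_or_one (n + l.r) with hp | hp
  · have h1 := h' (l.r + 2 * l.s + 1) (by omega) (by omega)
    rw [coeff_mul_quadratic, coeff_muSeries, coeff_muSeries, coeff_muSeries, if_neg (by omega),
      if_pos (by omega), if_pos (by omega), if_pos (by omega), if_neg (by omega)] at h1
    simp at h1
  · have h1 := h' (l.r + 2 * l.s) hlt (by omega)
    rw [coeff_mul_quadratic, coeff_muSeries, coeff_muSeries, coeff_muSeries, if_pos rfl,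
      if_pos (by omega), if_neg (by omega), if_pos (by omega), if_neg (by omega)] at h1
    have h2 := h l.r (by omega) (by omega)
    rw [coeff_phiSeries_mul_zero] at h2
    obtain rfl : δ = 0 := by simpa using h1
    simp at h2

/-- For n + r even the tested indices are r - 1, r + 1, …, with coefficients δ, φ₁ + 1, φ₃, φ₅, ….
For n + r odd they are r, r + 2, …, with coefficients δφ₁ + 1, δφ₃ + φ₁, …, a geometric recursion
that forces δ ≠ 0. -/
theorem vanishes_iff [CharP K 2] {δ : K} :
    Vanishes n (l.phiSeries * (PowerSeries.C δ + X + X ^ 2)) ∧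
      Vanishes n (l.muSeries * (PowerSeries.C δ + X + X ^ 2)) ↔
    l.μ = 0 ∧ (l.φ = 0 ∨ (Even (n + l.r) ∧ δ = 0 ∧
      ∀ j : Fin l.s, l.phi j = if (j : ℕ) = 0 then 1 else 0) ∨
      (Odd (n + l.r) ∧ δ ≠ 0 ∧ ∀ j : Fin l.s, l.phi j = (δ ^ ((j : ℕ) + 1))⁻¹)) := by
  have hr := l.two_le_r
  have hrn := l.r_le
  have hs := l.s_le
  rw [l.φ_eq_zero_iff, l.μ_eq_zero_iff]
  constructor
  · rintro ⟨h, h'⟩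
    have hle := l.le_of_vanishes h h'
    refine ⟨hle, ?_⟩
    by_cases hrn' : l.r = n + 1
    · exact .inl hrn'
    refine .inr ?_
    rcases Nat.even_or_odd (n + l.r) with hp | hp
    · refine .inl ⟨hp, ?_, fun j => ?_⟩
      · rw [Nat.even_iff] at hp
        have h1 := h (l.r - 1) (by omega) (by omega)
        rwa [coeff_phiSeries_mul_sub] at h1
      · rw [Nat.even_iff] at hp
        have hj := j.2
        -- The bound r + 2s ≤ n + 1 only puts this index at most at n; the parity of n + r excludes
        -- n itself.
        have h1 := h (l.r - 1 + 2 * (j + 1)) (by omega) (by omega)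
        rw [coeff_phiSeries_mul_sub_succ, dif_pos j.2] at h1
        exact CharTwo.add_eq_zero.1 h1
    · have hp' := Nat.odd_iff.1 hp
      have h1 := h l.r (by omega) (by omega)
      rw [coeff_phiSeries_mul_zero, CharTwo.add_eq_zero] at h1
      have hδ : δ ≠ 0 := by rintro rfl; simp at h1
      refine .inr ⟨hp, hδ, ?_⟩
      have key : ∀ (j : ℕ) (hj : j < l.s), l.phi ⟨j, hj⟩ = (δ ^ (j + 1))⁻¹ := by
        intro j
        induction j with
        | zero =>
          intro hj
          rw [dif_pos hj] at h1
          rw [zero_add, pow_one]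
          exact eq_inv_of_mul_eq_one_right h1
        | succ j ih =>
          intro hj
          have h2 := h (l.r + 2 * (j + 1)) (by omega) (by omega)
          rw [coeff_phiSeries_mul_succ, dif_pos hj, dif_pos (by omega), ih (by omega),
            CharTwo.add_eq_zero] at h2
          rw [pow_succ, mul_inv, ← h2, mul_right_comm, mul_inv_cancel₀ hδ, one_mul]
      exact fun j => key j j.2
  · rintro ⟨hle, h⟩
    refine ⟨?_, fun i hi _ => ?_⟩
    · have hlow : ∀ i < l.r - 1, coeff i (l.phiSeries * (PowerSeries.C δ + X + X ^ 2)) = 0 := by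
        intro i hi
        rw [coeff_mul_quadratic, l.coeff_phiSeries_of_lt hi]
        split_ifs <;>
          simp only [l.coeff_phiSeries_of_lt (show i - 1 < l.r - 1 by omega),
            l.coeff_phiSeries_of_lt (show i - 2 < l.r - 1 by omega), mul_zero, add_zero]
      intro i hi hpar
      by_cases hir : i < l.r - 1
      · exact hlow i hir
      rcases h with h | ⟨hp, rfl, h⟩ | ⟨hp, hδ, h⟩
      · omega
      · rw [Nat.even_iff] at hp
        obtain ⟨j, rfl⟩ : ∃ j, i = l.r - 1 + 2 * j := ⟨(i - (l.r - 1)) / 2, by omega⟩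
        rcases j with _ | j
        · exact l.coeff_phiSeries_mul_sub 0
        · rw [coeff_phiSeries_mul_sub_succ, dif_pos (by omega), h]
          exact CharTwo.add_self_eq_zero _
      · rw [Nat.odd_iff] at hp
        obtain ⟨j, rfl⟩ : ∃ j, i = l.r + 2 * j := ⟨(i - l.r) / 2, by omega⟩
        rcases j with _ | j
        · rw [mul_zero, add_zero, coeff_phiSeries_mul_zero, dif_pos (by omega), h, zero_add, pow_one,
            mul_inv_cancel₀ hδ]
          exact CharTwo.add_self_eq_zero _
        · rw [coeff_phiSeries_mul_succ, dif_pos (by omega), dif_pos (by omega), h, h]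
          simp only
          rw [pow_succ δ (j + 1), mul_inv, mul_left_comm, mul_inv_cancel₀ hδ, mul_one]
          exact CharTwo.add_self_eq_zero _
    · have hne : ∀ j ≤ i, coeff j l.muSeries = 0 := fun j hj => by
        rw [coeff_muSeries, if_neg (by omega)]
      rw [coeff_mul_quadratic, hne i le_rfl, hne _ (Nat.sub_le i 1), hne _ (Nat.sub_le i 2)]
      simp

/-- A nonzero φ could still give an alternating s, but not once an invariant quadratic form exists:
the parity condition would kill either the leading 1 or φ₁, and δφ₁ = 1 in the second case. -/
theorem not_vanishes {δ : K} (h : Vanishes n (l.phiSeries * (PowerSeries.C δ + X + X ^ 2)))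
    (hφ : l.φ ≠ 0) : ¬ Vanishes n l.phiSeries := by
  have hr := l.two_le_r
  have hrn := l.r_le
  rw [ne_eq, l.φ_eq_zero_iff] at hφ
  intro h'
  rcases Nat.mod_two_eq_zero_or_one (n + l.r) with hp | hp
  · have h1 := h' (l.r - 1) (by omega) (by omega)
    have h2 := l.coeff_phiSeries_sub 0
    rw [mul_zero, add_zero, h1, if_pos rfl] at h2
    exact zero_ne_one h2
  · have h1 := h' l.r (by omega) (by omega)
    have h2 := l.coeff_phiSeries_add 0
    rw [mul_zero, add_zero, h1] at h2
    have h3 := h l.r (by omega) (by omega)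
    rw [coeff_phiSeries_mul_zero, ← h2, mul_zero, zero_add] at h3
    exact one_ne_zero h3

end Label

/-- Squares have only even-degree terms, so p² pairs the top coefficient only with coefficients of g
of index ≡ n - 1 modulo 2. Conversely p = √y · X ^ j isolates each of these, and the trace form
detects it. -/
theorem lam_proj_mul_sq_eq_zero_iff (k : Type*) [Field k] [Algebra k K] [CharP K 2]
    [PerfectRing K 2] [FiniteDimensional k K] [Algebra.IsSeparable k K] (hn : 1 ≤ n)
    (g : PowerSeries K) : (∀ p : PowerSeries K,
      TruncSeries.lam k hn (TruncSeries.proj K n (g * p ^ 2)) = 0) ↔ Vanishes n g := by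
  constructor
  · intro h i hi hpar
    refine TruncSeries.trace_nondeg k fun y => ?_
    obtain ⟨j, hj⟩ : ∃ j, n - 1 = i + 2 * j := ⟨(n - 1 - i) / 2, by omega⟩
    have h1 := h (PowerSeries.C ((frobeniusEquiv K 2).symm y) * X ^ j)
    rw [mul_pow, ← map_pow, frobeniusEquiv_symm_pow_p, mul_left_comm, TruncSeries.lam_proj, hj,
      PowerSeries.coeff_C_mul, ← pow_mul, mul_comm j, PowerSeries.coeff_mul_X_pow, mul_comm] at h1
    exact h1
  · intro h p
    rw [TruncSeries.lam_proj, PowerSeries.coeff_mul]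
    rw [Finset.sum_eq_zero, map_zero]
    rintro ⟨i, j⟩ hij
    rw [Finset.HasAntidiagonal.mem_antidiagonal] at hij
    simp only at hij ⊢
    rcases Nat.even_or_odd' j with ⟨m, rfl | rfl⟩
    · rw [h i (by omega) (by omega), zero_mul]
    · rw [coeff_sq_two_mul_add_one, mul_zero]

end Vanishing

end KleinSymplectic

namespace KleinSymplectic

open PowerSeries (X)
open Matrix
open scoped Polynomial

/-! ### Quadratic forms attached to a label -/

section Quadratic

variable {k : Type*} [Field k] [CharP k 2] {K : Type*} [Field K] [Algebra k K]
  {f : k[X]} {n : ℕ} {ε : K}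

theorem eq_X_or_eq_X_add_one_iff (hf : f.Monic) (hirr : Irreducible f)
    (hε : Polynomial.aeval ε f = 0) :
    (f = Polynomial.X ∨ f = Polynomial.X + 1) ↔ ε + ε ^ 2 = 0 := by
  have : CharP K 2 := charP_of_injective_algebraMap (algebraMap k K).injective 2
  constructor
  · rintro (rfl | rfl)
    · rw [Polynomial.aeval_X] at hε
      rw [hε]; ring
    · rw [map_add, Polynomial.aeval_X, map_one] at hε
      linear_combination ε * hε
  · intro h
    rw [minpoly.eq_of_irreducible_of_monic hirr hε hf]
    have h' : ε * (ε + 1) = 0 := by linear_combination h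
    rcases mul_eq_zero.1 h' with h0 | h0
    · left; rw [h0, minpoly.zero]
    · right
      rw [CharTwo.add_eq_zero.1 h0, minpoly.one]
      exact CharTwo.sub_eq_add _ _

theorem isFullSetOfReps_Q_zero {σ : Matrix (Fin (f ^ n).natDegree ⊕ Fin (f ^ n).natDegree)
      (Fin (f ^ n).natDegree ⊕ Fin (f ^ n).natDegree) k} (hσ : ∀ i j, σ i j = σ j i)
    (hs : IsAdmissible (companionEnd f n) (Matrix.toBilin' σ))
    (hT : ∀ w, Matrix.toBilin' σ (companionEnd f n w) (companionEnd f n w) =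
      Matrix.toBilin' σ (companionEnd f n w) w) (h0 : ∀ w, Matrix.toBilin' σ w w = 0) :
    IsFullSetOfReps {q | IsInvariantQuadratic (C2 f n) (S σ) q} (QIsometric (C2 f n))
      (fun _ : Unit => Q σ 0) := by
  have hQ : IsInvariantQuadratic (C2 f n) (S σ) (Q σ 0) := by
    rw [← Matrix.diagonal_zero]
    exact isInvariantQuadratic_Q hσ hs hT 0
  refine ⟨fun _ => hQ, fun q hq => ⟨(), ?_, fun _ _ => rfl⟩⟩
  -- When s is alternating, h = 0 and the invariant is always zero, so there is a single class.
  refine (qIsometric_iff hs (h := 0) (fun w => ?_) hq hQ).2 ⟨0, ?_⟩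
  · rw [h0]; simp
  · have : (C2coords f n).low 0 = 0 := by simp [Coords.low]
    rw [this]; simp

variable [PerfectField k]

theorem isAdmissible_sigma_label (hf : f.Monic) (hirr : Irreducible f) (hn : 1 ≤ n)
    (hε : Polynomial.aeval ε f = 0) (hK : Algebra.adjoin k {ε} = ⊤) (l : Label n K) :
    IsAdmissible (companionEnd f n)
      (Matrix.toBilin' (sigma k (f ^ n).natDegree ε l.φ l.ψ l.μ)) := by
  have : CharP K 2 := charP_of_injective_algebraMap (algebraMap k K).injective 2
  rw [toBilin'_sigma_label hf hirr hn hε hK]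
  exact RingCoords.isAdmissible_form _ l.isUnit_det

theorem sigma_label_symm (hf : f.Monic) (hirr : Irreducible f) (hn : 1 ≤ n)
    (hε : Polynomial.aeval ε f = 0) (hK : Algebra.adjoin k {ε} = ⊤) (l : Label n K)
    (i j : Fin (f ^ n).natDegree ⊕ Fin (f ^ n).natDegree) :
    sigma k (f ^ n).natDegree ε l.φ l.ψ l.μ i j = sigma k (f ^ n).natDegree ε l.φ l.ψ l.μ j i := by
  have h := (isAdmissible_sigma_label hf hirr hn hε hK l).symm (Pi.single i 1) (Pi.single j 1)
  rwa [Matrix.toBilin'_single, Matrix.toBilin'_single] at h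

/-- A diagonal quadratic form on the square of `K[X] / (X ^ n)` vanishes if and only if both of
its coefficients satisfy a parity condition. -/
theorem forall_lam_eq_zero_iff (hf : f.Monic) (hirr : Irreducible f) (hn : 1 ≤ n)
    (hε : Polynomial.aeval ε f = 0) (hK : Algebra.adjoin k {ε} = ⊤) (g g' : PowerSeries K) :
    (∀ w, TruncSeries.lam k hn (TruncSeries.proj K n g * ((C2ringCoords hf hirr hn hε hK).θ w).1 ^ 2
      + TruncSeries.proj K n g' * ((C2ringCoords hf hirr hn hε hK).θ w).2 ^ 2) = 0) ↔
    Vanishes n g ∧ Vanishes n g' := by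
  have : CharP K 2 := charP_of_injective_algebraMap (algebraMap k K).injective 2
  have := (finrank_eq_natDegree hf hirr hε hK).1
  have := perfectRing_of_finiteDimensional (k := k) (K := K)
  rw [← lam_proj_mul_sq_eq_zero_iff k hn g, ← lam_proj_mul_sq_eq_zero_iff k hn g']
  constructor
  · intro h
    constructor
    · intro p
      simpa using h ((C2ringCoords hf hirr hn hε hK).θ.symm (TruncSeries.proj K n p, 0))
    · intro p
      simpa using h ((C2ringCoords hf hirr hn hε hK).θ.symm (0, TruncSeries.proj K n p))
  · rintro ⟨h, h'⟩ w
    obtain ⟨p, hp⟩ := TruncSeries.proj_surjective ((C2ringCoords hf hirr hn hε hK).θ w).1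
    obtain ⟨p', hp'⟩ := TruncSeries.proj_surjective ((C2ringCoords hf hirr hn hε hK).θ w).2
    rw [← hp, ← hp', ← map_pow, ← map_pow, ← map_mul, ← map_mul, map_add, h, h', add_zero]

theorem forall_toBilin'_self_eq_zero_iff (hf : f.Monic) (hirr : Irreducible f) (hn : 1 ≤ n)
    (hε : Polynomial.aeval ε f = 0) (hK : Algebra.adjoin k {ε} = ⊤) (l : Label n K) :
    (∀ w, Matrix.toBilin' (sigma k (f ^ n).natDegree ε l.φ l.ψ l.μ) w w = 0) ↔
      Vanishes n l.phiSeries ∧ Vanishes n l.muSeries := by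
  have : CharP K 2 := charP_of_injective_algebraMap (algebraMap k K).injective 2
  have := TruncSeries.charP (K := K) hn
  rw [← forall_lam_eq_zero_iff hf hirr hn hε hK, toBilin'_sigma_label hf hirr hn hε hK]
  refine forall_congr' fun w => ?_
  rw [RingCoords.form_apply, bil]
  change TruncSeries.lam k hn _ = 0 ↔ _
  have h2 : (2 : TruncSeries K n) = 0 := CharTwo.two_eq_zero
  congr! 2
  linear_combination TruncSeries.proj K n l.psiSeries * ((C2ringCoords hf hirr hn hε hK).θ w).1 *
    ((C2ringCoords hf hirr hn hε hK).θ w).2 * h2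

/-- The difference is lam of (τ² - τ)(φx² + μy²), the cross terms being doubled, and τ² - τ = (ε +
ε²) + X + X² in characteristic two. -/
theorem forall_toBilin'_companionEnd_iff (hf : f.Monic) (hirr : Irreducible f) (hn : 1 ≤ n)
    (hε : Polynomial.aeval ε f = 0) (hK : Algebra.adjoin k {ε} = ⊤) (l : Label n K) :
    (∀ w, Matrix.toBilin' (sigma k (f ^ n).natDegree ε l.φ l.ψ l.μ) (companionEnd f n w)
        (companionEnd f n w) =
      Matrix.toBilin' (sigma k (f ^ n).natDegree ε l.φ l.ψ l.μ) (companionEnd f n w) w) ↔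
      Vanishes n (l.phiSeries * (PowerSeries.C (ε + ε ^ 2) + X + X ^ 2)) ∧
      Vanishes n (l.muSeries * (PowerSeries.C (ε + ε ^ 2) + X + X ^ 2)) := by
  have : CharP K 2 := charP_of_injective_algebraMap (algebraMap k K).injective 2
  have := TruncSeries.charP (K := K) hn
  have h2 : (2 : TruncSeries K n) = 0 := CharTwo.two_eq_zero
  have hτ : TruncSeries.proj K n (PowerSeries.C (ε + ε ^ 2) + X + X ^ 2) =
      tau n ε ^ 2 - tau n ε := by
    simp only [tau, gen, map_add, map_pow]
    linear_combination (TruncSeries.proj K n (PowerSeries.C ε) + TruncSeries.proj K n X -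
      TruncSeries.proj K n (PowerSeries.C ε) * TruncSeries.proj K n X) * h2
  rw [← forall_lam_eq_zero_iff hf hirr hn hε hK, toBilin'_sigma_label hf hirr hn hε hK]
  refine forall_congr' fun w => ?_
  rw [RingCoords.form_apply, RingCoords.form_apply, RingCoords.θ_apply, ← sub_eq_zero, ← map_sub,
    map_mul, map_mul, hτ]
  change TruncSeries.lam k hn _ = 0 ↔ _
  congr! 2
  simp only [bil, Prod.smul_fst, Prod.smul_snd, smul_eq_mul]
  change _ * (tau n ε * _ * (tau n ε * _)) + _ * (tau n ε * _ * (tau n ε * _) +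
    tau n ε * _ * (tau n ε * _)) + _ * (tau n ε * _ * (tau n ε * _)) -
    (_ * (tau n ε * _ * _) + _ * (tau n ε * _ * _ + tau n ε * _ * _) + _ * (tau n ε * _ * _)) = _
  linear_combination (tau n ε ^ 2 - tau n ε) * TruncSeries.proj K n l.psiSeries *
    ((C2ringCoords hf hirr hn hε hK).θ w).1 * ((C2ringCoords hf hirr hn hε hK).θ w).2 * h2

theorem isFullSetOfReps_Q_single {σ : Matrix (Fin (f ^ n).natDegree ⊕ Fin (f ^ n).natDegree)
      (Fin (f ^ n).natDegree ⊕ Fin (f ^ n).natDegree) k} (hσ : ∀ i j, σ i j = σ j i)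
    (hs : IsAdmissible (companionEnd f n) (Matrix.toBilin' σ))
    (hT : ∀ w, Matrix.toBilin' σ (companionEnd f n w) (companionEnd f n w) =
      Matrix.toBilin' σ (companionEnd f n w) w) {P : Set k} (hP : IsArtinSchreierReps P)
    {t : Fin (f ^ n).natDegree ⊕ Fin (f ^ n).natDegree} (ht : eta σ t t ≠ 0) :
    IsFullSetOfReps {q | IsInvariantQuadratic (C2 f n) (S σ) q} (QIsometric (C2 f n))
      (fun x : P => Q σ (Matrix.single t t ((eta σ t t)⁻¹ * x))) := by
  obtain ⟨h, hh, hη⟩ := exists_diag_vector hσ hs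
  have hQ : ∀ x : k, IsInvariantQuadratic (C2 f n) (S σ)
      (Q σ (Matrix.single t t ((eta σ t t)⁻¹ * x))) := fun x => by
    rw [← Matrix.diagonal_single]
    exact isInvariantQuadratic_Q hσ hs hT _
  -- The factor η_tt⁻¹ normalises the invariant: the value at h is η_tt⁻¹ x h_t², and h_t² = η_tt.
  have hval : ∀ x : k, Q σ (Matrix.single t t ((eta σ t t)⁻¹ * x)) ((C2coords f n).low h) = x := by
    intro x
    rw [← Matrix.diagonal_single, Q_low, Finset.sum_eq_single t (fun i _ hi => by simp [hi])
      (by simp), Pi.single_eq_same, ← hη, mul_right_comm, inv_mul_cancel₀ ht, one_mul]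
  refine ⟨fun x => hQ x, fun q hq => ?_⟩
  obtain ⟨p, ⟨hp, hpx⟩, huniq⟩ := hP (q ((C2coords f n).low h))
  refine ⟨⟨p, hp⟩, (qIsometric_iff hs hh hq (hQ p)).2 (by rwa [hval]), ?_⟩
  rintro ⟨p', hp'⟩ hiso
  have h1 := (qIsometric_iff hs hh hq (hQ p')).1 hiso
  rw [hval] at h1
  exact Subtype.ext (huniq p' ⟨hp', h1⟩)

theorem exists_eta_ne_zero {σ : Matrix (Fin (f ^ n).natDegree ⊕ Fin (f ^ n).natDegree)
      (Fin (f ^ n).natDegree ⊕ Fin (f ^ n).natDegree) k} (hσ : ∀ i j, σ i j = σ j i)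
    (hs : IsAdmissible (companionEnd f n) (Matrix.toBilin' σ))
    (h0 : ¬ ∀ w, Matrix.toBilin' σ w w = 0) : ∃ t, eta σ t t ≠ 0 := by
  obtain ⟨h, hh, hη⟩ := exists_diag_vector hσ hs
  by_contra! hne
  have : h = 0 := funext fun t => pow_eq_zero_iff two_ne_zero |>.1 ((hη t).symm.trans (hne t))
  exact h0 fun w => by rw [hh, this]; simp

end Quadratic

end KleinSymplectic

end

open KleinSymplectic in
theorem theorem3 {k : Type*} [Field k] [CharP k 2] [PerfectField k]
    (f : Polynomial k) (hf : f.Monic) (hirr : Irreducible f) (n : ℕ) (hn : 1 ≤ n)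
    {K : Type*} [Field K] [Algebra k K] (ε : K) (hε : Polynomial.aeval ε f = 0)
    (hK : Algebra.adjoin k {ε} = ⊤)
    (P : Set k) (hP : IsArtinSchreierReps P) :
    -- the forms `S(φ, ψ, μ)` with `(φ, ψ, μ) ∈ 𝒦` represent the isometry classes
    IsFullSetOfReps {B | IsIndecomposableSymplectic (C2 f n) B} (Isometric (C2 f n))
      (fun T : calK n K => S (sigma k (f ^ n).natDegree ε T.1.1 T.1.2.1 T.1.2.2)) ∧
    -- different labels `(r, s, φ, ψ)` give different triples in `𝒦`
    Function.Injective (fun l : Label n K => (l.φ, l.ψ, l.μ)) ∧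
    -- the number of isometry classes over a finite field
    (Finite k →
      Nat.card (IsometryClass (C2 f n)) =
        if Even n then n * Nat.card k ^ (f.natDegree * ((n - 2) / 2))
        else (n + 1) / 2 * Nat.card k ^ (f.natDegree * ((n - 1) / 2)) +
          (n - 1) / 2 * Nat.card k ^ (f.natDegree * ((n - 3) / 2))) ∧
    -- quadratic forms
    ∀ (l : Label n K) (σ : Matrix (Fin (f ^ n).natDegree ⊕ Fin (f ^ n).natDegree)
        (Fin (f ^ n).natDegree ⊕ Fin (f ^ n).natDegree) k),
      σ = sigma k (f ^ n).natDegree ε l.φ l.ψ l.μ →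
      -- existence
      ((∃ q, IsInvariantQuadratic (C2 f n) (S σ) q) ↔
        l.μ = 0 ∧
          (l.φ = 0 ∨
            (Even (n + l.r) ∧ (f = Polynomial.X ∨ f = Polynomial.X + 1) ∧
              ∀ j : Fin l.s, l.phi j = if (j : ℕ) = 0 then 1 else 0) ∨
            (Odd (n + l.r) ∧ ¬ (f = Polynomial.X ∨ f = Polynomial.X + 1) ∧
              ∀ j : Fin l.s, l.phi j = ((ε + ε ^ 2) ^ ((j : ℕ) + 1))⁻¹))) ∧
      ((∃ q, IsInvariantQuadratic (C2 f n) (S σ) q) →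
        -- all such forms
        {q | IsInvariantQuadratic (C2 f n) (S σ) q} =
            Set.range (fun D' : Fin (f ^ n).natDegree ⊕ Fin (f ^ n).natDegree → k =>
              Q σ (Matrix.diagonal D')) ∧
        -- their isometry classes
        (l.φ = 0 ∧ l.μ = 0 →
          IsFullSetOfReps {q | IsInvariantQuadratic (C2 f n) (S σ) q} (QIsometric (C2 f n))
            (fun _ : Unit => Q σ 0)) ∧
        (¬ (l.φ = 0 ∧ l.μ = 0) →
          (∃ t, eta σ t t ≠ 0) ∧
          ∀ t, eta σ t t ≠ 0 →
            IsFullSetOfReps {q | IsInvariantQuadratic (C2 f n) (S σ) q} (QIsometric (C2 f n))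
              (fun x : P => Q σ (Matrix.single t t ((eta σ t t)⁻¹ * x))))) := by
  have : CharP K 2 := charP_of_injective_algebraMap (algebraMap k K).injective 2
  obtain ⟨hfin, hrank⟩ := finrank_eq_natDegree hf hirr hε hK
  refine ⟨isFullSetOfReps_S_label hf hirr hn hε hK, label_triple_injective hf hirr hn hε hK,
    fun hk => ?_, ?_⟩
  · have : Finite K := Module.finite_of_finite k
    have hcard : Nat.card K = Nat.card k ^ f.natDegree := by
      rw [← hrank, Module.natCard_eq_pow_finrank (K := k)]
    rw [natCard_isometryClass hf hirr hn hε hK, natCard_label hn, hcard]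
    simp only [pow_mul]
  · rintro l σ rfl
    have hσ := sigma_label_symm hf hirr hn hε hK l
    have hs := isAdmissible_sigma_label hf hirr hn hε hK l
    have hiff := exists_isInvariantQuadratic_iff hσ hs
    have hiff' := hiff.trans ((forall_toBilin'_companionEnd_iff hf hirr hn hε hK l).trans
      l.vanishes_iff)
    refine ⟨?_, fun hex => ?_⟩
    · rw [eq_X_or_eq_X_add_one_iff hf hirr hε]
      exact hiff'
    · have hT := hiff.1 hex
      refine ⟨setOf_isInvariantQuadratic_eq hσ hs hT, fun h0 => ?_, fun h0 => ⟨?_, fun t ht =>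
        isFullSetOfReps_Q_single hσ hs hT hP ht⟩⟩
      · refine isFullSetOfReps_Q_zero hσ hs hT ((forall_toBilin'_self_eq_zero_iff hf hirr hn hε hK
          l).2 ?_)
        rw [l.φ_eq, l.μ_eq, hankel_eq_zero_iff, hankel_eq_zero_iff] at h0
        exact ⟨fun i hi _ => h0.1 i hi, fun i hi _ => h0.2 i hi⟩
      -- Existence gives μ = 0, hence φ ≠ 0 here, and `not_vanishes` shows that s is not
      -- alternating, so h and with it the diagonal of η are nonzero.
      · refine exists_eta_ne_zero hσ hs fun h => ?_
        exact l.not_vanishes ((forall_toBilin'_companionEnd_iff hf hirr hn hε hK l).1 hT).1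
          (fun hφ => h0 ⟨hφ, (hiff'.1 hex).1⟩)
          ((forall_toBilin'_self_eq_zero_iff hf hirr hn hε hK l).1 h).1
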